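/- For each $n\in\mathbb N$ let $\mathcal D_n$ be an arbitrary probability distribution over pairs $(H,t)$, where $H$ is a Hermitian operator on $n$ qubits (a Hamiltonian) and $t\in\mathbb R$ an evolution time, and let $\mathcal E_n=\{e^{-iHt} : (H,t)\sim\mathcal D_n\}$ be the resulting ensemble of random unitaries in $U(2^n)$. Let $q:\mathbb N\to\mathbb N$. Suppose that one of the following holds. 1. (One-dimensional systems.) For every $n$, almost every $H$ drawn from $\mathcal D_n$ is a real linear combination of $n$-qubit Pauli strings each of which acts non-trivially only within some window of $q(n)$ consecutive sites (of an open chain or a ring of $n$ sites), and $q(n)=\mathcal O(\log n)$. 2. (All-to-all connected systems.) For every $n$, almost every $H$ drawn from $\mathcal D_n$ is a real linear combination of $n$-qubit Pauli strings of weight at most $q(n)$, and $q(n)=\mathcal O(1)$. Then $\mathcal E=(\mathcal E_n)_n$ is not a pseudorandom unitary (PRU) with security against polynomial-time quantum adversaries. Here a quantum adversary $\mathcal A$ is a family of quantum circuits that may apply the unknown $n$-qubit unitary $U$ as a gate, at any places in the circuit, and that output one measured bit; it is polynomial-time if the circuit for $n$ has polynomially many qubits and its description can be computed from $n$ in time polynomial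 in $n$; and $\mathcal E$ is a PRU if for every polynomial-time $\mathcal A$ the advantage $$\Bigl|\,\mathbb E_{U\sim\mathcal E_n}\Pr[\mathcal A^U=1]-\mathbb E_{U\sim\mathrm{Haar}(2^n)}\Pr[\mathcal A^U=1]\,\Bigr|$$ is negligible, i.e. decays faster than every inverse polynomial in $n$. In fact there is a polynomial-time adversary that makes only two queries to $U$, in parallel, and whose advantage is not negligible. -/

import Mathlib

open MeasureTheory Filter

noncomputable section

namespace NoGoPRU

/-! ### Qubits, unitaries and the Haar measure -/

/-- Bit strings of length `n`: the labels of the computational basis of `n` qubits. -/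
abbrev Bits (n : ℕ) : Type := Fin n → Fin 2

/-- Operators on `n` qubits. -/
abbrev Op (n : ℕ) : Type := Matrix (Bits n) (Bits n) ℂ

/-- The unitary group `U(2^n)`. -/
abbrev UGroup (n : ℕ) : Type := Matrix.unitaryGroup (Bits n) ℂ

instance instMeasurableSpaceUGroup (n : ℕ) : MeasurableSpace (UGroup n) := borel _

instance instBorelSpaceUGroup (n : ℕ) : BorelSpace (UGroup n) := ⟨rfl⟩

instance instCompactSpaceUGroup (n : ℕ) : CompactSpace (UGroup n) := by
  apply isCompact_iff_compactSpace.mp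
  have hK : IsCompact
      (Set.univ.pi fun _ : Bits n => Set.univ.pi fun _ : Bits n =>
        Metric.closedBall (0 : ℂ) 1) :=
    isCompact_univ_pi fun _ => isCompact_univ_pi fun _ => isCompact_closedBall 0 1
  have hc : IsClosed ((Matrix.unitaryGroup (Bits n) ℂ : Set (Op n))) := by
    have : ((Matrix.unitaryGroup (Bits n) ℂ : Set (Op n)))
        = {A : Op n | A * A.conjTranspose = 1} := by
      ext A
      exact Matrix.mem_unitaryGroup_iff
    rw [this]
    exact isClosed_eq (continuous_id.matrix_mul continuous_id.matrix_conjTranspose)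
      continuous_const
  refine hK.of_isClosed_subset hc fun A hA => ?_
  intro i _ j _
  rw [mem_closedBall_zero_iff]
  exact entry_norm_bound_of_unitary hA i j

/-- The Haar probability measure on `U(2^n)`. -/
def haar (n : ℕ) : Measure (UGroup n) := Measure.haarMeasure ⊤

/-! ### Local Hamiltonians and their time evolution -/

/-- Hamiltonians on `n` qubits: Hermitian matrices, with their Borel σ-algebra. -/
abbrev Hamiltonian (n : ℕ) : Type := selfAdjoint (Op n)

instance instMeasurableSpaceHamiltonian (n : ℕ) : MeasurableSpace (Hamiltonian n) := borel _

instance instBorelSpaceHamiltonian (n : ℕ) : BorelSpace (Hamiltonian n) := ⟨rfl⟩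

/-- The single-qubit Pauli labels. -/
inductive Pauli
  | I
  | X
  | Y
  | Z
  deriving DecidableEq

instance instFintypePauli : Fintype Pauli :=
  ⟨{Pauli.I, Pauli.X, Pauli.Y, Pauli.Z}, fun a => by cases a <;> decide⟩

/-- The single-qubit Pauli matrices. -/
def Pauli.mat : Pauli → Matrix (Fin 2) (Fin 2) ℂ
  | .I => !![1, 0; 0, 1]
  | .X => !![0, 1; 1, 0]
  | .Y => !![0, -Complex.I; Complex.I, 0]
  | .Z => !![1, 0; 0, -1]

/-- Pauli strings on `n` qubits. -/
abbrev PauliString (n : ℕ) : Type := Fin n → Pauli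

/-- The tensor product of the Pauli matrices of a Pauli string. -/
def PauliString.toOp {n : ℕ} (P : PauliString n) : Op n :=
  Matrix.of fun x y => ∏ i, (P i).mat (x i) (y i)

/-- The number of qubits on which a Pauli string acts non-trivially. -/
def PauliString.weight {n : ℕ} (P : PauliString n) : ℕ :=
  (Finset.univ.filter fun i => P i ≠ Pauli.I).card

/-- The Pauli string acts non-trivially only inside some window of `q` consecutive sites
`a, a + 1, …, a + q - 1`. Sites are read modulo `n`, so that both the open chain (windows that do
not wrap around) and the ring are covered. -/
def PauliString.InWindow {n : ℕ} (q : ℕ) (P : PauliString n) : Prop :=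
  ∃ a : ℕ, ∀ i : Fin n, P i ≠ Pauli.I → ∃ j < q, (i : ℕ) = (a + j) % n

/-- `H = ∑ h_P P` with real coefficients, where all Pauli strings that appear satisfy `S`. -/
def IsPauliSum {n : ℕ} (S : PauliString n → Prop) (H : Hamiltonian n) : Prop :=
  ∃ h : PauliString n → ℝ, (∀ P, h P ≠ 0 → S P) ∧
    (H : Op n) = ∑ P, (h P : ℂ) • PauliString.toOp P

/-- `q`-local Hamiltonians with all-to-all connectivity. -/
def IsLocal {n : ℕ} (q : ℕ) (H : Hamiltonian n) : Prop :=
  IsPauliSum (fun P => PauliString.weight P ≤ q) H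

/-- Geometrically `q`-local Hamiltonians in one dimension. -/
def IsLocal1D {n : ℕ} (q : ℕ) (H : Hamiltonian n) : Prop :=
  IsPauliSum (PauliString.InWindow q) H

/-- The time-evolution operator `exp(-i H t)`. -/
def evolution {n : ℕ} (p : Hamiltonian n × ℝ) : UGroup n :=
  ⟨NormedSpace.exp ((-(Complex.I * (p.2 : ℂ))) • (p.1 : Op n)), by
    have hH : ((p.1 : Op n)).conjTranspose = (p.1 : Op n) := p.1.2
    rw [Matrix.mem_unitaryGroup_iff, Matrix.star_eq_conjTranspose, ← Matrix.exp_conjTranspose,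
      Matrix.conjTranspose_smul, hH]
    have hs : star (-(Complex.I * (p.2 : ℂ))) = -(-(Complex.I * (p.2 : ℂ))) := by
      simp
    rw [hs, neg_smul (-(Complex.I * (p.2 : ℂ))), ← Matrix.exp_add_of_commute _ _
      (Commute.neg_right (Commute.refl ((-(Complex.I * (p.2 : ℂ))) • (p.1 : Op n)))), add_neg_cancel, NormedSpace.exp_zero]⟩

/-- The unitary ensemble `{exp(-i H t) | (H, t) ∼ D}`, as a measure on the unitary group. -/
def evolutionEnsemble {n : ℕ} (D : Measure (Hamiltonian n × ℝ)) : Measure (UGroup n) :=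
  D.map evolution

/-! ### Quantum circuits with oracle queries -/

/-- The elementary operations of a circuit: a universal finite gate set, and a query to the
unknown `n`-qubit unitary. -/
inductive GateKind
  | X
  | H
  | T
  | CNOT
  | Toffoli
  | query
  deriving DecidableEq

/-- The number of wires on which an operation acts. -/
@[reducible]
def GateKind.arity (n : ℕ) : GateKind → ℕ
  | .X => 1
  | .H => 1
  | .T => 1
  | .CNOT => 2
  | .Toffoli => 3
  | .query => n

/-- The matrix of an operation, where `U` is the unknown unitary. Addition and multiplication of
bits are modulo 2. -/
def GateKind.matrix {n : ℕ} (U : UGroup n) : (k : GateKind) → Op (k.arity n)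
  | .X => Matrix.of fun (x y : Bits 1) => (!![0, 1; 1, 0] : Matrix (Fin 2) (Fin 2) ℂ) (x 0) (y 0)
  | .H => Matrix.of fun (x y : Bits 1) =>
      ((1 / Real.sqrt 2 : ℝ) : ℂ) * (!![1, 1; 1, -1] : Matrix (Fin 2) (Fin 2) ℂ) (x 0) (y 0)
  | .T => Matrix.of fun (x y : Bits 1) =>
      (!![1, 0; 0, Complex.exp (Complex.I * (Real.pi / 4))] : Matrix (Fin 2) (Fin 2) ℂ) (x 0) (y 0)
  | .CNOT => Matrix.of fun (x y : Bits 2) => if x 0 = y 0 ∧ x 1 = y 1 + y 0 then 1 else 0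
  | .Toffoli => Matrix.of fun (x y : Bits 3) =>
      if x 0 = y 0 ∧ x 1 = y 1 ∧ x 2 = y 2 + y 0 * y 1 then 1 else 0
  | .query => (U : Op n)

/-- The code number of an operation. -/
def GateKind.code : GateKind → ℕ
  | .X => 0
  | .H => 1
  | .T => 2
  | .CNOT => 3
  | .Toffoli => 4
  | .query => 5

/-- An operation placed on distinct wires of an `m`-qubit register. -/
structure Gate (n m : ℕ) where
  kind : GateKind
  wires : Fin (kind.arity n) ↪ Fin m

open Classical in
/-- The operator `A ⊗ 1` on `m` qubits, where `A` acts on the wires in the range of `e`. -/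
def onWires {k m : ℕ} (e : Fin k ↪ Fin m) (A : Op k) : Op m :=
  Matrix.of fun x y => if ∀ j, j ∉ Set.range e → x j = y j then A (x ∘ e) (y ∘ e) else 0

/-- The operator that a placed operation applies to the register. -/
def Gate.op {n m : ℕ} (U : UGroup n) (g : Gate n m) : Op m :=
  onWires g.wires (g.kind.matrix U)

/-- A circuit: a register of `width` qubits (including all ancillas), a sequence of
operations, and the wire that is measured at the end. -/
structure Circuit (n : ℕ) where
  width : ℕ
  gates : List (Gate n width)
  out : Fin width

/-- The final state of the circuit, started in `|0…0⟩`. -/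
def Circuit.finalState {n : ℕ} (C : Circuit n) (U : UGroup n) : Bits C.width → ℂ :=
  C.gates.foldl (fun ψ g => (g.op U).mulVec ψ) (Pi.single 0 1)

/-- The probability that the final measurement of the output wire returns `1`. -/
def Circuit.acceptProb {n : ℕ} (C : Circuit n) (U : UGroup n) : ℝ :=
  ∑ x : Bits C.width, if x C.out = 1 then ‖C.finalState U x‖ ^ 2 else 0

/-- The description of a circuit as a list of numbers: the width, the output wire, and then for
each operation its code number followed by the wires on which it acts. -/
def Circuit.encode {n : ℕ} (C : Circuit n) : List ℕ :=
  C.width :: (C.out : ℕ) ::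
    C.gates.flatMap fun g => g.kind.code :: List.ofFn fun i => (g.wires i : ℕ)

/-- All queries of the circuit are made at once, in parallel on disjoint sets of wires, and there
are exactly `k` of them. -/
def Circuit.ParallelQueries {n : ℕ} (C : Circuit n) (k : ℕ) : Prop :=
  ∃ pre qs post : List (Gate n C.width), C.gates = pre ++ qs ++ post ∧
    (∀ g ∈ pre, g.kind ≠ .query) ∧ (∀ g ∈ post, g.kind ≠ .query) ∧
    (∀ g ∈ qs, g.kind = .query) ∧ qs.length = k ∧
    qs.Pairwise fun g h => ∀ i j, g.wires i ≠ h.wires j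

/-! ### Classical polynomial time

Programs of a random access machine: memory cells indexed by `ℕ` hold natural numbers, the
arithmetic operations are addition and truncated subtraction, addressing is direct or indirect,
control flow is by `if` and `while`, each elementary step has unit cost, and there is a write-only
output tape. Within polynomial factors this is equivalent to Turing machine time. -/

/-- Programs of the random access machine. -/
inductive Prog
  /-- `M[r] := c` -/
  | const (r c : ℕ)
  /-- `M[r] := M[s]` -/
  | copy (r s : ℕ)
  /-- `M[r] := M[r] + M[s]` -/
  | plus (r s : ℕ)
  /-- `M[r] := M[r] - M[s]`, truncated at `0` -/
  | minus (r s : ℕ)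
  /-- `M[r] := M[M[s]]` -/
  | load (r s : ℕ)
  /-- `M[M[r]] := M[s]` -/
  | store (r s : ℕ)
  /-- write `M[r]` on the output tape -/
  | emit (r : ℕ)
  /-- run one program, then another -/
  | seq (p p' : Prog)
  /-- if `M[r] ≠ 0` run the first program, otherwise the second -/
  | cond (r : ℕ) (p p' : Prog)
  /-- while `M[r] ≠ 0` run the program -/
  | loop (r : ℕ) (p : Prog)

/-- Memory contents and output tape. -/
structure MState where
  mem : ℕ → ℕ
  out : List ℕ

/-- Set one memory cell. -/
def MState.write (s : MState) (r v : ℕ) : MState := ⟨Function.update s.mem r v, s.out⟩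

/-- `Exec p s s' t`: the program `p`, started in state `s`, halts in state `s'` after exactly `t`
steps. -/
inductive Exec : Prog → MState → MState → ℕ → Prop
  | const (r c : ℕ) (s : MState) : Exec (.const r c) s (s.write r c) 1
  | copy (r r' : ℕ) (s : MState) : Exec (.copy r r') s (s.write r (s.mem r')) 1
  | plus (r r' : ℕ) (s : MState) : Exec (.plus r r') s (s.write r (s.mem r + s.mem r')) 1
  | minus (r r' : ℕ) (s : MState) : Exec (.minus r r') s (s.write r (s.mem r - s.mem r')) 1
  | load (r r' : ℕ) (s : MState) : Exec (.load r r') s (s.write r (s.mem (s.mem r'))) 1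
  | store (r r' : ℕ) (s : MState) : Exec (.store r r') s (s.write (s.mem r) (s.mem r')) 1
  | emit (r : ℕ) (s : MState) : Exec (.emit r) s ⟨s.mem, s.out ++ [s.mem r]⟩ 1
  | seq {p p' : Prog} {s₁ s₂ s₃ : MState} {t t' : ℕ} (h : Exec p s₁ s₂ t)
      (h' : Exec p' s₂ s₃ t') : Exec (.seq p p') s₁ s₃ (t + t')
  | condTrue {r : ℕ} {p p' : Prog} {s₁ s₂ : MState} {t : ℕ} (hr : s₁.mem r ≠ 0)
      (h : Exec p s₁ s₂ t) : Exec (.cond r p p') s₁ s₂ (t + 1)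
  | condFalse {r : ℕ} {p p' : Prog} {s₁ s₂ : MState} {t : ℕ} (hr : s₁.mem r = 0)
      (h : Exec p' s₁ s₂ t) : Exec (.cond r p p') s₁ s₂ (t + 1)
  | loopStop {r : ℕ} {p : Prog} {s : MState} (hr : s.mem r = 0) : Exec (.loop r p) s s 1
  | loopStep {r : ℕ} {p : Prog} {s₁ s₂ s₃ : MState} {t t' : ℕ} (hr : s₁.mem r ≠ 0)
      (h : Exec p s₁ s₂ t) (h' : Exec (.loop r p) s₂ s₃ t') :
      Exec (.loop r p) s₁ s₃ (t + t' + 1)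

/-- The initial state on input `n`: `n` stands in cell `0`, everything else is blank. -/
def MState.init (n : ℕ) : MState := ⟨Function.update (fun _ => 0) 0 n, []⟩

/-! ### Quantum adversaries and pseudorandom unitaries -/

/-- A quantum experiment: for each `n` a circuit that queries an `n`-qubit unitary. -/
abbrev Experiment : Type := (n : ℕ) → Circuit n

/-- The experiment runs in time polynomial in `n`: its circuits have polynomially many qubits, and
one program writes down the `n`-th circuit in a number of steps polynomial in `n` (so the number of
gates is polynomial too, and the family is uniform). -/
def Experiment.PolyTime (A : Experiment) : Prop :=
  ∃ (prog : Prog) (p : Polynomial ℕ), ∀ n : ℕ, (A n).width ≤ p.eval n ∧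
    ∃ (s : MState) (t : ℕ), Exec prog (MState.init n) s t ∧ t ≤ p.eval n ∧ s.out = (A n).encode

/-- The advantage of an experiment in distinguishing the ensemble `E n` from Haar-random unitaries
on `n` qubits. -/
def advantage (A : Experiment) (E : (n : ℕ) → Measure (UGroup n)) (n : ℕ) : ℝ :=
  |(∫ U, (A n).acceptProb U ∂(E n)) - ∫ U, (A n).acceptProb U ∂(haar n)|

/-- A function of `n` is negligible if it decays faster than every inverse polynomial. -/
def Negligible (f : ℕ → ℝ) : Prop :=
  Asymptotics.SuperpolynomialDecay atTop (fun n : ℕ => (n : ℝ)) f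

/-- The ensembles `E n` form a pseudorandom unitary: no polynomial-time quantum experiment, which
may query the unitary adaptively, distinguishes them from Haar-random with non-negligible
advantage. -/
def IsPRU (E : (n : ℕ) → Measure (UGroup n)) : Prop :=
  ∀ A : Experiment, A.PolyTime → Negligible (advantage A E)

end NoGoPRU

end

noncomputable section

namespace NoGoPRU

/-! ### Algebra of Pauli strings -/

/-- `1` if two Pauli matrices commute and `-1` if they anticommute. -/
def Pauli.sign (a b : Pauli) : ℤ := if a = .I ∨ b = .I ∨ a = b then 1 else -1

/-- An involution of the Pauli labels which, for `a ≠ I`, exchanges the labels that commute with `a`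
and those that anticommute with `a`. -/
def Pauli.toggle : Pauli → Pauli → Pauli
  | .I, b => b
  | .X, .I => .Z
  | .X, .X => .Y
  | .X, .Y => .X
  | .X, .Z => .I
  | .Y, .I => .X
  | .Y, .X => .I
  | .Y, .Y => .Z
  | .Y, .Z => .Y
  | .Z, .I => .X
  | .Z, .X => .I
  | .Z, .Y => .Z
  | .Z, .Z => .Y

lemma Pauli.toggle_toggle (a b : Pauli) : a.toggle (a.toggle b) = b := by
  cases a <;> cases b <;> rfl

lemma Pauli.sign_toggle {a : Pauli} (ha : a ≠ .I) (b : Pauli) :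
    a.sign (a.toggle b) = -a.sign b := by
  revert ha
  cases a <;> cases b <;> decide

lemma Pauli.mat_mul_comm (a b : Pauli) :
    a.mat * b.mat = (a.sign b : ℂ) • (b.mat * a.mat) := by
  cases a <;> cases b <;> ext i j <;> fin_cases i <;> fin_cases j <;>
    simp [Pauli.mat, Pauli.sign, Matrix.mul_apply, Fin.sum_univ_two]

lemma Pauli.mat_mul_self (a : Pauli) : a.mat * a.mat = 1 := by
  cases a <;> ext i j <;> fin_cases i <;> fin_cases j <;>
    simp [Pauli.mat, Matrix.mul_apply, Fin.sum_univ_two]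

lemma Pauli.mat_conj (a : Pauli) (i j : Fin 2) : star (a.mat i j) = a.mat j i := by
  cases a <;> fin_cases i <;> fin_cases j <;> simp [Pauli.mat]

lemma Pauli.trace_mul (a b : Pauli) : (a.mat * b.mat).trace = if a = b then 2 else 0 := by
  cases a <;> cases b <;>
    simp [Pauli.mat, Matrix.trace, Fin.sum_univ_two] <;> norm_num

lemma Pauli.sum_univ {M : Type*} [AddCommMonoid M] (f : Pauli → M) :
    ∑ a, f a = f .I + (f .X + (f .Y + f .Z)) := by
  have : (Finset.univ : Finset Pauli) = {Pauli.I, Pauli.X, Pauli.Y, Pauli.Z} := rfl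
  rw [this, Finset.sum_insert (by decide), Finset.sum_insert (by decide),
    Finset.sum_insert (by decide), Finset.sum_singleton]

lemma Pauli.sum_mat_mul_mat (x y x' y' : Fin 2) :
    ∑ a : Pauli, a.mat x y * a.mat x' y' = if y = x' ∧ y' = x then 2 else 0 := by
  rw [Pauli.sum_univ]
  fin_cases x <;> fin_cases y <;> fin_cases x' <;> fin_cases y' <;>
    simp [Pauli.mat] <;> norm_num

lemma Pauli.card : Fintype.card Pauli = 4 := rfl

variable {n : ℕ}

lemma sum_prod_bits {ι : Type*} [Fintype ι] [DecidableEq ι] {κ : Type*} [Fintype κ] [DecidableEq κ]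
    {R : Type*} [CommSemiring R]
    (f : ι → κ → R) : ∑ z : ι → κ, ∏ i, f i (z i) = ∏ i, ∑ b, f i b := by
  rw [Finset.prod_univ_sum, Fintype.piFinset_univ]

lemma PauliString.toOp_mul_apply (P Q : PauliString n) (x y : Bits n) :
    (P.toOp * Q.toOp) x y = ∏ i, ((P i).mat * (Q i).mat) (x i) (y i) := by
  simp only [Matrix.mul_apply, PauliString.toOp, Matrix.of_apply, ← Finset.prod_mul_distrib]
  exact sum_prod_bits fun i b => (P i).mat (x i) b * (Q i).mat b (y i)

lemma PauliString.toOp_mul_comm (P Q : PauliString n) :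
    P.toOp * Q.toOp = ((∏ i, (P i).sign (Q i) : ℤ) : ℂ) • (Q.toOp * P.toOp) := by
  ext x y
  rw [Matrix.smul_apply, toOp_mul_apply, toOp_mul_apply, smul_eq_mul, Int.cast_prod,
    ← Finset.prod_mul_distrib]
  refine Finset.prod_congr rfl fun i _ => ?_
  rw [Pauli.mat_mul_comm, Matrix.smul_apply, smul_eq_mul]

lemma PauliString.toOp_mul_self (P : PauliString n) : P.toOp * P.toOp = 1 := by
  ext x y
  rw [toOp_mul_apply]
  simp only [Pauli.mat_mul_self, Matrix.one_apply]
  rw [Finset.prod_ite_zero]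
  simp [funext_iff]

lemma PauliString.star_toOp (P : PauliString n) : star P.toOp = P.toOp := by
  ext x y
  simp only [Matrix.star_apply, PauliString.toOp, Matrix.of_apply, star_prod]
  exact Finset.prod_congr rfl fun i _ => Pauli.mat_conj _ _ _

lemma PauliString.trace_toOp_mul (P Q : PauliString n) :
    (P.toOp * Q.toOp).trace = if P = Q then 2 ^ n else 0 := by
  simp only [Matrix.trace, Matrix.diag, toOp_mul_apply]
  rw [sum_prod_bits fun i b => ((P i).mat * (Q i).mat) b b]
  have : ∀ i, ∑ b, ((P i).mat * (Q i).mat) b b = if P i = Q i then (2 : ℂ) else 0 := fun i =>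
    Pauli.trace_mul _ _
  simp only [this]
  rw [Finset.prod_ite_zero]
  simp [funext_iff]

/-- The identity string. -/
def PauliString.one (n : ℕ) : PauliString n := fun _ => .I

lemma PauliString.toOp_one : (PauliString.one n).toOp = 1 := by
  have : ∀ i j : Fin 2, Pauli.I.mat i j = if i = j then 1 else 0 := by
    intro i j; fin_cases i <;> fin_cases j <;> simp [Pauli.mat]
  ext x y
  simp only [PauliString.toOp, PauliString.one, Matrix.of_apply, this, Matrix.one_apply]
  rw [Finset.prod_ite_zero]
  simp [funext_iff]

lemma PauliString.exists_ne_of_ne_one {P : PauliString n} (hP : P ≠ PauliString.one n) :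
    ∃ i, P i ≠ .I := by
  by_contra h
  push Not at h
  exact hP (funext h)

/-! ### Partial swaps -/

/-- Exchange the entries of two bit strings at the sites where `w` is `1`. -/
def partialSwap (w : Bits n) (q : Bits n × Bits n) : Bits n × Bits n :=
  (fun i => if w i = 1 then q.2 i else q.1 i, fun i => if w i = 1 then q.1 i else q.2 i)

lemma partialSwap_partialSwap (w : Bits n) (q : Bits n × Bits n) :
    partialSwap w (partialSwap w q) = q := by
  ext i <;> by_cases h : w i = 1 <;> simp [partialSwap, h]

lemma partialSwap_bijective (w : Bits n) : Function.Bijective (partialSwap w) :=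
  (Function.Involutive.bijective (partialSwap_partialSwap w))

/-- The Pauli string is trivial outside the set marked by `w`. -/
def PauliString.Within (w : Bits n) (P : PauliString n) : Prop := ∀ i, w i = 0 → P i = .I

instance (w : Bits n) : DecidablePred (PauliString.Within w) := fun P => by
  unfold PauliString.Within; infer_instance

/-- The number of marked sites. -/
def weight (w : Bits n) : ℕ := ∑ i, (w i : ℕ)

lemma prod_two_pow (w : Bits n) (c : ℂ) : ∏ i, c ^ (w i : ℕ) = c ^ weight w := by
  rw [Finset.prod_pow_eq_pow_sum]; rfl

lemma fin_two_eq_zero_or_one (b : Fin 2) : b = 0 ∨ b = 1 := by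
  fin_cases b <;> simp

lemma sum_within_toOp_mul_toOp (w : Bits n) (α α' β β' : Bits n) :
    ∑ P with PauliString.Within w P, P.toOp α β * P.toOp α' β' =
      if (β, β') = partialSwap w (α, α') then 2 ^ weight w else 0 := by
  have h1 : ∀ P : PauliString n, (if PauliString.Within w P then P.toOp α β * P.toOp α' β' else 0)
      = ∏ i, if w i = 0 → P i = .I then (P i).mat (α i) (β i) * (P i).mat (α' i) (β' i)
        else 0 := by
    intro P
    rw [Finset.prod_ite_zero]
    simp [PauliString.Within, PauliString.toOp, Finset.prod_mul_distrib]
  rw [Finset.sum_filter, Finset.sum_congr rfl fun P _ => h1 P]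
  rw [sum_prod_bits fun i a => if w i = 0 → a = Pauli.I then
    a.mat (α i) (β i) * a.mat (α' i) (β' i) else 0]
  have h2 : ∀ i, (∑ a : Pauli, if w i = 0 → a = Pauli.I then
      a.mat (α i) (β i) * a.mat (α' i) (β' i) else 0) =
      if β i = (partialSwap w (α, α')).1 i ∧ β' i = (partialSwap w (α, α')).2 i
        then (2 : ℂ) ^ (w i : ℕ) else 0 := by
    intro i
    rcases fin_two_eq_zero_or_one (w i) with h | h
    · simp only [h, forall_const, partialSwap]
      rw [Finset.sum_ite_eq' Finset.univ Pauli.I]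
      generalize α i = a, β i = b, α' i = a', β' i = b'
      fin_cases a <;> fin_cases b <;> fin_cases a' <;> fin_cases b' <;> simp [Pauli.mat]
    · simp only [h, partialSwap]
      simp [Pauli.sum_mat_mul_mat]
  simp only [h2]
  rw [Finset.prod_ite_zero, prod_two_pow]
  simp [Prod.ext_iff, funext_iff, forall_and]

lemma sum_toOp_mul_toOp (α α' β β' : Bits n) :
    ∑ P : PauliString n, P.toOp α β * P.toOp α' β' =
      if β = α' ∧ β' = α then 2 ^ n else 0 := by
  have h := sum_within_toOp_mul_toOp (fun _ => 1) α α' β β'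
  have h1 : ∀ P : PauliString n, PauliString.Within (fun _ => 1) P := fun P i hi => by simp at hi
  have h2 : weight (fun _ : Fin n => (1 : Fin 2)) = n := by simp [weight]
  simpa [h1, h2, partialSwap, Prod.ext_iff] using h

/-! ### The Pauli transfer matrix -/

/-- The entry `2⁻ⁿ tr(P U Q U†)` of the Pauli transfer matrix of `U`. -/
def transfer (P Q : PauliString n) (U : UGroup n) : ℝ :=
  ((P.toOp * (U : Op n) * Q.toOp * star (U : Op n)).trace).re / 2 ^ n

lemma coe_transfer (P Q : PauliString n) (U : UGroup n) :
    (transfer P Q U : ℂ) = (P.toOp * (U : Op n) * Q.toOp * star (U : Op n)).trace / 2 ^ n := by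
  have h : star (P.toOp * (U : Op n) * Q.toOp * star (U : Op n)).trace
      = (P.toOp * (U : Op n) * Q.toOp * star (U : Op n)).trace := by
    rw [← Matrix.trace_conjTranspose, ← Matrix.star_eq_conjTranspose, star_mul, star_mul, star_mul,
      star_star, PauliString.star_toOp, PauliString.star_toOp, ← mul_assoc, ← mul_assoc,
      Matrix.trace_mul_comm]
    simp only [mul_assoc]
  rw [transfer]
  push_cast
  congr 1
  exact Complex.conj_eq_iff_re.mp h

lemma coe_unitary_mul_star (U : UGroup n) : (U : Op n) * star (U : Op n) = 1 :=
  Matrix.mem_unitaryGroup_iff.mp U.2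

lemma coe_star_mul_unitary (U : UGroup n) : star (U : Op n) * (U : Op n) = 1 :=
  Matrix.mem_unitaryGroup_iff'.mp U.2

lemma transfer_one_right (P : PauliString n) (U : UGroup n) :
    transfer P (PauliString.one n) U = if P = PauliString.one n then 1 else 0 := by
  have h : (transfer P (PauliString.one n) U : ℂ) = if P = PauliString.one n then 1 else 0 := by
    rw [coe_transfer, PauliString.toOp_one, mul_one, mul_assoc, coe_unitary_mul_star,
      ← PauliString.toOp_one, PauliString.trace_toOp_mul]
    split_ifs <;> simp
  split_ifs at h ⊢ <;> exact_mod_cast h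

lemma transfer_one_left (Q : PauliString n) (U : UGroup n) :
    transfer (PauliString.one n) Q U = if Q = PauliString.one n then 1 else 0 := by
  have h : (transfer (PauliString.one n) Q U : ℂ) = if Q = PauliString.one n then 1 else 0 := by
    rw [coe_transfer, PauliString.toOp_one, one_mul, Matrix.trace_mul_comm, ← mul_assoc,
      coe_star_mul_unitary, one_mul, ← mul_one Q.toOp,
      ← PauliString.toOp_one, PauliString.trace_toOp_mul]
    split_ifs <;> simp
  split_ifs at h ⊢ <;> exact_mod_cast h

lemma sum_trace_toOp_mul_sq (X : Op n) :
    ∑ P : PauliString n, (P.toOp * X).trace ^ 2 = 2 ^ n * (X * X).trace := by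
  have h1 : ∀ P : PauliString n, (P.toOp * X).trace ^ 2
      = ∑ α, ∑ β, ∑ α', ∑ β', (P.toOp α β * P.toOp α' β') * (X β α * X β' α') := by
    intro P
    simp only [Matrix.trace, Matrix.diag, Matrix.mul_apply, sq, Finset.sum_mul, Finset.mul_sum]
    refine Finset.sum_congr rfl fun α _ => Finset.sum_congr rfl fun β _ => ?_
    refine Finset.sum_congr rfl fun α' _ => Finset.sum_congr rfl fun β' _ => ?_
    ring
  simp only [h1]
  rw [Finset.sum_comm]
  simp only [Finset.sum_comm (s := (Finset.univ : Finset (PauliString n))), ← Finset.sum_mul,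
    sum_toOp_mul_toOp]
  simp only [Matrix.trace, Matrix.diag, Matrix.mul_apply, Finset.mul_sum]
  refine Finset.sum_congr rfl fun α _ => Finset.sum_congr rfl fun β _ => ?_
  rw [Finset.sum_eq_single β, Finset.sum_eq_single α]
  · simp [mul_comm]
  · intro b _ hb; simp [hb]
  · simp
  · intro b _ hb; simp [hb.symm]
  · simp

lemma sum_transfer_sq (Q : PauliString n) (U : UGroup n) :
    ∑ P : PauliString n, transfer P Q U ^ 2 = 1 := by
  have h : ((∑ P : PauliString n, transfer P Q U ^ 2 : ℝ) : ℂ) = 1 := by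
    push_cast
    simp only [coe_transfer, div_pow, ← Finset.sum_div]
    have : ∀ P : PauliString n, P.toOp * (U : Op n) * Q.toOp * star (U : Op n)
        = P.toOp * ((U : Op n) * Q.toOp * star (U : Op n)) := fun P => by simp only [mul_assoc]
    simp only [this, sum_trace_toOp_mul_sq]
    have h2 : (U : Op n) * Q.toOp * star (U : Op n) * ((U : Op n) * Q.toOp * star (U : Op n))
        = 1 := by
      calc _ = (U : Op n) * Q.toOp * (star (U : Op n) * (U : Op n)) * Q.toOp * star (U : Op n) := by
            simp only [mul_assoc]
        _ = (U : Op n) * (Q.toOp * Q.toOp) * star (U : Op n) := by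
            rw [coe_star_mul_unitary]; simp only [mul_assoc, mul_one]
        _ = 1 := by rw [PauliString.toOp_mul_self, mul_one, coe_unitary_mul_star]
    rw [h2]
    have h3 : (1 : Op n).trace = 2 ^ n := by simp [Matrix.trace_one]
    rw [h3]
    field_simp
  exact_mod_cast h

end NoGoPRU

namespace NoGoPRU

variable {n : ℕ}

/-! ### Swap correlators -/

/-- `tr(SWAP_w (U ⊗ U) SWAP_w (U ⊗ U)†)`, where `SWAP_w` exchanges two copies of the sites marked
by `w`. -/
def swapCorrelator (w : Bits n) (U : UGroup n) : ℂ :=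
  ∑ a : Bits n × Bits n, ∑ g : Bits n × Bits n,
    ((U : Op n) (partialSwap w a).1 g.1 * (U : Op n) (partialSwap w a).2 g.2) *
      star ((U : Op n) a.1 (partialSwap w g).1 * (U : Op n) a.2 (partialSwap w g).2)

/-- The matrix of the partial swap. -/
def swapMatrix (w : Bits n) : Matrix (Bits n × Bits n) (Bits n × Bits n) ℂ :=
  Matrix.of fun a b => if b = partialSwap w a then 1 else 0

open scoped Kronecker in
lemma sum_within_kronecker (w : Bits n) :
    ∑ P with PauliString.Within w P, P.toOp ⊗ₖ P.toOp = (2 : ℂ) ^ weight w • swapMatrix w := by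
  ext a b
  rw [Matrix.sum_apply]
  simp only [Matrix.kroneckerMap_apply, Matrix.smul_apply, swapMatrix, Matrix.of_apply]
  rw [sum_within_toOp_mul_toOp]
  simp

open scoped Kronecker in
lemma trace_swapMatrix (w : Bits n) (U : UGroup n) :
    (swapMatrix w * ((U : Op n) ⊗ₖ (U : Op n)) * swapMatrix w *
      (star (U : Op n) ⊗ₖ star (U : Op n))).trace = swapCorrelator w U := by
  have h1 : ∀ X : Matrix (Bits n × Bits n) (Bits n × Bits n) ℂ, ∀ a b,
      (swapMatrix w * X) a b = X (partialSwap w a) b := by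
    intro X a b
    simp [swapMatrix, Matrix.mul_apply]
  simp only [mul_assoc]
  simp only [Matrix.trace, Matrix.diag, h1]
  simp only [Matrix.mul_apply (M := (U : Op n) ⊗ₖ (U : Op n)), h1]
  rw [swapCorrelator]
  refine Finset.sum_congr rfl fun a _ => Finset.sum_congr rfl fun g _ => ?_
  simp [Matrix.kroneckerMap_apply, Matrix.star_apply]

open scoped Kronecker in
lemma swapCorrelator_eq (w : Bits n) (U : UGroup n) :
    swapCorrelator w U = ((4 ^ n / 4 ^ weight w *
      ∑ P with PauliString.Within w P, ∑ Q with PauliString.Within w Q,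
        transfer P Q U ^ 2 : ℝ) : ℂ) := by
  have h1 : ∀ P Q : PauliString n, ((transfer P Q U : ℝ) : ℂ) ^ 2 =
      ((P.toOp ⊗ₖ P.toOp) * ((U : Op n) ⊗ₖ (U : Op n)) * (Q.toOp ⊗ₖ Q.toOp) *
        (star (U : Op n) ⊗ₖ star (U : Op n))).trace / 4 ^ n := by
    intro P Q
    rw [coe_transfer, div_pow, ← Matrix.mul_kronecker_mul, ← Matrix.mul_kronecker_mul,
      ← Matrix.mul_kronecker_mul, Matrix.trace_kronecker, ← pow_mul, mul_comm n 2, pow_mul, sq]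
    norm_num
  push_cast
  simp only [h1, ← Finset.sum_div, ← Matrix.trace_sum, ← Finset.sum_mul, ← Finset.mul_sum]
  rw [sum_within_kronecker, ← trace_swapMatrix]
  simp only [Matrix.smul_mul, Matrix.mul_smul, Matrix.trace_smul, smul_eq_mul]
  have : (4 : ℂ) ^ weight w = 2 ^ weight w * 2 ^ weight w := by
    rw [← mul_pow]; norm_num
  rw [this]
  field_simp

/-! ### Haar averages -/

instance instIsProbabilityMeasureHaar (n : ℕ) : IsProbabilityMeasure (haar n) :=
  ⟨by
    have := Measure.haarMeasure_self (K₀ := (⊤ : TopologicalSpace.PositiveCompacts (UGroup n)))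
    simpa [haar] using this⟩

instance instIsMulLeftInvariantHaar (n : ℕ) : (haar n).IsMulLeftInvariant := by
  unfold haar; infer_instance

lemma continuous_transfer (P Q : PauliString n) : Continuous (transfer P Q) := by
  unfold transfer
  refine Continuous.div_const (Complex.continuous_re.comp (Continuous.matrix_trace ?_)) _
  have h : Continuous fun U : UGroup n => (U : Op n) := continuous_subtype_val
  exact ((continuous_const.matrix_mul h).matrix_mul continuous_const).matrix_mul h.star

lemma integrable_of_continuous {X : Type*} [TopologicalSpace X] [CompactSpace X] [T2Space X]
    [MeasurableSpace X] [BorelSpace X] (μ : Measure X) [IsFiniteMeasure μ] {f : X → ℝ}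
    (hf : Continuous f) : Integrable f μ := by
  rw [← integrableOn_univ]
  exact hf.continuousOn.integrableOn_compact isCompact_univ

/-- Two anticommuting Pauli strings are conjugate. -/
lemma exists_conj_of_anticommute {P R : PauliString n}
    (h : P.toOp * R.toOp = -(R.toOp * P.toOp)) :
    ∃ W : UGroup n, star (W : Op n) * P.toOp * (W : Op n) = R.toOp := by
  set c : ℂ := ((1 / Real.sqrt 2 : ℝ) : ℂ) with hc
  have hcc : c * c = 1 / 2 := by
    rw [hc, ← Complex.ofReal_mul, div_mul_div_comm, Real.mul_self_sqrt (by norm_num)]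
    norm_num
  have hstar : star (c • (P.toOp + R.toOp)) = c • (P.toOp + R.toOp) := by
    rw [star_smul, star_add, PauliString.star_toOp, PauliString.star_toOp]
    congr 1
    exact Complex.conj_ofReal _
  have hsq : (P.toOp + R.toOp) * (P.toOp + R.toOp) = (2 : ℂ) • (1 : Op n) := by
    rw [add_mul, mul_add, mul_add, PauliString.toOp_mul_self, PauliString.toOp_mul_self, h,
      two_smul]
    abel
  refine ⟨⟨c • (P.toOp + R.toOp), ?_⟩, ?_⟩
  · rw [Matrix.mem_unitaryGroup_iff, hstar, smul_mul_smul_comm, hsq, hcc, smul_smul]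
    norm_num
  · change star (c • (P.toOp + R.toOp)) * P.toOp * (c • (P.toOp + R.toOp)) = R.toOp
    rw [hstar, smul_mul_assoc, smul_mul_smul_comm, hcc]
    have : (P.toOp + R.toOp) * P.toOp * (P.toOp + R.toOp) = (2 : ℂ) • R.toOp := by
      have h1 : (P.toOp + R.toOp) * P.toOp = 1 + R.toOp * P.toOp := by
        rw [add_mul, PauliString.toOp_mul_self]
      have h2 : R.toOp * P.toOp * P.toOp = R.toOp := by
        rw [mul_assoc, PauliString.toOp_mul_self, mul_one]
      have h3 : R.toOp * P.toOp * R.toOp = -P.toOp := by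
        rw [mul_assoc, h, mul_neg, ← mul_assoc, PauliString.toOp_mul_self, one_mul]
      rw [h1, add_mul, one_mul, mul_add, h2, h3, two_smul]
      abel
    rw [this, smul_smul]
    norm_num

lemma integral_transfer_sq_eq {P R : PauliString n}
    (h : P.toOp * R.toOp = -(R.toOp * P.toOp)) (Q : PauliString n) :
    ∫ U, transfer P Q U ^ 2 ∂(haar n) = ∫ U, transfer R Q U ^ 2 ∂(haar n) := by
  obtain ⟨W, hW⟩ := exists_conj_of_anticommute h
  rw [← integral_mul_left_eq_self (fun U => transfer P Q U ^ 2) W]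
  refine integral_congr_ae (Eventually.of_forall fun U => ?_)
  have h0 : ((W * U : UGroup n) : Op n) = (W : Op n) * (U : Op n) := rfl
  have htr : (P.toOp * ((W : Op n) * (U : Op n)) * Q.toOp *
      star ((W : Op n) * (U : Op n))).trace = (star (W : Op n) * P.toOp * (W : Op n) *
        (U : Op n) * Q.toOp * star (U : Op n)).trace := by
    rw [star_mul, ← mul_assoc _ (star (U : Op n)), Matrix.trace_mul_comm _ (star (W : Op n))]
    simp only [mul_assoc]
  have : transfer P Q (W * U) = transfer R Q U := by
    rw [transfer, transfer, ← hW, h0, htr]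
  simp only [this]

/-- The Haar average of a squared entry of the Pauli transfer matrix is exponentially small. -/
lemma integral_transfer_sq_le {P : PauliString n} (hP : P ≠ PauliString.one n)
    (Q : PauliString n) : ∫ U, transfer P Q U ^ 2 ∂(haar n) ≤ 2 / 4 ^ n := by
  obtain ⟨i, hi⟩ := PauliString.exists_ne_of_ne_one hP
  set e : PauliString n → ℝ := fun R => ∫ U, transfer R Q U ^ 2 ∂(haar n) with he
  have he0 : ∀ R, 0 ≤ e R := fun R => integral_nonneg fun U => sq_nonneg _
  set τ : PauliString n → PauliString n := fun R => Function.update R i ((P i).toggle (R i)) with hτ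
  have hττ : Function.Involutive τ := by
    intro R
    simp [hτ, Pauli.toggle_toggle]
  have hsign : ∀ R : PauliString n, (∏ j, (P j).sign (R j) = -1) ∨
      (∏ j, (P j).sign (τ R j) = -1) := by
    intro R
    have h1 : ∏ j, (P j).sign (τ R j) = -∏ j, (P j).sign (R j) := by
      rw [← Finset.mul_prod_erase _ _ (Finset.mem_univ i),
        ← Finset.mul_prod_erase _ (fun j => (P j).sign (R j)) (Finset.mem_univ i)]
      have : ∏ j ∈ Finset.univ.erase i, (P j).sign (τ R j) =
          ∏ j ∈ Finset.univ.erase i, (P j).sign (R j) := by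
        refine Finset.prod_congr rfl fun j hj => ?_
        simp only [hτ]
        rw [Function.update_of_ne (Finset.ne_of_mem_erase hj)]
      rw [this, hτ]
      simp only [Function.update_self]
      rw [Pauli.sign_toggle hi, neg_mul]
    have h2 : ∏ j, (P j).sign (R j) = 1 ∨ ∏ j, (P j).sign (R j) = -1 := by
      apply Finset.prod_induction _ (fun z : ℤ => z = 1 ∨ z = -1)
      · rintro a b (rfl | rfl) (rfl | rfl) <;> simp
      · simp
      · intro j _
        unfold Pauli.sign
        split_ifs <;> simp
    rcases h2 with h2 | h2
    · right; rw [h1, h2]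
    · exact Or.inl h2
  have hanti : ∀ R : PauliString n, ∏ j, (P j).sign (R j) = -1 → e P = e R := by
    intro R hR
    refine integral_transfer_sq_eq ?_ Q
    rw [PauliString.toOp_mul_comm, hR]
    simp
  have hle : ∀ R, e P ≤ e R + e (τ R) := by
    intro R
    rcases hsign R with h | h
    · rw [hanti R h]; linarith [he0 (τ R)]
    · rw [hanti _ h]; linarith [he0 R]
  have hsum : ∑ R, e R = 1 := by
    rw [he, ← integral_finsetSum]
    · simp [sum_transfer_sq]
    · intro R _
      exact integrable_of_continuous _ ((continuous_transfer R Q).pow 2)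
  have hsumτ : ∑ R, e (τ R) = 1 := by
    rw [← hsum]
    exact hττ.bijective.sum_comp e
  have := Finset.sum_le_sum fun R (_ : R ∈ Finset.univ) => hle R
  rw [Finset.sum_add_distrib, hsum, hsumτ, Finset.sum_const, nsmul_eq_mul] at this
  have hcard : ((Finset.univ : Finset (PauliString n)).card : ℝ) = 4 ^ n := by
    rw [Finset.card_univ, Fintype.card_fun, Pauli.card, Fintype.card_fin]
    norm_num
  rw [hcard] at this
  rw [le_div_iff₀ (by positivity)]
  change e P * 4 ^ n ≤ 2
  linarith

/-! ### Time evolutions of local Hamiltonians -/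

lemma commute_evolution {X : Op n} {H : Hamiltonian n} (h : Commute X (H : Op n)) (t : ℝ) :
    Commute X (evolution (H, t) : Op n) :=
  Commute.exp_right (h.smul_right _)

lemma conj_evolution {X : Op n} {H : Hamiltonian n} (h : Commute X (H : Op n)) (t : ℝ) :
    (evolution (H, t) : Op n) * X * star (evolution (H, t) : Op n) = X := by
  rw [← (commute_evolution h t).eq, mul_assoc, coe_unitary_mul_star, mul_one]

lemma trace_toOp_mul_sum (h : PauliString n → ℝ) (P : PauliString n) :
    (P.toOp * ∑ Q, (h Q : ℂ) • Q.toOp).trace = 2 ^ n * h P := by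
  simp only [Finset.mul_sum, Matrix.trace_sum, Matrix.mul_smul, Matrix.trace_smul,
    PauliString.trace_toOp_mul, smul_eq_mul, mul_ite, mul_zero, Finset.sum_ite_eq,
    Finset.mem_univ, if_true]
  ring

/-- The coefficients of the Hamiltonian are a fixed vector of the Pauli transfer matrix. -/
lemma sum_transfer_mul_coeff {H : Hamiltonian n} {h : PauliString n → ℝ}
    (hH : (H : Op n) = ∑ P, (h P : ℂ) • PauliString.toOp P) (t : ℝ) (P : PauliString n) :
    ∑ Q, transfer P Q (evolution (H, t)) * h Q = h P := by
  have h1 : (2 : ℂ) ^ n * h P = (P.toOp * ((evolution (H, t) : Op n) * (H : Op n) *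
      star (evolution (H, t) : Op n))).trace := by
    rw [conj_evolution (Commute.refl _), hH, trace_toOp_mul_sum]
  have h2 : ((∑ Q, transfer P Q (evolution (H, t)) * h Q : ℝ) : ℂ) = h P := by
    have h3 : (h P : ℂ) = (2 ^ n * h P) / 2 ^ n := by field_simp
    rw [h3, h1, hH]
    push_cast
    simp only [coe_transfer, Finset.mul_sum, Finset.sum_mul, Matrix.trace_sum, Matrix.mul_smul,
      Matrix.smul_mul, Matrix.trace_smul, smul_eq_mul, Finset.sum_div]
    refine Finset.sum_congr rfl fun Q _ => ?_
    simp only [mul_assoc]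
    ring
  exact_mod_cast h2

/-- The block of the Pauli transfer matrix that belongs to the terms of the Hamiltonian has
Frobenius norm at least `1`. -/
lemma one_le_sum_transfer_sq (S : Finset (PauliString n)) (hne : S.Nonempty)
    (hS : PauliString.one n ∉ S) {H : Hamiltonian n}
    (hH : IsPauliSum (fun P => P = PauliString.one n ∨ P ∈ S) H) (t : ℝ) :
    1 ≤ ∑ P ∈ S, ∑ Q ∈ S, transfer P Q (evolution (H, t)) ^ 2 := by
  obtain ⟨h, hh, hH⟩ := hH
  by_cases h0 : ∀ P ∈ S, h P = 0
  · have hscal : (H : Op n) = (h (PauliString.one n) : ℂ) • 1 := by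
      rw [hH, Finset.sum_eq_single (PauliString.one n), PauliString.toOp_one]
      · intro P _ hP
        have : h P = 0 := by
          by_contra hc
          rcases hh P hc with h' | h'
          · exact hP h'
          · exact hc (h0 P h')
        simp [this]
      · simp
    obtain ⟨P, hP⟩ := hne
    have hPP : transfer P P (evolution (H, t)) = 1 := by
      have h1 : Commute P.toOp (H : Op n) := by
        rw [hscal]; exact (Commute.one_right _).smul_right _
      have : (transfer P P (evolution (H, t)) : ℂ) = 1 := by
        rw [coe_transfer]
        have h2 := conj_evolution h1 t
        rw [mul_assoc, mul_assoc, ← mul_assoc (evolution (H, t) : Op n), h2,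
          PauliString.trace_toOp_mul]
        simp
      exact_mod_cast this
    calc (1 : ℝ) = transfer P P (evolution (H, t)) ^ 2 := by rw [hPP]; norm_num
      _ ≤ ∑ Q ∈ S, transfer P Q (evolution (H, t)) ^ 2 :=
        Finset.single_le_sum (f := fun Q => transfer P Q (evolution (H, t)) ^ 2)
          (fun Q _ => sq_nonneg _) hP
      _ ≤ _ := Finset.single_le_sum
          (f := fun P => ∑ Q ∈ S, transfer P Q (evolution (H, t)) ^ 2)
          (fun P _ => Finset.sum_nonneg fun Q _ => sq_nonneg _) hP
  · push Not at h0
    obtain ⟨P₀, hP₀, hne0⟩ := h0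
    have hpos : 0 < ∑ P ∈ S, h P ^ 2 :=
      Finset.sum_pos' (fun P _ => sq_nonneg _) ⟨P₀, hP₀, by positivity⟩
    have hfix : ∀ P ∈ S, h P = ∑ Q ∈ S, transfer P Q (evolution (H, t)) * h Q := by
      intro P hP
      rw [← sum_transfer_mul_coeff hH t P]
      symm
      refine Finset.sum_subset (Finset.subset_univ S) fun Q _ hQ => ?_
      by_cases hQ1 : Q = PauliString.one n
      · have hP1 : P ≠ PauliString.one n := fun h' => hS (h' ▸ hP)
        rw [hQ1, transfer_one_right, if_neg hP1, zero_mul]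
      · have : h Q = 0 := by
          by_contra hc
          exact (hh Q hc).elim hQ1 hQ
        rw [this, mul_zero]
    have hle : ∑ P ∈ S, h P ^ 2 ≤ (∑ P ∈ S, ∑ Q ∈ S, transfer P Q (evolution (H, t)) ^ 2) *
        ∑ P ∈ S, h P ^ 2 := by
      rw [Finset.sum_mul]
      refine Finset.sum_le_sum fun P hP => ?_
      conv_lhs => rw [hfix P hP]
      exact Finset.sum_mul_sq_le_sq_mul_sq S _ _
    exact le_of_mul_le_mul_right (by simpa using hle) hpos

lemma measurable_evolution (n : ℕ) : Measurable (evolution (n := n)) := by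
  have hc : Continuous (evolution (n := n)) := by
    refine Continuous.subtype_mk ?_ _
    let _ : NormedRing (Op n) := Matrix.linftyOpNormedRing
    let _ : NormedAlgebra ℂ (Op n) := Matrix.linftyOpNormedAlgebra
    let _ : NormedAlgebra ℚ (Op n) := NormedAlgebra.restrictScalars ℚ ℂ (Op n)
    refine (NormedSpace.exp_continuous (𝔸 := Op n)).comp ?_
    have h1 : Continuous fun p : Hamiltonian n × ℝ => -(Complex.I * (p.2 : ℂ)) := by fun_prop
    have h2 : Continuous fun p : Hamiltonian n × ℝ => (p.1 : Op n) :=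
      continuous_subtype_val.comp continuous_fst
    exact h1.smul h2
  exact hc.measurable

end NoGoPRU

namespace NoGoPRU

variable {n k : ℕ}

/-! ### A random set of sites

From independent coins `c i` and `r i j`, a set of sites is drawn: a site is marked if all its `k`
coins `r i j` show `1`, and this mark is flipped if `c i = 1` and the preceding site is marked. The
marks form a Markov chain which starts a run of marked sites with probability `2⁻ᵏ`, and continues
it with probability `1/2`. -/

/-- `1` if all bits are `1`. -/
def allOnes (r : Bits k) : Fin 2 := if ∀ j, r j = 1 then 1 else 0

/-- The marks, shifted by one site and preceded by `0`. -/
def markSeq (c : Bits n) (r : Fin n → Bits k) : ℕ → Fin 2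
  | 0 => 0
  | i + 1 => if h : i < n then allOnes (r ⟨i, h⟩) + c ⟨i, h⟩ * markSeq c r i else 0

/-- The marked sites. -/
def marks (c : Bits n) (r : Fin n → Bits k) : Bits n := fun i => markSeq c r (i + 1)

/-- The mark of the preceding site. -/
def prevMark (w : Bits n) (i : Fin n) : Fin 2 := (Fin.cons 0 w : Fin (n + 1) → Fin 2) i.castSucc

lemma markSeq_succ (c : Bits n) (r : Fin n → Bits k) (i : Fin n) :
    markSeq c r (i + 1) = allOnes (r i) + c i * markSeq c r i := by
  rw [markSeq, dif_pos i.2]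

lemma markSeq_eq_cons (c : Bits n) (r : Fin n → Bits k) (i : Fin (n + 1)) :
    markSeq c r i = (Fin.cons 0 (marks c r) : Fin (n + 1) → Fin 2) i := by
  refine Fin.cases ?_ (fun j => ?_) i
  · rfl
  · rw [Fin.cons_succ]; rfl

lemma marks_eq_iff (c : Bits n) (r : Fin n → Bits k) (w : Bits n) :
    marks c r = w ↔ ∀ i, allOnes (r i) + c i * prevMark w i = w i := by
  constructor
  · rintro rfl i
    have := markSeq_eq_cons c r i.castSucc
    rw [prevMark, ← this]
    exact (markSeq_succ c r i).symm
  · intro h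
    have key : ∀ i : ℕ, ∀ hi : i < n + 1,
        markSeq c r i = (Fin.cons 0 w : Fin (n + 1) → Fin 2) ⟨i, hi⟩ := by
      intro i
      induction i with
      | zero => intro _; rfl
      | succ i ih =>
        intro hi
        have hi' : i < n := by omega
        have h1 := h ⟨i, hi'⟩
        have h2 := markSeq_succ c r ⟨i, hi'⟩
        have h3 : (⟨i + 1, hi⟩ : Fin (n + 1)) = Fin.succ ⟨i, hi'⟩ := rfl
        rw [h3, Fin.cons_succ, ← h1]
        simp only at h2
        rw [h2, ih (by omega)]
        rfl
    funext i
    have := key (i + 1) (by omega)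
    exact this

/-- The transition probabilities of the Markov chain. -/
def transition (k : ℕ) (a b : Fin 2) : ℝ :=
  if a = 1 then 1 / 2 else if b = 1 then (1 / 2) ^ k else 1 - (1 / 2) ^ k

lemma transition_nonneg (k : ℕ) (a b : Fin 2) : 0 ≤ transition k a b := by
  have : ((1 : ℝ) / 2) ^ k ≤ 1 := pow_le_one₀ (by norm_num) (by norm_num)
  unfold transition
  split_ifs
  · norm_num
  · positivity
  · linarith

/-- The probability that `w` is the set of marked sites. -/
def markProb (k : ℕ) (w : Bits n) : ℝ := ∏ i, transition k (prevMark w i) (w i)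

lemma markProb_nonneg (k : ℕ) (w : Bits n) : 0 ≤ markProb k w :=
  Finset.prod_nonneg fun _ _ => transition_nonneg _ _ _

lemma sum_allOnes (k : ℕ) (f : Fin 2 → ℝ) :
    ∑ r : Bits k, f (allOnes r) = f 1 + (2 ^ k - 1) * f 0 := by
  have h1 : ∀ r : Bits k, f (allOnes r) = f 0 + if r = (fun _ => 1) then f 1 - f 0 else 0 := by
    intro r
    unfold allOnes
    by_cases h : r = fun _ => 1
    · subst h; simp
    · have : ¬ ∀ j, r j = 1 := fun h' => h (funext h')
      simp [h, this]
  simp only [h1, Finset.sum_add_distrib, Finset.sum_const, Finset.sum_ite_eq', Finset.mem_univ,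
    if_true, Finset.card_univ, Fintype.card_fun, Fintype.card_fin, nsmul_eq_mul]
  push_cast
  ring

lemma sum_site_eq_transition (k : ℕ) (a b : Fin 2) :
    ∑ c : Fin 2, ∑ r : Bits k, (if allOnes r + c * a = b then (1 : ℝ) else 0) =
      2 ^ (k + 1) * transition k a b := by
  have h : ∀ c : Fin 2, ∑ r : Bits k, (if allOnes r + c * a = b then (1 : ℝ) else 0) =
      (if 1 + c * a = b then (1 : ℝ) else 0) + (2 ^ k - 1) * if 0 + c * a = b then (1 : ℝ) else 0 :=
    fun c => sum_allOnes k fun x => if x + c * a = b then (1 : ℝ) else 0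
  have h2 : (2 : ℝ) ^ k * ((2 : ℝ) ^ k)⁻¹ = 1 := mul_inv_cancel₀ (by positivity)
  simp only [h, Fin.sum_univ_two, transition, pow_succ]
  fin_cases a <;> fin_cases b <;> simp <;> nlinarith [h2]

lemma sum_marks (k : ℕ) (G : Bits n → ℝ) :
    ∑ c : Bits n, ∑ r : Fin n → Bits k, G (marks c r) =
      (2 ^ (k + 1)) ^ n * ∑ w, markProb k w * G w := by
  have h1 : ∀ w : Bits n, ∑ c : Bits n, ∑ r : Fin n → Bits k, (if marks c r = w then (1 : ℝ) else 0)
      = (2 ^ (k + 1)) ^ n * markProb k w := by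
    intro w
    have h2 : ∀ (c : Bits n) (r : Fin n → Bits k), (if marks c r = w then (1 : ℝ) else 0) =
        ∏ i, if allOnes (r i) + c i * prevMark w i = w i then 1 else 0 := by
      intro c r
      rw [Finset.prod_ite_zero]
      simp [marks_eq_iff]
    simp only [h2]
    have h3 : ∀ c : Bits n, ∑ r : Fin n → Bits k, ∏ i,
        (if allOnes (r i) + c i * prevMark w i = w i then (1 : ℝ) else 0) =
        ∏ i, ∑ r : Bits k, if allOnes r + c i * prevMark w i = w i then (1 : ℝ) else 0 :=
      fun c => sum_prod_bits fun i r =>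
        if allOnes r + c i * prevMark w i = w i then (1 : ℝ) else 0
    simp only [h3]
    rw [sum_prod_bits fun i c => ∑ r : Bits k,
      if allOnes r + c * prevMark w i = w i then (1 : ℝ) else 0]
    simp only [sum_site_eq_transition]
    rw [Finset.prod_mul_distrib, markProb]
    simp
  have h4 : ∀ (c : Bits n) (r : Fin n → Bits k), G (marks c r) =
      ∑ w, (if marks c r = w then (1 : ℝ) else 0) * G w := by
    intro c r; simp
  simp only [h4]
  rw [Finset.mul_sum]
  simp only [Finset.sum_comm (s := (Finset.univ : Finset (Fin n → Bits k)))]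
  rw [Finset.sum_comm]
  refine Finset.sum_congr rfl fun w _ => ?_
  simp only [← Finset.sum_mul]
  rw [h1]
  ring

lemma sum_chain_le {f : Fin 2 → Fin 2 → ℝ} {B : ℝ} (hf : ∀ a b, 0 ≤ f a b)
    (hB : ∀ a, f a 0 + f a 1 ≤ B) (n : ℕ) (a : Fin 2) :
    ∑ w : Fin n → Fin 2, ∏ i, f ((Fin.cons a w : Fin (n + 1) → Fin 2) i.castSucc) (w i) ≤ B ^ n := by
  have hB0 : 0 ≤ B := le_trans (add_nonneg (hf 0 0) (hf 0 1)) (hB 0)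
  induction n generalizing a with
  | zero => simp
  | succ n ih =>
    rw [← (Fin.consEquiv fun _ : Fin (n + 1) => Fin 2).sum_comp, Fintype.sum_prod_type]
    have h1 : ∀ (b : Fin 2) (w : Fin n → Fin 2),
        ∏ i, f ((Fin.cons a (Fin.cons b w : Fin (n + 1) → Fin 2) : Fin (n + 2) → Fin 2) i.castSucc)
          ((Fin.cons b w : Fin (n + 1) → Fin 2) i) =
        f a b * ∏ i, f ((Fin.cons b w : Fin (n + 1) → Fin 2) i.castSucc) (w i) := by
      intro b w
      rw [Fin.prod_univ_succ]
      simp only [Fin.castSucc_zero, Fin.cons_zero, Fin.cons_succ, ← Fin.succ_castSucc]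
    have h2 : ∀ b : Fin 2, ∑ w : Fin n → Fin 2,
        ∏ i, f ((Fin.cons a (Fin.cons b w : Fin (n + 1) → Fin 2) : Fin (n + 2) → Fin 2) i.castSucc)
          ((Fin.cons b w : Fin (n + 1) → Fin 2) i) ≤ f a b * B ^ n := by
      intro b
      simp only [h1, ← Finset.mul_sum]
      exact mul_le_mul_of_nonneg_left (ih b) (hf a b)
    refine (Finset.sum_le_sum fun b _ => h2 b).trans ?_
    rw [Fin.sum_univ_two, ← add_mul, pow_succ']
    exact mul_le_mul_of_nonneg_right (hB a) (pow_nonneg hB0 n)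

lemma sum_markProb_mul_four_pow_le (hk : 1 ≤ k) :
    ∑ w : Bits n, markProb k w * 4 ^ weight w ≤ (5 / 2) ^ n := by
  have hs : ((1 : ℝ) / 2) ^ k ≤ 1 / 2 := by
    calc ((1 : ℝ) / 2) ^ k ≤ (1 / 2) ^ 1 := pow_le_pow_of_le_one (by norm_num) (by norm_num) hk
      _ = 1 / 2 := by norm_num
  have hs0 : 0 ≤ ((1 : ℝ) / 2) ^ k := by positivity
  have := sum_chain_le (f := fun a b => transition k a b * 4 ^ (b : ℕ)) (B := 5 / 2)
    (fun a b => mul_nonneg (transition_nonneg _ _ _) (by positivity)) (fun a => by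
      fin_cases a
      · simp only [one_div, inv_pow] at hs
        simp [transition]
        linarith
      · simp [transition]; norm_num) n 0
  refine le_trans (le_of_eq ?_) this
  refine Finset.sum_congr rfl fun w _ => ?_
  rw [Finset.prod_mul_distrib, Finset.prod_pow_eq_pow_sum]
  rfl

/-- The number of runs of marked sites. -/
def runs (w : Bits n) : ℕ := (Finset.univ.filter fun i => w i = 1 ∧ prevMark w i = 0).card

lemma sum_prevMark_le (w : Bits n) : ∑ i, (prevMark w i : ℕ) ≤ weight w := by
  have h1 := Fin.sum_univ_castSucc fun i => ((Fin.cons 0 w : Fin (n + 1) → Fin 2) i : ℕ)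
  have h2 := Fin.sum_univ_succ fun i => ((Fin.cons 0 w : Fin (n + 1) → Fin 2) i : ℕ)
  simp only [Fin.cons_zero, Fin.cons_succ] at h2
  have h3 : ∑ i, (prevMark w i : ℕ) =
      ∑ i : Fin n, ((Fin.cons 0 w : Fin (n + 1) → Fin 2) i.castSucc : ℕ) := rfl
  have h4 : weight w = ∑ i, (w i : ℕ) := rfl
  have h5 : ((0 : Fin 2) : ℕ) = 0 := rfl
  omega

lemma le_markProb (k : ℕ) (w : Bits n) :
    (1 - (1 / 2) ^ k) ^ n * (1 / 4) ^ weight w * ((1 / 2) ^ k) ^ runs w ≤ markProb k w := by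
  set s : ℝ := (1 / 2) ^ k with hs
  have hs0 : 0 ≤ s := by positivity
  have hs1 : s ≤ 1 := pow_le_one₀ (by norm_num) (by norm_num)
  have hsite : ∀ i, (1 - s) * ((1 / 2) ^ (w i : ℕ) * (1 / 2) ^ (prevMark w i : ℕ) *
      if w i = 1 ∧ prevMark w i = 0 then s else 1) ≤ transition k (prevMark w i) (w i) := by
    intro i
    generalize prevMark w i = a, w i = b
    rw [transition, ← hs]
    fin_cases a <;> fin_cases b <;> simp <;> nlinarith
  have hprod : ∏ i, ((1 - s) * ((1 / 2) ^ (w i : ℕ) * (1 / 2) ^ (prevMark w i : ℕ) *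
      if w i = 1 ∧ prevMark w i = 0 then s else 1)) ≤ markProb k w := by
    refine Finset.prod_le_prod (fun i _ => ?_) fun i _ => hsite i
    have : (0 : ℝ) ≤ if w i = 1 ∧ prevMark w i = 0 then s else 1 := by split_ifs <;> linarith
    have h1 : 0 ≤ 1 - s := by linarith
    positivity
  refine le_trans ?_ hprod
  rw [Finset.prod_mul_distrib, Finset.prod_mul_distrib, Finset.prod_mul_distrib,
    Finset.prod_pow_eq_pow_sum, Finset.prod_pow_eq_pow_sum, Finset.prod_const, Finset.card_univ,
    Fintype.card_fin, Finset.prod_ite, Finset.prod_const, Finset.prod_const_one, mul_one, mul_assoc]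
  refine mul_le_mul_of_nonneg_left ?_ (pow_nonneg (by linarith) n)
  refine mul_le_mul_of_nonneg_right ?_ (pow_nonneg hs0 _)
  have h4 : ((1 : ℝ) / 4) ^ weight w = (1 / 2) ^ weight w * (1 / 2) ^ weight w := by
    rw [← mul_pow]; norm_num
  rw [h4]
  refine mul_le_mul_of_nonneg_left ?_ (by positivity)
  exact pow_le_pow_of_le_one (by norm_num) (by norm_num) (sum_prevMark_le w)

/-- The number of coins per site. -/
def coinCount (n : ℕ) : ℕ := Nat.clog 2 n + 1

lemma half_pow_coinCount_le (hn : 1 ≤ n) : ((1 : ℝ) / 2) ^ coinCount n ≤ 1 / (2 * n) := by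
  have h : n ≤ 2 ^ Nat.clog 2 n := Nat.le_pow_clog (by norm_num) n
  have h' : (n : ℝ) ≤ 2 ^ Nat.clog 2 n := by exact_mod_cast h
  have hn' : (0 : ℝ) < n := by exact_mod_cast hn
  rw [coinCount, pow_succ', div_pow, one_pow, div_mul_div_comm, one_mul]
  gcongr

lemma le_half_pow_coinCount (hn : 2 ≤ n) : 1 / (4 * (n : ℝ)) ≤ (1 / 2) ^ coinCount n := by
  have h : 2 ^ (Nat.clog 2 n).pred < n := Nat.pow_pred_clog_lt_self (by norm_num) (by omega)
  have hpos : 0 < Nat.clog 2 n := Nat.clog_pos (by norm_num) hn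
  have h2 : 2 ^ coinCount n ≤ 4 * n := by
    have : coinCount n = (Nat.clog 2 n).pred + 2 := by
      rw [coinCount]; have := Nat.succ_pred_eq_of_pos hpos; omega
    rw [this, pow_add]; omega
  have h' : (2 : ℝ) ^ coinCount n ≤ 4 * n := by exact_mod_cast h2
  rw [div_pow, one_pow]
  gcongr

lemma le_markProb_coinCount (hn : 2 ≤ n) (w : Bits n) {a b : ℕ} (ha : weight w ≤ a)
    (hb : runs w ≤ b) :
    1 / 2 * (1 / 16) ^ a * (1 / (4 * (n : ℝ))) ^ b ≤
      markProb (coinCount n) w * (1 / 4) ^ weight w := by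
  have hn' : (2 : ℝ) ≤ n := by exact_mod_cast hn
  have h1 := half_pow_coinCount_le (n := n) (by omega)
  have h2 := le_half_pow_coinCount hn
  have h3 : (1 : ℝ) / 2 ≤ (1 - (1 / 2) ^ coinCount n) ^ n := by
    have hle : 1 - 1 / (2 * (n : ℝ)) ≤ 1 - (1 / 2) ^ coinCount n := by linarith
    have hpos : 0 ≤ 1 - 1 / (2 * (n : ℝ)) := by
      rw [sub_nonneg, div_le_one (by positivity)]; linarith
    refine le_trans ?_ (pow_le_pow_left₀ hpos hle n)
    have := one_add_mul_le_pow (a := -(1 / (2 * (n : ℝ)))) (by linarith) n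
    rw [← sub_eq_add_neg] at this
    refine le_trans (le_of_eq ?_) this
    field_simp
    norm_num
  have h4 := le_markProb (coinCount n) w
  have h5 : (1 / (4 * (n : ℝ))) ^ b ≤ ((1 / 2) ^ coinCount n) ^ runs w := by
    refine le_trans ?_ (pow_le_pow_left₀ (by positivity) h2 _)
    refine pow_le_pow_of_le_one (by positivity) ?_ hb
    rw [div_le_one (by positivity)]; linarith
  have h6 : ((1 : ℝ) / 16) ^ a ≤ (1 / 4) ^ weight w * (1 / 4) ^ weight w := by
    rw [← mul_pow]
    refine (pow_le_pow_of_le_one (by norm_num) (by norm_num) ha).trans (le_of_eq ?_)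
    norm_num
  calc 1 / 2 * (1 / 16) ^ a * (1 / (4 * (n : ℝ))) ^ b
      ≤ (1 - (1 / 2) ^ coinCount n) ^ n * ((1 / 4) ^ weight w * (1 / 4) ^ weight w) *
        ((1 / 2) ^ coinCount n) ^ runs w := by gcongr
    _ = ((1 - (1 / 2) ^ coinCount n) ^ n * (1 / 4) ^ weight w *
        ((1 / 2) ^ coinCount n) ^ runs w) * (1 / 4) ^ weight w := by ring
    _ ≤ _ := by gcongr

end NoGoPRU

namespace NoGoPRU

variable {n k m : ℕ}

/-! ### Basis states and gates -/

/-- The computational basis states. -/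
def ket (z : Bits m) : Bits m → ℂ := Pi.single z 1

lemma ket_apply (z x : Bits m) : ket z x = if x = z then 1 else 0 := by
  simp [ket, Pi.single_apply]

lemma onWires_mulVec_ket {l : ℕ} (e : Fin l ↪ Fin m) (A : Op l) (z : Bits m) :
    (onWires e A).mulVec (ket z) = ∑ a : Bits l, A a (z ∘ e) • ket (Function.extend e a z) := by
  classical
  funext x
  rw [ket, Matrix.mulVec_single_one, Finset.sum_apply]
  simp only [Matrix.col_apply, Pi.smul_apply, smul_eq_mul, ket_apply, onWires, Matrix.of_apply]
  split_ifs with h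
  · rw [Finset.sum_eq_single (x ∘ e)]
    · have : x = Function.extend e (x ∘ e) z := by
        funext j
        by_cases hj : ∃ i, e i = j
        · obtain ⟨i, rfl⟩ := hj
          rw [e.injective.extend_apply]; rfl
        · rw [Function.extend_apply' _ _ _ hj]
          exact h j hj
      rw [if_pos this, mul_one]
    · intro a _ ha
      rw [if_neg, mul_zero]
      rintro rfl
      exact ha (funext fun i => (e.injective.extend_apply a z i).symm)
    · simp
  · symm
    refine Finset.sum_eq_zero fun a _ => ?_
    rw [if_neg, mul_zero]
    rintro rfl
    exact h fun j hj => Function.extend_apply' _ _ _ hj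

/-- Apply a list of operations to a state. -/
def runGates (U : UGroup n) (gs : List (Gate n m)) (ψ : Bits m → ℂ) : Bits m → ℂ :=
  gs.foldl (fun ψ g => (g.op U).mulVec ψ) ψ

lemma runGates_nil (U : UGroup n) (ψ : Bits m → ℂ) : runGates U [] ψ = ψ := rfl

lemma runGates_cons (U : UGroup n) (g : Gate n m) (gs : List (Gate n m)) (ψ : Bits m → ℂ) :
    runGates U (g :: gs) ψ = runGates U gs ((g.op U).mulVec ψ) := rfl

lemma runGates_append (U : UGroup n) (gs gs' : List (Gate n m)) (ψ : Bits m → ℂ) :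
    runGates U (gs ++ gs') ψ = runGates U gs' (runGates U gs ψ) := List.foldl_append ..

lemma runGates_smul (U : UGroup n) (gs : List (Gate n m)) (a : ℂ) (ψ : Bits m → ℂ) :
    runGates U gs (a • ψ) = a • runGates U gs ψ := by
  induction gs generalizing ψ with
  | nil => rfl
  | cons g gs ih => rw [runGates_cons, Matrix.mulVec_smul, ih, runGates_cons]

lemma runGates_add (U : UGroup n) (gs : List (Gate n m)) (ψ φ : Bits m → ℂ) :
    runGates U gs (ψ + φ) = runGates U gs ψ + runGates U gs φ := by
  induction gs generalizing ψ φ with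
  | nil => rfl
  | cons g gs ih => rw [runGates_cons, Matrix.mulVec_add, ih, runGates_cons, runGates_cons]

lemma runGates_zero (U : UGroup n) (gs : List (Gate n m)) :
    runGates U gs 0 = 0 := by
  have := runGates_smul U gs 0 0
  simpa using this

lemma runGates_sum (U : UGroup n) (gs : List (Gate n m)) {ι : Type*} (s : Finset ι)
    (ψ : ι → Bits m → ℂ) :
    runGates U gs (∑ i ∈ s, ψ i) = ∑ i ∈ s, runGates U gs (ψ i) := by
  classical
  induction s using Finset.induction_on with
  | empty => simp [runGates_zero]
  | insert a s ha ih => rw [Finset.sum_insert ha, runGates_add, ih, Finset.sum_insert ha]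

lemma runGates_flatMap_finRange (U : UGroup n) {l : ℕ} (f : Fin l → List (Gate n m))
    (φ : ℕ → Bits m → ℂ) (h : ∀ i : Fin l, runGates U (f i) (φ i) = φ (i + 1)) :
    runGates U ((List.finRange l).flatMap f) (φ 0) = φ l := by
  induction l with
  | zero => rfl
  | succ l ih =>
    rw [List.finRange_succ_last, List.flatMap_append, runGates_append, List.flatMap_map,
      ih (fun i => f i.castSucc) (fun i => h i.castSucc)]
    simpa using h (Fin.last l)

lemma sum_accept {ι : Type*} [Fintype ι] (z : ι → Bits m) (hz : Function.Injective z) (α : ι → ℂ)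
    (o : Fin m) :
    (∑ x : Bits m, if x o = 1 then ‖(∑ i, α i • ket (z i)) x‖ ^ 2 else 0) =
      ∑ i, if z i o = 1 then ‖α i‖ ^ 2 else 0 := by
  classical
  have h1 : ∀ x : Bits m, (∑ i, α i • ket (z i)) x = ∑ i, if x = z i then α i else 0 := by
    intro x
    rw [Finset.sum_apply]
    simp [ket_apply]
  have h2 : ∀ i, (∑ i', if z i = z i' then α i' else 0) = α i := by
    intro i
    simp [hz.eq_iff]
  have h3 : ∀ x : Bits m, x ∉ Finset.univ.image z →
      (if x o = 1 then ‖(∑ i, α i • ket (z i)) x‖ ^ 2 else 0) = 0 := by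
    intro x hx
    have : (∑ i, α i • ket (z i)) x = 0 := by
      rw [h1]
      refine Finset.sum_eq_zero fun i _ => if_neg ?_
      rintro rfl
      exact hx (Finset.mem_image_of_mem _ (Finset.mem_univ _))
    simp [this]
  rw [← Finset.sum_subset (Finset.subset_univ (Finset.univ.image z)) fun x _ hx => h3 x hx,
    Finset.sum_image fun i _ j _ hij => hz hij]
  refine Finset.sum_congr rfl fun i _ => ?_
  rw [h1, h2]

/-! ### The wires of the circuit -/

/-- The wires of the distinguishing circuit: the control qubit; the marks `w`; for each site the two
qubits `x` and `y` on which the unknown unitary acts, the coins `p` and `q` that determine their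
initial values, the coins `c` and `r` that determine the marks, partial conjunctions `u` of the
coins `r`, and the control `v` of a swap. -/
inductive Wire (n k : ℕ)
  | ctl
  | w (i : Fin (n + 1))
  | x (i : Fin n)
  | y (i : Fin n)
  | p (i : Fin n)
  | q (i : Fin n)
  | c (i : Fin n)
  | v (i : Fin n)
  | u (i : Fin n) (j : Fin (k + 1))
  | r (i : Fin n) (j : Fin k)
  deriving DecidableEq

/-- The position of a wire in the register. -/
def Wire.index : Wire n k → ℕ
  | .ctl => 0
  | .w i => i * (2 * k + 8) + 1
  | .x i => i * (2 * k + 8) + 2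
  | .y i => i * (2 * k + 8) + 3
  | .p i => i * (2 * k + 8) + 4
  | .q i => i * (2 * k + 8) + 5
  | .c i => i * (2 * k + 8) + 6
  | .v i => i * (2 * k + 8) + 7
  | .u i j => i * (2 * k + 8) + 8 + 2 * j
  | .r i j => i * (2 * k + 8) + 9 + 2 * j

/-- The block of the register to which a wire belongs. -/
def Wire.site : Wire n k → ℕ
  | .ctl => 0
  | .w i => i
  | .x i => i
  | .y i => i
  | .p i => i
  | .q i => i
  | .c i => i
  | .v i => i
  | .u i _ => i
  | .r i _ => i

/-- The position of a wire within its block. -/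
def Wire.offset : Wire n k → ℕ
  | .ctl => 0
  | .w _ => 0
  | .x _ => 1
  | .y _ => 2
  | .p _ => 3
  | .q _ => 4
  | .c _ => 5
  | .v _ => 6
  | .u _ j => 7 + 2 * j
  | .r _ j => 8 + 2 * j

lemma Wire.index_eq {a : Wire n k} (ha : a ≠ .ctl) :
    a.index = a.site * (2 * k + 8) + a.offset + 1 := by
  cases a <;> simp_all [Wire.index, Wire.site, Wire.offset] <;> omega

lemma Wire.offset_lt (a : Wire n k) : a.offset < 2 * k + 8 := by
  cases a <;> simp only [Wire.offset] <;> omega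

lemma Wire.eq_of_site_eq_of_offset_eq {a b : Wire n k} (ha : a ≠ .ctl) (hb : b ≠ .ctl)
    (hs : a.site = b.site) (ho : a.offset = b.offset) : a = b := by
  cases a <;> cases b <;> simp only [Wire.site, Wire.offset] at hs ho <;>
    first
    | exact absurd rfl ha
    | exact absurd rfl hb
    | (exfalso; omega)
    | (congr 1 <;> apply Fin.ext <;> omega)

lemma Wire.index_injective : Function.Injective (Wire.index (n := n) (k := k)) := by
  intro a b hab
  by_cases ha : a = .ctl
  · by_cases hb : b = .ctl
    · rw [ha, hb]
    · rw [Wire.index_eq hb, ha] at hab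
      simp [Wire.index] at hab
  · by_cases hb : b = .ctl
    · rw [Wire.index_eq ha, hb] at hab
      simp [Wire.index] at hab
    · rw [Wire.index_eq ha, Wire.index_eq hb] at hab
      have hab' : a.offset + (2 * k + 8) * a.site = b.offset + (2 * k + 8) * b.site := by
        rw [mul_comm _ a.site, mul_comm _ b.site]; omega
      have h1 := congrArg (· % (2 * k + 8)) hab'
      have h2 := congrArg (· / (2 * k + 8)) hab'
      simp only [Nat.add_mul_mod_self_left, Nat.mod_eq_of_lt (Wire.offset_lt _)] at h1
      simp only [Nat.add_mul_div_left _ _ (show 0 < 2 * k + 8 by omega),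
        Nat.div_eq_of_lt (Wire.offset_lt _), zero_add] at h2
      exact Wire.eq_of_site_eq_of_offset_eq ha hb h2 h1

lemma Wire.index_lt (a : Wire n k) : a.index < n * (2 * k + 8) + 2 := by
  have key : ∀ i : Fin n, (i : ℕ) * (2 * k + 8) + (2 * k + 8) ≤ n * (2 * k + 8) := by
    intro i
    rw [← Nat.succ_mul]
    exact Nat.mul_le_mul_right _ i.2
  cases a with
  | ctl => simp [Wire.index]
  | w i =>
    have : (i : ℕ) * (2 * k + 8) ≤ n * (2 * k + 8) := Nat.mul_le_mul_right _ (by omega)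
    simp only [Wire.index]; omega
  | u i j => have := key i; simp only [Wire.index]; omega
  | r i j => have := key i; simp only [Wire.index]; omega
  | _ i => have := key i; simp only [Wire.index]; omega

lemma Wire.index_surjective {t : ℕ} (ht : t < n * (2 * k + 8) + 2) :
    ∃ a : Wire n k, a.index = t := by
  rcases Nat.eq_zero_or_pos t with rfl | hpos
  · exact ⟨.ctl, rfl⟩
  have hdm := Nat.div_add_mod (t - 1) (2 * k + 8)
  have hlt := Nat.mod_lt (t - 1) (show 0 < 2 * k + 8 by omega)
  rw [mul_comm] at hdm
  generalize (t - 1) / (2 * k + 8) = i at hdm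
  generalize (t - 1) % (2 * k + 8) = o at hdm hlt
  have hi : i < n + 1 := by
    by_contra hc
    have : (n + 1) * (2 * k + 8) ≤ i * (2 * k + 8) := Nat.mul_le_mul_right _ (by omega)
    rw [Nat.succ_mul] at this
    omega
  by_cases ho : o = 0
  · exact ⟨.w ⟨i, hi⟩, by simp only [Wire.index]; omega⟩
  have hi' : i < n := by
    by_contra hc
    have : n * (2 * k + 8) ≤ i * (2 * k + 8) := Nat.mul_le_mul_right _ (by omega)
    omega
  by_cases h7 : 7 ≤ o
  · rcases Nat.even_or_odd' o with ⟨j, hj | hj⟩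
    · exact ⟨.r ⟨i, hi'⟩ ⟨j - 4, by omega⟩, by simp only [Wire.index]; omega⟩
    · exact ⟨.u ⟨i, hi'⟩ ⟨j - 3, by omega⟩, by simp only [Wire.index]; omega⟩
  · have h6 : o = 1 ∨ o = 2 ∨ o = 3 ∨ o = 4 ∨ o = 5 ∨ o = 6 := by omega
    rcases h6 with h | h | h | h | h | h
    · exact ⟨.x ⟨i, hi'⟩, by simp only [Wire.index]; omega⟩
    · exact ⟨.y ⟨i, hi'⟩, by simp only [Wire.index]; omega⟩
    · exact ⟨.p ⟨i, hi'⟩, by simp only [Wire.index]; omega⟩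
    · exact ⟨.q ⟨i, hi'⟩, by simp only [Wire.index]; omega⟩
    · exact ⟨.c ⟨i, hi'⟩, by simp only [Wire.index]; omega⟩
    · exact ⟨.v ⟨i, hi'⟩, by simp only [Wire.index]; omega⟩

/-- The number of wires. -/
def regWidth (n k : ℕ) : ℕ := n * (2 * k + 8) + 2

/-- The arrangement of the wires in the register. -/
def Wire.equiv (n k : ℕ) : Wire n k ≃ Fin (regWidth n k) :=
  Equiv.ofBijective (fun a => ⟨a.index, a.index_lt⟩)
    ⟨fun _ _ h => Wire.index_injective (Fin.mk.inj h), fun t =>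
      (Wire.index_surjective t.2).imp fun _ h => Fin.ext h⟩

/-- The basis state with given values of the wires. -/
def wireKet (z : Wire n k → Fin 2) : Bits (regWidth n k) → ℂ := ket (z ∘ (Wire.equiv n k).symm)

/-- The operation of the given kind on the given wires. -/
def wireGate (κ : GateKind) (f : Fin (κ.arity n) ↪ Wire n k) : Gate n (regWidth n k) :=
  ⟨κ, f.trans (Wire.equiv n k).toEmbedding⟩

lemma wireGate_mulVec (U : UGroup n) (κ : GateKind) (f : Fin (κ.arity n) ↪ Wire n k)
    (z : Wire n k → Fin 2) :
    ((wireGate κ f).op U).mulVec (wireKet z) =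
      ∑ a, κ.matrix U a (z ∘ f) • wireKet (Function.extend f a z) := by
  have h := onWires_mulVec_ket (f.trans (Wire.equiv n k).toEmbedding) (κ.matrix U)
    (z ∘ (Wire.equiv n k).symm)
  refine h.trans (Finset.sum_congr rfl fun a _ => ?_)
  have h1 : (z ∘ (Wire.equiv n k).symm) ∘ (f.trans (Wire.equiv n k).toEmbedding) = z ∘ f := by
    funext i; simp
  have h2 : Function.extend (f.trans (Wire.equiv n k).toEmbedding) a (z ∘ (Wire.equiv n k).symm) =
      Function.extend f a z ∘ (Wire.equiv n k).symm := by
    funext t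
    obtain ⟨b, rfl⟩ := (Wire.equiv n k).surjective t
    by_cases hb : ∃ i, f i = b
    · obtain ⟨i, rfl⟩ := hb
      have := (f.trans (Wire.equiv n k).toEmbedding).injective.extend_apply a
        (z ∘ (Wire.equiv n k).symm) i
      refine this.trans ?_
      rw [Function.comp_apply, Equiv.symm_apply_apply, f.injective.extend_apply]
    · rw [Function.extend_apply', Function.comp_apply, Function.comp_apply,
        Equiv.symm_apply_apply, Function.extend_apply' _ _ _ hb]
      rintro ⟨i, hi⟩
      exact hb ⟨i, (Wire.equiv n k).injective hi⟩
  rw [h1, h2, wireKet]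

lemma wireGate_mulVec_classical (U : UGroup n) (κ : GateKind) (f : Fin (κ.arity n) ↪ Wire n k)
    (z : Wire n k → Fin 2) (b : Bits (κ.arity n))
    (h : ∀ a, κ.matrix U a (z ∘ f) = if a = b then 1 else 0) :
    ((wireGate κ f).op U).mulVec (wireKet z) = wireKet (Function.extend f b z) := by
  rw [wireGate_mulVec]
  simp [h]

/-- A gate on one wire. -/
def gateX (a : Wire n k) : Gate n (regWidth n k) :=
  wireGate .X ⟨fun _ : Fin 1 => a, fun i j _ => Subsingleton.elim i j⟩

/-- The Hadamard gate. -/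
def gateH (a : Wire n k) : Gate n (regWidth n k) :=
  wireGate .H ⟨fun _ : Fin 1 => a, fun i j _ => Subsingleton.elim i j⟩

/-- The gate `CNOT` with control `a` and target `b`. -/
def gateCNOT (a b : Wire n k) (h : a ≠ b) : Gate n (regWidth n k) :=
  wireGate .CNOT ⟨(![a, b] : Fin 2 → Wire n k), by
    intro i j; fin_cases i <;> fin_cases j <;> simp [h, h.symm]⟩

/-- The Toffoli gate with controls `a`, `b` and target `c`. -/
def gateToffoli (a b c : Wire n k) (h : a ≠ b ∧ a ≠ c ∧ b ≠ c) : Gate n (regWidth n k) :=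
  wireGate .Toffoli ⟨(![a, b, c] : Fin 3 → Wire n k), by
    intro i j; fin_cases i <;> fin_cases j <;> simp [h, h.1.symm, h.2.1.symm, h.2.2.symm]⟩

/-- A query to the unknown unitary. -/
def gateQuery (f : Fin n ↪ Wire n k) : Gate n (regWidth n k) := wireGate .query f

lemma gateX_mulVec (U : UGroup n) (a : Wire n k) (z : Wire n k → Fin 2) :
    ((gateX a).op U).mulVec (wireKet z) = wireKet (Function.update z a (z a + 1)) := by
  rw [gateX, wireGate_mulVec_classical U .X _ z (fun _ : Fin 1 => z a + 1)]
  · congr 1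
    funext t
    by_cases ht : t = a
    · subst ht
      rw [Function.update_self]
      exact Function.Injective.extend_apply (f := fun _ : Fin 1 => t)
        (fun i j _ => Subsingleton.elim i j) (fun _ => z t + 1) z 0
    · rw [Function.update_of_ne ht, Function.extend_apply']
      rintro ⟨i, hi⟩
      exact ht hi.symm
  · intro b
    have hb : (b = fun _ : Fin 1 => z a + 1) ↔ b (0 : Fin 1) = z a + 1 :=
      ⟨fun h => by rw [h], fun h => funext fun i => by rw [Subsingleton.elim i (0 : Fin 1), h]⟩
    simp only [hb, GateKind.matrix, Matrix.of_apply, Function.comp_apply]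
    generalize b (0 : Fin 1) = s, z a = t
    fin_cases s <;> fin_cases t <;> simp

lemma gateCNOT_mulVec (U : UGroup n) (a b : Wire n k) (h : a ≠ b) (z : Wire n k → Fin 2) :
    ((gateCNOT a b h).op U).mulVec (wireKet z) = wireKet (Function.update z b (z b + z a)) := by
  rw [gateCNOT, wireGate_mulVec_classical U .CNOT _ z (![z a, z b + z a] : Fin 2 → Fin 2)]
  · congr 1
    funext t
    have hinj : Function.Injective (![a, b] : Fin 2 → Wire n k) := by
      intro i j; fin_cases i <;> fin_cases j <;> simp [h, h.symm]
    have he := hinj.extend_apply (![z a, z b + z a] : Fin 2 → Fin 2) z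
    by_cases htb : t = b
    · subst htb
      rw [Function.update_self]
      exact he 1
    · rw [Function.update_of_ne htb]
      by_cases hta : t = a
      · subst hta
        exact he 0
      · refine Function.extend_apply' _ _ _ ?_
        rintro ⟨i, hi⟩
        revert hi
        change (![a, b] : Fin 2 → Wire n k) i = t → False
        fin_cases i
        · exact fun hi => hta hi.symm
        · exact fun hi => htb hi.symm
  · intro s
    simp only [GateKind.matrix, Matrix.of_apply]
    congr 1
    rw [eq_iff_iff]
    constructor
    · rintro ⟨h1, h2⟩
      funext i
      fin_cases i
      · exact h1
      · exact h2
    · rintro rfl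
      exact ⟨rfl, rfl⟩

lemma gateToffoli_mulVec (U : UGroup n) (a b c : Wire n k) (h : a ≠ b ∧ a ≠ c ∧ b ≠ c)
    (z : Wire n k → Fin 2) :
    ((gateToffoli a b c h).op U).mulVec (wireKet z) =
      wireKet (Function.update z c (z c + z a * z b)) := by
  rw [gateToffoli,
    wireGate_mulVec_classical U .Toffoli _ z (![z a, z b, z c + z a * z b] : Fin 3 → Fin 2)]
  · congr 1
    funext t
    have hinj : Function.Injective (![a, b, c] : Fin 3 → Wire n k) := by
      intro i j; fin_cases i <;> fin_cases j <;> simp [h, h.1.symm, h.2.1.symm, h.2.2.symm]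
    have he := hinj.extend_apply (![z a, z b, z c + z a * z b] : Fin 3 → Fin 2) z
    by_cases htc : t = c
    · subst htc
      rw [Function.update_self]
      exact he 2
    · rw [Function.update_of_ne htc]
      by_cases hta : t = a
      · subst hta
        exact he 0
      · by_cases htb : t = b
        · subst htb
          exact he 1
        · refine Function.extend_apply' _ _ _ ?_
          rintro ⟨i, hi⟩
          revert hi
          change (![a, b, c] : Fin 3 → Wire n k) i = t → False
          fin_cases i
          · exact fun hi => hta hi.symm
          · exact fun hi => htb hi.symm
          · exact fun hi => htc hi.symm
  · intro s
    simp only [GateKind.matrix, Matrix.of_apply]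
    congr 1
    rw [eq_iff_iff]
    constructor
    · rintro ⟨h1, h2, h3⟩
      funext i
      fin_cases i
      · exact h1
      · exact h2
      · exact h3
    · rintro rfl
      exact ⟨rfl, rfl, rfl⟩

/-- The normalization of the Hadamard gate. -/
def invSqrtTwo : ℂ := ((1 / Real.sqrt 2 : ℝ) : ℂ)

lemma norm_invSqrtTwo_sq : ‖invSqrtTwo‖ ^ 2 = 1 / 2 := by
  rw [invSqrtTwo, Complex.norm_real, Real.norm_eq_abs, sq_abs, div_pow, Real.sq_sqrt (by norm_num)]
  norm_num

lemma gateH_mulVec (U : UGroup n) (a : Wire n k) (z : Wire n k → Fin 2) :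
    ((gateH a).op U).mulVec (wireKet z) = invSqrtTwo • (wireKet (Function.update z a 0) +
      (if z a = 0 then (1 : ℂ) else -1) • wireKet (Function.update z a 1)) := by
  have hext : ∀ b : Fin 1 → Fin 2, Function.extend (fun _ : Fin 1 => a) b z =
      Function.update z a (b 0) := by
    intro b
    funext t
    by_cases ht : t = a
    · subst ht
      rw [Function.update_self]
      exact Function.Injective.extend_apply (f := fun _ : Fin 1 => t)
        (fun i j _ => Subsingleton.elim i j) b z 0
    · rw [Function.update_of_ne ht, Function.extend_apply']
      rintro ⟨i, hi⟩
      exact ht hi.symm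
  have hsum : ∑ b : Fin 1 → Fin 2, (((1 / Real.sqrt 2 : ℝ) : ℂ) *
      (!![1, 1; 1, -1] : Matrix (Fin 2) (Fin 2) ℂ) (b 0) (z a)) •
        wireKet (Function.update z a (b 0)) = invSqrtTwo • (wireKet (Function.update z a 0) +
      (if z a = 0 then (1 : ℂ) else -1) • wireKet (Function.update z a 1)) := by
    rw [← (Equiv.funUnique (Fin 1) (Fin 2)).symm.sum_comp, Fin.sum_univ_two]
    have h0 : ∀ b : Fin 2, (Equiv.funUnique (Fin 1) (Fin 2)).symm b (0 : Fin 1) = b := fun _ => rfl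
    simp only [h0]
    rw [smul_add, smul_smul, invSqrtTwo]
    congr 2
    · generalize z a = t
      fin_cases t <;> simp
    · generalize z a = t
      fin_cases t <;> simp
  rw [gateH, wireGate_mulVec, ← hsum]
  refine Finset.sum_congr rfl fun b _ => ?_
  exact congrArg _ (congrArg wireKet (hext b))

lemma gateQuery_mulVec (U : UGroup n) (f : Fin n ↪ Wire n k) (z : Wire n k → Fin 2) :
    ((gateQuery f).op U).mulVec (wireKet z) =
      ∑ a : Bits n, (U : Op n) a (z ∘ f) • wireKet (Function.extend f a z) :=
  wireGate_mulVec U .query f z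

end NoGoPRU

namespace NoGoPRU

variable {n k : ℕ}

/-! ### The distinguishing circuit -/

/-- The Hadamard gates that toss the coins of a site. -/
def tossGates (i : Fin n) : List (Gate n (regWidth n k)) :=
  [gateH (.p i), gateH (.q i), gateH (.c i)] ++ (List.finRange k).map fun j => gateH (.r i j)

/-- One step of the conjunction of the coins of a site. -/
def andGate (i : Fin n) (j : Fin k) : Gate n (regWidth n k) :=
  gateToffoli (.u i j.castSucc) (.r i j) (.u i j.succ)
    ⟨by simp, by simpa using j.castSucc_lt_succ.ne, by simp⟩

/-- The gates that initialize a site from its coins and compute its mark. -/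
def markGates (i : Fin n) : List (Gate n (regWidth n k)) :=
  [gateCNOT (.p i) (.x i) (by simp), gateCNOT (.q i) (.y i) (by simp), gateX (.u i 0)] ++
    (List.finRange k).map (andGate i) ++
    [gateCNOT (.u i (Fin.last k)) (.w i.succ) (by simp),
      gateToffoli (.c i) (.w i.castSucc) (.w i.succ)
        ⟨by simp, by simp, by simpa using i.castSucc_lt_succ.ne⟩]

/-- The swap of `x` and `y` with control `v`. -/
def swapGates (i : Fin n) : List (Gate n (regWidth n k)) :=
  [gateCNOT (.y i) (.x i) (by simp), gateToffoli (.v i) (.x i) (.y i) (by simp),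
    gateCNOT (.y i) (.x i) (by simp)]

/-- The swap before the queries, at marked sites and if the control qubit is `1`. -/
def preSwapGates (i : Fin n) : List (Gate n (regWidth n k)) :=
  gateToffoli .ctl (.w i.succ) (.v i) (by simp) ::
    (swapGates i ++ [gateCNOT (.w i.succ) (.v i) (by simp)])

/-- The swap after the queries, at marked sites and if the control qubit is `0`. -/
def postSwapGates (i : Fin n) : List (Gate n (regWidth n k)) :=
  swapGates i ++ [gateToffoli .ctl (.w i.succ) (.v i) (by simp)]

/-- The gates before the queries. -/
def preGates (n k : ℕ) : List (Gate n (regWidth n k)) :=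
  (List.finRange n).flatMap tossGates ++ (List.finRange n).flatMap markGates ++ [gateH .ctl] ++
    (List.finRange n).flatMap preSwapGates

/-- The wires of the first query. -/
def xWires (n k : ℕ) : Fin n ↪ Wire n k :=
  ⟨Wire.x, by intro _ _ h; exact Wire.x.inj h⟩

/-- The wires of the second query. -/
def yWires (n k : ℕ) : Fin n ↪ Wire n k :=
  ⟨Wire.y, by intro _ _ h; exact Wire.y.inj h⟩

/-- The two queries. -/
def queryGates (n k : ℕ) : List (Gate n (regWidth n k)) :=
  [gateQuery (xWires n k), gateQuery (yWires n k)]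

/-- The gates after the queries. -/
def postGates (n k : ℕ) : List (Gate n (regWidth n k)) :=
  (List.finRange n).flatMap postSwapGates ++ [gateH .ctl]

/-- The distinguishing circuit. -/
def swapCircuit (n k : ℕ) : Circuit n where
  width := regWidth n k
  gates := preGates n k ++ queryGates n k ++ postGates n k
  out := Wire.equiv n k .ctl

/-! ### The coins -/

/-- The assignment with value `1` on the given set of wires. -/
def indicator (s : Finset (Wire n k)) : Wire n k → Fin 2 := fun t => if t ∈ s then 1 else 0

lemma gateH_mulVec_indicator (U : UGroup n) {a : Wire n k} {s : Finset (Wire n k)} (ha : a ∉ s) :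
    ((gateH a).op U).mulVec (wireKet (indicator s)) =
      invSqrtTwo • (wireKet (indicator s) + wireKet (indicator (insert a s))) := by
  have h0 : indicator s a = 0 := if_neg ha
  have h1 : Function.update (indicator s) a 0 = indicator s := by
    rw [← h0, Function.update_eq_self]
  have h2 : Function.update (indicator s) a 1 = indicator (insert a s) := by
    funext t
    by_cases ht : t = a
    · subst ht; simp [indicator]
    · simp [indicator, ht]
  rw [gateH_mulVec, h1, h2, if_pos h0, one_smul]

lemma runGates_gateH (U : UGroup n) (l : List (Wire n k)) (hl : l.Nodup)
    (s : Finset (Wire n k)) (hs : ∀ a ∈ l, a ∉ s) :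
    runGates U (l.map gateH) (∑ A ∈ s.powerset, wireKet (indicator A)) =
      invSqrtTwo ^ l.length • ∑ A ∈ (s ∪ l.toFinset).powerset, wireKet (indicator A) := by
  induction l generalizing s with
  | nil => simp [runGates_nil]
  | cons a l ih =>
    have ha : a ∉ s := hs a (by simp)
    have h1 : ((gateH a).op U).mulVec (∑ A ∈ s.powerset, wireKet (indicator A)) =
        invSqrtTwo • ∑ A ∈ (insert a s).powerset, wireKet (indicator A) := by
      rw [Matrix.mulVec_sum, Finset.sum_powerset_insert ha, ← Finset.sum_add_distrib,
        Finset.smul_sum]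
      refine Finset.sum_congr rfl fun A hA => ?_
      exact gateH_mulVec_indicator U fun h => ha (Finset.mem_powerset.mp hA h)
    rw [List.map_cons, runGates_cons, h1, runGates_smul, ih hl.of_cons, smul_smul, List.length_cons,
      pow_succ']
    · congr 3
      ext t
      simp only [Finset.mem_union, Finset.mem_insert, List.mem_toFinset, List.mem_cons]
      tauto
    · intro b hb hb'
      rcases Finset.mem_insert.mp hb' with rfl | hb'
      · exact (List.nodup_cons.mp hl).1 hb
      · exact hs b (List.mem_cons_of_mem _ hb) hb'

/-- The coins. -/
def coinList (n k : ℕ) : List (Wire n k) :=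
  (List.finRange n).flatMap fun i => [.p i, .q i, .c i] ++ (List.finRange k).map fun j => .r i j

lemma flatMap_tossGates :
    (List.finRange n).flatMap (tossGates (k := k)) = (coinList n k).map gateH := by
  rw [coinList, List.map_flatMap]
  congr 1
  funext i
  simp [tossGates]

lemma coinList_nodup : (coinList n k).Nodup := by
  rw [coinList, List.nodup_flatMap]
  constructor
  · intro i _
    rw [List.nodup_append]
    refine ⟨by simp, ?_, by simp⟩
    exact (List.nodup_finRange k).map fun a b h => by simpa using h
  · refine (List.nodup_finRange n).imp ?_
    intro i j hij
    rw [Function.onFun, List.disjoint_left]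
    intro t ht ht'
    simp only [List.mem_append, List.mem_cons, List.mem_map, List.not_mem_nil, or_false] at ht ht'
    rcases ht with (rfl | rfl | rfl) | ⟨_, _, rfl⟩ <;> simp [hij] at ht'
    exact hij ht'.symm

lemma length_coinList : (coinList n k).length = n * (k + 3) := by
  simp [coinList, List.length_flatMap]

/-- The state of the wires after the coin tosses. -/
def tossed (p q c : Bits n) (r : Fin n → Bits k) : Wire n k → Fin 2
  | .p i => p i
  | .q i => q i
  | .c i => c i
  | .r i j => r i j
  | _ => 0

lemma mem_coinList (t : Wire n k) : t ∈ (coinList n k).toFinset ↔ (∃ i, t = .p i) ∨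
    (∃ i, t = .q i) ∨ (∃ i, t = .c i) ∨ ∃ i j, t = .r i j := by
  simp only [coinList, List.mem_toFinset, List.mem_flatMap, List.mem_finRange, true_and,
    List.mem_append, List.mem_cons, List.mem_map, List.not_mem_nil, or_false]
  constructor
  · rintro ⟨i, (h | h | h) | ⟨j, h⟩⟩
    · exact Or.inl ⟨i, h⟩
    · exact Or.inr (Or.inl ⟨i, h⟩)
    · exact Or.inr (Or.inr (Or.inl ⟨i, h⟩))
    · exact Or.inr (Or.inr (Or.inr ⟨i, j, h.symm⟩))
  · rintro (⟨i, h⟩ | ⟨i, h⟩ | ⟨i, h⟩ | ⟨i, j, h⟩)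
    · exact ⟨i, Or.inl (Or.inl h)⟩
    · exact ⟨i, Or.inl (Or.inr (Or.inl h))⟩
    · exact ⟨i, Or.inl (Or.inr (Or.inr h))⟩
    · exact ⟨i, Or.inr ⟨j, h.symm⟩⟩

lemma tossed_eq_zero (p q c : Bits n) (r : Fin n → Bits k) {t : Wire n k}
    (ht : t ∉ (coinList n k).toFinset) : tossed p q c r t = 0 := by
  rw [mem_coinList] at ht
  cases t with
  | p i => exact absurd (Or.inl ⟨i, rfl⟩) ht
  | q i => exact absurd (Or.inr (Or.inl ⟨i, rfl⟩)) ht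
  | c i => exact absurd (Or.inr (Or.inr (Or.inl ⟨i, rfl⟩))) ht
  | r i j => exact absurd (Or.inr (Or.inr (Or.inr ⟨i, j, rfl⟩))) ht
  | _ => rfl

lemma indicator_filter_tossed (p q c : Bits n) (r : Fin n → Bits k) :
    indicator ((coinList n k).toFinset.filter fun t => tossed p q c r t = 1) =
      tossed p q c r := by
  funext t
  unfold indicator
  by_cases ht : t ∈ (coinList n k).toFinset
  · rcases fin_two_eq_zero_or_one (tossed p q c r t) with h | h
    · rw [if_neg, h]
      rw [Finset.mem_filter, h]
      exact fun h' => absurd h'.2 (by decide)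
    · rw [if_pos (Finset.mem_filter.mpr ⟨ht, h⟩), h]
  · rw [tossed_eq_zero p q c r ht, if_neg]
    exact fun h => ht (Finset.mem_filter.mp h).1

lemma filter_tossed_indicator {A : Finset (Wire n k)} (hA : A ⊆ (coinList n k).toFinset) :
    ((coinList n k).toFinset.filter fun t => tossed (fun i => indicator A (.p i))
      (fun i => indicator A (.q i)) (fun i => indicator A (.c i))
      (fun i j => indicator A (.r i j)) t = 1) = A := by
  have h : ∀ t ∈ (coinList n k).toFinset, tossed (fun i => indicator A (.p i))
      (fun i => indicator A (.q i)) (fun i => indicator A (.c i))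
      (fun i j => indicator A (.r i j)) t = indicator A t := by
    intro t ht
    rw [mem_coinList] at ht
    rcases ht with ⟨i, rfl⟩ | ⟨i, rfl⟩ | ⟨i, rfl⟩ | ⟨i, j, rfl⟩ <;> rfl
  have hind : ∀ t, indicator A t = 1 ↔ t ∈ A := by
    intro t
    unfold indicator
    split_ifs with h'
    · simp [h']
    · simp [h']
  ext t
  rw [Finset.mem_filter]
  constructor
  · rintro ⟨ht, h'⟩
    rwa [h t ht, hind] at h'
  · intro ht
    exact ⟨hA ht, by rw [h t (hA ht), hind]; exact ht⟩

lemma sum_indicator_coinList {M : Type*} [AddCommMonoid M] (f : (Wire n k → Fin 2) → M) :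
    ∑ A ∈ (coinList n k).toFinset.powerset, f (indicator A) =
      ∑ ρ : Bits n × Bits n × Bits n × (Fin n → Bits k),
        f (tossed ρ.1 ρ.2.1 ρ.2.2.1 ρ.2.2.2) := by
  symm
  refine Finset.sum_bij' (fun ρ _ => (coinList n k).toFinset.filter fun t =>
      tossed ρ.1 ρ.2.1 ρ.2.2.1 ρ.2.2.2 t = 1)
    (fun A _ => (fun i => indicator A (.p i), fun i => indicator A (.q i),
      fun i => indicator A (.c i), fun i j => indicator A (.r i j))) ?_ ?_ ?_ ?_ ?_
  · intro ρ _
    exact Finset.mem_powerset.mpr (Finset.filter_subset _ _)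
  · exact fun _ _ => Finset.mem_univ _
  · rintro ⟨p, q, c, r⟩ _
    rw [indicator_filter_tossed]
    rfl
  · intro A hA
    exact filter_tossed_indicator (Finset.mem_powerset.mp hA)
  · rintro ⟨p, q, c, r⟩ _
    rw [indicator_filter_tossed]

lemma runGates_toss (U : UGroup n) :
    runGates U ((List.finRange n).flatMap tossGates) (Pi.single 0 1) =
      invSqrtTwo ^ (n * (k + 3)) • ∑ ρ : Bits n × Bits n × Bits n × (Fin n → Bits k),
        wireKet (tossed ρ.1 ρ.2.1 ρ.2.2.1 ρ.2.2.2) := by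
  have h0 : (Pi.single 0 1 : Bits (regWidth n k) → ℂ) =
      ∑ A ∈ (∅ : Finset (Wire n k)).powerset, wireKet (indicator A) := by
    rw [Finset.powerset_empty, Finset.sum_singleton]
    rfl
  rw [flatMap_tossGates, h0, runGates_gateH U _ coinList_nodup _ (by simp), length_coinList,
    Finset.empty_union, sum_indicator_coinList wireKet]

/-! ### The marks -/

/-- The conjunction of the first `j` bits. -/
def leadingAnd (r : Bits k) (j : ℕ) : Fin 2 := if ∀ l : Fin k, (l : ℕ) < j → r l = 1 then 1 else 0

lemma leadingAnd_zero (r : Bits k) : leadingAnd r 0 = 1 := by simp [leadingAnd]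

lemma leadingAnd_succ (r : Bits k) (j : Fin k) :
    leadingAnd r (j + 1) = leadingAnd r j * r j := by
  unfold leadingAnd
  by_cases h : ∀ l : Fin k, (l : ℕ) < j → r l = 1
  · rw [if_pos h, one_mul]
    rcases fin_two_eq_zero_or_one (r j) with h0 | h0
    · rw [if_neg, h0]
      intro h'
      have := h' j (by omega)
      rw [h0] at this
      exact absurd this (by decide)
    · rw [if_pos, h0]
      intro l hl
      rcases Nat.lt_succ_iff_lt_or_eq.mp hl with h1 | h1
      · exact h l h1
      · rw [Fin.ext h1]; exact h0
  · rw [if_neg h, if_neg, zero_mul]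
    exact fun h' => h fun l hl => h' l (by omega)

lemma leadingAnd_self (r : Bits k) : leadingAnd r k = allOnes r := by
  simp [leadingAnd, allOnes]

/-- The state of the wires during the computation of the marks. -/
def partialMarked (p q c : Bits n) (r : Fin n → Bits k) (s t l : ℕ) : Wire n k → Fin 2
  | .ctl => 0
  | .w i => if (i : ℕ) ≤ t then markSeq c r i else 0
  | .x i => if (i : ℕ) < s then p i else 0
  | .y i => if (i : ℕ) < s then q i else 0
  | .p i => p i
  | .q i => q i
  | .c i => c i
  | .v _ => 0
  | .u i j => if (i : ℕ) < t ∨ ((i : ℕ) = t ∧ (j : ℕ) < l) then leadingAnd (r i) j else 0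
  | .r i j => r i j

/-- The state of the wires when the marks have been computed, with arbitrary values of the control
qubit and of the wires `x`, `y` and `v`. -/
def marked (p q c : Bits n) (r : Fin n → Bits k) (b : Fin 2) (a : Bits n × Bits n) (v : Bits n) :
    Wire n k → Fin 2
  | .ctl => b
  | .w i => markSeq c r i
  | .x i => a.1 i
  | .y i => a.2 i
  | .p i => p i
  | .q i => q i
  | .c i => c i
  | .v i => v i
  | .u i j => leadingAnd (r i) j
  | .r i j => r i j

lemma tossed_eq_partialMarked (p q c : Bits n) (r : Fin n → Bits k) :
    tossed p q c r = partialMarked p q c r 0 0 0 := by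
  funext t
  cases t with
  | w i =>
    by_cases hi : (i : ℕ) = 0
    · simp [tossed, partialMarked, hi, markSeq]
    · simp [tossed, partialMarked, hi]
  | _ => simp [tossed, partialMarked]

lemma partialMarked_eq_marked (p q c : Bits n) (r : Fin n → Bits k) :
    partialMarked p q c r n n 0 = marked p q c r 0 (p, q) 0 := by
  funext t
  cases t with
  | w i => simp [marked, partialMarked, Nat.lt_succ_iff.mp i.2]
  | _ => simp [marked, partialMarked]

lemma runGates_markGates (U : UGroup n) (p q c : Bits n) (r : Fin n → Bits k) (i : Fin n) :
    runGates U (markGates i) (wireKet (partialMarked p q c r i i 0)) =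
      wireKet (partialMarked p q c r (i + 1) (i + 1) 0) := by
  have h1 : runGates U [gateCNOT (.p i) (.x i) (by simp), gateCNOT (.q i) (.y i) (by simp),
      gateX (.u i 0)] (wireKet (partialMarked p q c r i i 0)) =
      wireKet (partialMarked p q c r (i + 1) i 1) := by
    simp only [runGates_cons, runGates_nil, gateCNOT_mulVec, gateX_mulVec]
    congr 1
    funext t
    cases t with
    | x l =>
      by_cases h : l = i
      · subst h; simp [partialMarked]
      · have h' : (l : ℕ) ≠ i := fun h' => h (Fin.ext h')
        have : (l : ℕ) < i ↔ (l : ℕ) < i + 1 := by omega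
        simp [partialMarked, h, this]
    | y l =>
      by_cases h : l = i
      · subst h; simp [partialMarked]
      · have h' : (l : ℕ) ≠ i := fun h' => h (Fin.ext h')
        have : (l : ℕ) < i ↔ (l : ℕ) < i + 1 := by omega
        simp [partialMarked, h, this]
    | u l j =>
      by_cases h : l = i
      · subst h
        by_cases hj : j = 0
        · subst hj; simp [partialMarked, leadingAnd_zero]
        · have : ¬ (j : ℕ) = 0 := fun h' => hj (Fin.ext h')
          simp [partialMarked, hj]
      · have h' : (l : ℕ) ≠ i := fun h' => h (Fin.ext h')
        simp [partialMarked, h, h']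
    | _ => simp [partialMarked]
  have h2 : runGates U ((List.finRange k).flatMap fun j => [andGate i j])
      (wireKet (partialMarked p q c r (i + 1) i (0 + 1))) =
      wireKet (partialMarked p q c r (i + 1) i (k + 1)) := by
    refine runGates_flatMap_finRange U _
      (fun j => wireKet (partialMarked p q c r (i + 1) i (j + 1))) fun j => ?_
    simp only [runGates_cons, runGates_nil, andGate, gateToffoli_mulVec]
    congr 1
    funext t
    cases t with
    | u l j' =>
      by_cases h : l = i
      · subst h
        by_cases hj : j' = j.succ
        · subst hj; simp [partialMarked, leadingAnd_succ]
        · have : ¬ (j' : ℕ) = j + 1 := fun h' => hj (Fin.ext h')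
          have h2 : (j' : ℕ) < j + 1 ↔ (j' : ℕ) < j + 1 + 1 := by omega
          simp only [partialMarked, Function.update_apply, Wire.u.injEq, hj, and_false, if_false,
            h2]
      · have h' : (l : ℕ) ≠ i := fun h' => h (Fin.ext h')
        simp [partialMarked, h, h']
    | _ => simp [partialMarked]
  have h3 : runGates U [gateCNOT (.u i (Fin.last k)) (.w i.succ) (by simp),
      gateToffoli (.c i) (.w i.castSucc) (.w i.succ)
        ⟨by simp, by simp, by simpa using i.castSucc_lt_succ.ne⟩]
      (wireKet (partialMarked p q c r (i + 1) i (k + 1))) =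
      wireKet (partialMarked p q c r (i + 1) (i + 1) 0) := by
    simp only [runGates_cons, runGates_nil, gateCNOT_mulVec, gateToffoli_mulVec]
    congr 1
    funext t
    cases t with
    | w l =>
      by_cases h : l = i.succ
      · subst h
        simp [partialMarked, i.castSucc_lt_succ.ne, markSeq_succ,
          leadingAnd_self]
      · have h' : (l : ℕ) ≠ i + 1 := fun h' => h (Fin.ext h')
        have : (l : ℕ) ≤ i ↔ (l : ℕ) ≤ i + 1 := by omega
        simp [partialMarked, h, this]
    | u l j =>
      have : ((l : ℕ) < i ∨ (l : ℕ) = i ∧ (j : ℕ) < k + 1) ↔ (l : ℕ) < i + 1 := by omega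
      simp only [partialMarked, Function.update_apply, reduceCtorEq, if_false, this,
        Nat.not_lt_zero, and_false, or_false]
    | _ => simp [partialMarked, Function.update_apply]
  have h4 : (List.finRange k).map (andGate i) = (List.finRange k).flatMap fun j => [andGate i j] :=
    List.map_eq_flatMap
  rw [markGates, runGates_append, runGates_append, h1, h4]
  rw [zero_add] at h2
  rw [h2, h3]

end NoGoPRU

namespace NoGoPRU

variable {n k : ℕ}

/-! ### The controlled swaps and the queries -/

lemma runGates_swapGates (U : UGroup n) (i : Fin n) (z : Wire n k → Fin 2) :
    runGates U (swapGates i) (wireKet z) = wireKet (Function.update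
      (Function.update z (.x i) (if z (.v i) = 1 then z (.y i) else z (.x i)))
      (.y i) (if z (.v i) = 1 then z (.x i) else z (.y i))) := by
  simp only [swapGates, runGates_cons, runGates_nil, gateCNOT_mulVec, gateToffoli_mulVec]
  congr 1
  have key : ∀ a b d : Fin 2, a + b + (b + d * (a + b)) = (if d = 1 then b else a) ∧
      b + d * (a + b) = if d = 1 then a else b := by decide
  funext t
  by_cases hx : t = .x i
  · subst hx
    simpa [Function.update_apply] using (key (z (.x i)) (z (.y i)) (z (.v i))).1
  · by_cases hy : t = .y i
    · subst hy
      simpa [Function.update_apply] using (key (z (.x i)) (z (.y i)) (z (.v i))).2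
    · simp [hx, hy]

/-- The first `i` bits of one string followed by the remaining bits of another one. -/
def mix (i : ℕ) (f g : Bits n) : Bits n := fun l => if (l : ℕ) < i then f l else g l

lemma mix_zero (f g : Bits n) : mix 0 f g = g := by funext l; simp [mix]

lemma mix_self (f g : Bits n) : mix n f g = f := by funext l; simp [mix]

lemma mix_apply (f g : Bits n) (i : Fin n) : mix i f g i = g i := by simp [mix]

lemma mix_succ_apply (f g : Bits n) (i : Fin n) : mix (i + 1) f g i = f i := by simp [mix]

lemma mix_succ_of_ne (f g : Bits n) {i l : Fin n} (h : l ≠ i) :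
    mix (i + 1) f g l = mix i f g l := by
  have h' : (l : ℕ) ≠ i := fun h' => h (Fin.ext h')
  have : (l : ℕ) < i + 1 ↔ (l : ℕ) < i := by omega
  simp only [mix, this]

lemma runGates_preSwap (U : UGroup n) (p q c : Bits n) (r : Fin n → Bits k) (b : Fin 2)
    (a : Bits n × Bits n) :
    runGates U ((List.finRange n).flatMap preSwapGates) (wireKet (marked p q c r b a 0)) =
      wireKet (marked p q c r b (partialSwap (fun l => b * marks c r l) a)
        fun l => b * marks c r l + marks c r l) := by
  set S := partialSwap (fun l => b * marks c r l) a with hS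
  have h := runGates_flatMap_finRange U (preSwapGates (k := k)) (fun i => wireKet
    (marked p q c r b (mix i S.1 a.1, mix i S.2 a.2)
      (mix i (fun l => b * marks c r l + marks c r l) 0))) fun i => by
    simp only [preSwapGates, runGates_cons, runGates_append, runGates_nil, gateToffoli_mulVec,
      runGates_swapGates, gateCNOT_mulVec]
    congr 1
    funext t
    have hw : markSeq c r (i + 1) = marks c r i := rfl
    cases t with
    | x l =>
      by_cases h : l = i
      · subst h
        simp [marked, mix_apply, mix_succ_apply, hS, partialSwap, hw]
      · simp [marked, h, mix_succ_of_ne]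
    | y l =>
      by_cases h : l = i
      · subst h
        simp [marked, mix_apply, mix_succ_apply, hS, partialSwap, hw]
      · simp [marked, h, mix_succ_of_ne]
    | v l =>
      by_cases h : l = i
      · subst h
        simp [marked, mix_apply, mix_succ_apply, hw]
      · simp [marked, h, mix_succ_of_ne]
    | _ => simp [marked]
  simpa only [mix_zero, mix_self, Prod.mk.eta] using h

lemma runGates_postSwap (U : UGroup n) (p q c : Bits n) (r : Fin n → Bits k) (b : Fin 2)
    (a : Bits n × Bits n) (v : Bits n) :
    runGates U ((List.finRange n).flatMap postSwapGates) (wireKet (marked p q c r b a v)) =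
      wireKet (marked p q c r b (partialSwap v a) fun l => v l + b * marks c r l) := by
  set S := partialSwap v a with hS
  have h := runGates_flatMap_finRange U (postSwapGates (k := k)) (fun i => wireKet
    (marked p q c r b (mix i S.1 a.1, mix i S.2 a.2)
      (mix i (fun l => v l + b * marks c r l) v))) fun i => by
    simp only [postSwapGates, runGates_cons, runGates_append, runGates_nil, gateToffoli_mulVec,
      runGates_swapGates]
    congr 1
    funext t
    have hw : markSeq c r (i + 1) = marks c r i := rfl
    cases t with
    | x l =>
      by_cases h : l = i
      · subst h
        simp [marked, mix_apply, mix_succ_apply, hS, partialSwap]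
      · simp [marked, h, mix_succ_of_ne]
    | y l =>
      by_cases h : l = i
      · subst h
        simp [marked, mix_apply, mix_succ_apply, hS, partialSwap]
      · simp [marked, h, mix_succ_of_ne]
    | v l =>
      by_cases h : l = i
      · subst h
        simp [marked, mix_apply, mix_succ_apply, hw]
      · simp [marked, h, mix_succ_of_ne]
    | _ => simp [marked]
  simpa only [mix_zero, mix_self, Prod.mk.eta] using h

lemma gateH_mulVec_marked (U : UGroup n) (p q c : Bits n) (r : Fin n → Bits k) (b : Fin 2)
    (a : Bits n × Bits n) (v : Bits n) :
    ((gateH .ctl).op U).mulVec (wireKet (marked p q c r b a v)) =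
      invSqrtTwo • (wireKet (marked p q c r 0 a v) +
        (if b = 0 then (1 : ℂ) else -1) • wireKet (marked p q c r 1 a v)) := by
  have h : ∀ b', Function.update (marked p q c r b a v) .ctl b' = marked p q c r b' a v := by
    intro b'
    funext t
    cases t <;> simp [marked]
  rw [gateH_mulVec, h, h]
  rfl

lemma runGates_queryGates (U : UGroup n) (p q c : Bits n) (r : Fin n → Bits k) (b : Fin 2)
    (a : Bits n × Bits n) (v : Bits n) :
    runGates U (queryGates n k) (wireKet (marked p q c r b a v)) =
      ∑ s : Bits n × Bits n, ((U : Op n) s.1 a.1 * (U : Op n) s.2 a.2) •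
        wireKet (marked p q c r b s v) := by
  have hx : ∀ (a : Bits n × Bits n) (s : Bits n), Function.extend
      (xWires n k) s (marked p q c r b a v) =
      marked p q c r b (s, a.2) v := by
    intro a s
    funext t
    by_cases ht : ∃ i, t = .x i
    · obtain ⟨i, rfl⟩ := ht
      exact (xWires n k).injective.extend_apply _ _ i
    · refine (Function.extend_apply' _ _ _ fun ⟨i, hi⟩ => ht ⟨i, hi.symm⟩).trans ?_
      cases t with
      | x i => exact absurd ⟨i, rfl⟩ ht
      | _ => rfl
  have hy : ∀ (a : Bits n × Bits n) (s : Bits n), Function.extend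
      (yWires n k) s (marked p q c r b a v) =
      marked p q c r b (a.1, s) v := by
    intro a s
    funext t
    by_cases ht : ∃ i, t = .y i
    · obtain ⟨i, rfl⟩ := ht
      exact (yWires n k).injective.extend_apply _ _ i
    · refine (Function.extend_apply' _ _ _ fun ⟨i, hi⟩ => ht ⟨i, hi.symm⟩).trans ?_
      cases t with
      | y i => exact absurd ⟨i, rfl⟩ ht
      | _ => rfl
  rw [queryGates, runGates_cons, runGates_cons, runGates_nil, gateQuery_mulVec, Matrix.mulVec_sum,
    Fintype.sum_prod_type]
  refine Finset.sum_congr rfl fun s _ => ?_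
  rw [Matrix.mulVec_smul, hx, gateQuery_mulVec, Finset.smul_sum]
  refine Finset.sum_congr rfl fun s' _ => ?_
  rw [hy, smul_smul]
  rfl

lemma partialSwap_zero (a : Bits n × Bits n) : partialSwap (fun _ => 0) a = a := by
  simp [partialSwap]

/-- The action of the circuit between the two Hadamard gates on the control qubit. -/
lemma runGates_branch (U : UGroup n) (p q c : Bits n) (r : Fin n → Bits k) (b : Fin 2)
    (a : Bits n × Bits n) :
    runGates U ((List.finRange n).flatMap preSwapGates ++ queryGates n k ++
        (List.finRange n).flatMap postSwapGates) (wireKet (marked p q c r b a 0)) =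
      ∑ s : Bits n × Bits n,
        ((U : Op n) (partialSwap (fun l => b * marks c r l + marks c r l) s).1
            (partialSwap (fun l => b * marks c r l) a).1 *
          (U : Op n) (partialSwap (fun l => b * marks c r l + marks c r l) s).2
            (partialSwap (fun l => b * marks c r l) a).2) •
        wireKet (marked p q c r b s (marks c r)) := by
  have hv : (fun l => b * marks c r l + marks c r l + b * marks c r l) = marks c r := by
    have : ∀ x y : Fin 2, x * y + y + x * y = y := by decide
    funext l
    exact this _ _
  rw [runGates_append, runGates_append, runGates_preSwap, runGates_queryGates, runGates_sum]
  simp only [runGates_smul, runGates_postSwap, hv]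
  rw [← (partialSwap_bijective fun l => b * marks c r l + marks c r l).sum_comp]
  simp only [partialSwap_partialSwap]

/-- The amplitude of a branch: swap after the queries for `b = 0`, and before them for `b = 1`. -/
def branchAmp (U : UGroup n) (w : Bits n) (a s : Bits n × Bits n) (b : Fin 2) : ℂ :=
  if b = 0 then (U : Op n) (partialSwap w s).1 a.1 * (U : Op n) (partialSwap w s).2 a.2
  else (U : Op n) s.1 (partialSwap w a).1 * (U : Op n) s.2 (partialSwap w a).2

lemma runGates_branch' (U : UGroup n) (p q c : Bits n) (r : Fin n → Bits k) (b : Fin 2)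
    (a : Bits n × Bits n) :
    runGates U ((List.finRange n).flatMap preSwapGates ++ queryGates n k ++
        (List.finRange n).flatMap postSwapGates) (wireKet (marked p q c r b a 0)) =
      ∑ s : Bits n × Bits n, branchAmp U (marks c r) a s b •
        wireKet (marked p q c r b s (marks c r)) := by
  rw [runGates_branch]
  refine Finset.sum_congr rfl fun s _ => ?_
  have h2 : ∀ x : Fin 2, x + x = 0 := by decide
  rcases fin_two_eq_zero_or_one b with rfl | rfl
  · simp [branchAmp, partialSwap_zero]
  · simp [branchAmp, partialSwap_zero, h2]

lemma runGates_swapCircuit (U : UGroup n) :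
    runGates U (preGates n k ++ queryGates n k ++ postGates n k) (Pi.single 0 1) =
      ∑ j : (Bits n × Bits n × Bits n × (Fin n → Bits k)) × (Bits n × Bits n) × Fin 2,
        (invSqrtTwo ^ (n * (k + 3) + 2) *
          (branchAmp U (marks j.1.2.2.1 j.1.2.2.2) (j.1.1, j.1.2.1) j.2.1 0 +
            (if j.2.2 = 0 then (1 : ℂ) else -1) *
              branchAmp U (marks j.1.2.2.1 j.1.2.2.2) (j.1.1, j.1.2.1) j.2.1 1)) •
        wireKet (marked j.1.1 j.1.2.1 j.1.2.2.1 j.1.2.2.2 j.2.2 j.2.1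
          (marks j.1.2.2.1 j.1.2.2.2)) := by
  have h0 : preGates n k ++ queryGates n k ++ postGates n k =
      (List.finRange n).flatMap tossGates ++
      ((List.finRange n).flatMap markGates ++ ([gateH .ctl] ++
      (((List.finRange n).flatMap preSwapGates ++ queryGates n k ++
        (List.finRange n).flatMap postSwapGates) ++ [gateH .ctl]))) := by
    rw [preGates, postGates]
    simp only [List.append_assoc]
  rw [h0, runGates_append, runGates_toss, runGates_smul, runGates_sum,
    Fintype.sum_prod_type (α₁ := Bits n × Bits n × Bits n × (Fin n → Bits k)), Finset.smul_sum]
  refine Finset.sum_congr rfl ?_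
  rintro ⟨p, q, c, r⟩ -
  have hmark : runGates U ((List.finRange n).flatMap markGates) (wireKet (tossed p q c r)) =
      wireKet (marked p q c r 0 (p, q) 0) := by
    rw [tossed_eq_partialMarked, ← partialMarked_eq_marked]
    exact runGates_flatMap_finRange U _ (fun i => wireKet (partialMarked p q c r i i 0))
      (runGates_markGates U p q c r)
  rw [runGates_append, hmark, runGates_append, runGates_cons, runGates_nil, gateH_mulVec_marked,
    runGates_append, runGates_smul, runGates_add, if_pos rfl, one_smul, runGates_branch',
    runGates_branch', runGates_smul, runGates_add, runGates_sum, runGates_sum,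
    ← Finset.sum_add_distrib, Fintype.sum_prod_type (α₁ := Bits n × Bits n) (α₂ := Fin 2),
    smul_smul, Finset.smul_sum]
  refine Finset.sum_congr rfl fun s _ => ?_
  rw [Fin.sum_univ_two]
  simp only [runGates_smul, runGates_cons, runGates_nil, gateH_mulVec_marked]
  simp only [if_pos, Fin.isValue, one_ne_zero, if_false]
  module

lemma marked_injective (n k : ℕ) : Function.Injective
    fun j : (Bits n × Bits n × Bits n × (Fin n → Bits k)) × (Bits n × Bits n) × Fin 2 =>
      marked j.1.1 j.1.2.1 j.1.2.2.1 j.1.2.2.2 j.2.2 j.2.1 (marks j.1.2.2.1 j.1.2.2.2) := by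
  rintro ⟨⟨p, q, c, r⟩, ⟨a, a'⟩, b⟩ ⟨⟨p', q', c', r'⟩, ⟨d, d'⟩, b'⟩ h
  have hp : p = p' := funext fun i => congrFun h (.p i)
  have hq : q = q' := funext fun i => congrFun h (.q i)
  have hc : c = c' := funext fun i => congrFun h (.c i)
  have hr : r = r' := funext fun i => funext fun j => congrFun h (.r i j)
  have ha : a = d := funext fun i => congrFun h (.x i)
  have ha' : a' = d' := funext fun i => congrFun h (.y i)
  have hb : b = b' := congrFun h .ctl
  subst hp hq hc hr ha ha' hb
  rfl

lemma norm_branchAmp_sum (U : UGroup n) (w : Bits n) (b : Fin 2) :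
    ∑ a : Bits n × Bits n, ∑ s : Bits n × Bits n, ‖branchAmp U w a s b‖ ^ 2 = 4 ^ n := by
  have hrow : ∀ i : Bits n, ∑ j : Bits n, ‖(U : Op n) i j‖ ^ 2 = 1 := by
    intro i
    have h := congrFun (congrFun (coe_unitary_mul_star U) i) i
    rw [Matrix.mul_apply, Matrix.one_apply_eq] at h
    have h' : ((∑ j : Bits n, ‖(U : Op n) i j‖ ^ 2 : ℝ) : ℂ) = 1 := by
      rw [← h]
      push_cast
      refine Finset.sum_congr rfl fun j _ => ?_
      rw [Matrix.star_apply]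
      exact (Complex.mul_conj' _).symm
    exact_mod_cast h'
  have htot : ∑ s : Bits n × Bits n, ∑ a : Bits n × Bits n,
      ‖(U : Op n) s.1 a.1 * (U : Op n) s.2 a.2‖ ^ 2 = 4 ^ n := by
    have h1 : ∀ s : Bits n × Bits n, ∑ a : Bits n × Bits n,
        ‖(U : Op n) s.1 a.1 * (U : Op n) s.2 a.2‖ ^ 2 = 1 := by
      intro s
      simp only [norm_mul, mul_pow]
      rw [Fintype.sum_prod_type]
      simp only [← Finset.mul_sum, hrow, mul_one]
    simp only [h1, Finset.sum_const, Finset.card_univ, Fintype.card_prod, Fintype.card_fun,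
      Fintype.card_fin, nsmul_eq_mul, mul_one]
    push_cast
    rw [← mul_pow]
    norm_num
  rw [Finset.sum_comm]
  unfold branchAmp
  split_ifs with hb
  · rw [(partialSwap_bijective w).sum_comp fun s => ∑ a : Bits n × Bits n,
      ‖(U : Op n) s.1 a.1 * (U : Op n) s.2 a.2‖ ^ 2, htot]
  · have h2 : ∀ s : Bits n × Bits n, ∑ a : Bits n × Bits n,
        ‖(U : Op n) s.1 (partialSwap w a).1 * (U : Op n) s.2 (partialSwap w a).2‖ ^ 2 =
        ∑ a : Bits n × Bits n, ‖(U : Op n) s.1 a.1 * (U : Op n) s.2 a.2‖ ^ 2 :=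
      fun s => (partialSwap_bijective w).sum_comp
        fun a => ‖(U : Op n) s.1 a.1 * (U : Op n) s.2 a.2‖ ^ 2
    simp only [h2, htot]

/-- The sum of squared entries of the Pauli transfer matrix over the strings within `w`. -/
def transferSum (w : Bits n) (U : UGroup n) : ℝ :=
  ∑ P with PauliString.Within w P, ∑ Q with PauliString.Within w Q, transfer P Q U ^ 2

lemma norm_sq_branch_diff_sum (U : UGroup n) (w : Bits n) :
    ∑ a : Bits n × Bits n, ∑ s : Bits n × Bits n,
      ‖branchAmp U w a s 0 + -1 * branchAmp U w a s 1‖ ^ 2 =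
      2 * 4 ^ n * (1 - (1 / 4) ^ weight w * transferSum w U) := by
  have h1 : ∀ x y : ℂ, ‖x + -1 * y‖ ^ 2 = ‖x‖ ^ 2 + ‖y‖ ^ 2 - 2 * (x * star y).re := by
    intro x y
    rw [neg_one_mul, ← sub_eq_add_neg, ← Complex.normSq_eq_norm_sq, ← Complex.normSq_eq_norm_sq,
      ← Complex.normSq_eq_norm_sq, Complex.normSq_sub]
    rfl
  have h2 : ∑ a : Bits n × Bits n, ∑ s : Bits n × Bits n,
      (branchAmp U w a s 0 * star (branchAmp U w a s 1)).re = (swapCorrelator w U).re := by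
    rw [swapCorrelator, Finset.sum_comm]
    simp only [Complex.re_sum]
    rfl
  simp only [h1, Finset.sum_add_distrib, Finset.sum_sub_distrib, norm_branchAmp_sum,
    ← Finset.mul_sum, h2, swapCorrelator_eq, Complex.ofReal_re]
  change _ + _ - 2 * (_ * transferSum w U) = _
  rw [div_pow, one_pow]
  ring

/-- The acceptance probability of the distinguishing circuit. -/
lemma acceptProb_swapCircuit (U : UGroup n) :
    (swapCircuit n k).acceptProb U =
      1 / 2 * ∑ w : Bits n, markProb k w * (1 - (1 / 4) ^ weight w * transferSum w U) := by
  have h1 : (swapCircuit n k).acceptProb U = ∑ x : Bits (regWidth n k),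
      if x (Wire.equiv n k .ctl) = 1 then ‖runGates U (preGates n k ++ queryGates n k ++
        postGates n k) (Pi.single 0 1) x‖ ^ 2 else 0 := rfl
  have hinj : Function.Injective
      fun j : (Bits n × Bits n × Bits n × (Fin n → Bits k)) × (Bits n × Bits n) × Fin 2 =>
      marked j.1.1 j.1.2.1 j.1.2.2.1 j.1.2.2.2 j.2.2 j.2.1 (marks j.1.2.2.1 j.1.2.2.2) ∘
        (Wire.equiv n k).symm := by
    intro j j' h
    refine marked_injective n k ?_
    funext t
    simpa using congrFun h (Wire.equiv n k t)
  have hN : ‖invSqrtTwo ^ (n * (k + 3) + 2)‖ ^ 2 = (1 / 2) ^ (n * (k + 3) + 2) := by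
    rw [norm_pow, ← pow_mul, mul_comm, pow_mul, norm_invSqrtTwo_sq]
  rw [h1, runGates_swapCircuit]
  simp only [wireKet]
  rw [sum_accept _ hinj, Fintype.sum_prod_type]
  simp only [Fintype.sum_prod_type (α₁ := Bits n × Bits n) (α₂ := Fin 2), Fin.sum_univ_two,
    Function.comp_apply, Equiv.symm_apply_apply, marked, Fin.isValue, zero_ne_one, if_false,
    zero_add, if_true, one_ne_zero, norm_mul, mul_pow, hN, ← Finset.mul_sum]
  have h3 : ∑ ρ : Bits n × Bits n × Bits n × (Fin n → Bits k), ∑ s : Bits n × Bits n,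
      ‖branchAmp U (marks ρ.2.2.1 ρ.2.2.2) (ρ.1, ρ.2.1) s 0 +
        -1 * branchAmp U (marks ρ.2.2.1 ρ.2.2.2) (ρ.1, ρ.2.1) s 1‖ ^ 2 =
      ∑ c : Bits n, ∑ r : Fin n → Bits k, 2 * 4 ^ n *
        (1 - (1 / 4) ^ weight (marks c r) * transferSum (marks c r) U) := by
    simp only [← norm_sq_branch_diff_sum]
    rw [← (Equiv.prodAssoc (Bits n) (Bits n) (Bits n × (Fin n → Bits k))).sum_comp,
      Fintype.sum_prod_type, Finset.sum_comm, Fintype.sum_prod_type]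
    rfl
  rw [h3, sum_marks k fun w => 2 * 4 ^ n * (1 - (1 / 4) ^ weight w * transferSum w U)]
  have h4 : ((1 : ℝ) / 2) ^ (n * (k + 3) + 2) * ((2 ^ (k + 1)) ^ n * (2 * 4 ^ n)) = 1 / 2 := by
    have e : (4 : ℝ) ^ n = 2 ^ (2 * n) := by rw [pow_mul]; norm_num
    rw [e, ← pow_mul, div_pow, one_pow, ← pow_succ', ← pow_add]
    rw [show n * (k + 3) + 2 = ((k + 1) * n + (2 * n + 1)) + 1 by ring, pow_succ]
    field_simp
  have h5 : ∑ w : Bits n, markProb k w * (2 * 4 ^ n * (1 - (1 / 4) ^ weight w * transferSum w U)) =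
      2 * 4 ^ n * ∑ w : Bits n, markProb k w * (1 - (1 / 4) ^ weight w * transferSum w U) := by
    rw [Finset.mul_sum]
    exact Finset.sum_congr rfl fun w _ => by ring
  rw [h5]
  calc _ = ((1 / 2) ^ (n * (k + 3) + 2) * ((2 ^ (k + 1)) ^ n * (2 * 4 ^ n))) *
        ∑ w : Bits n, markProb k w * (1 - (1 / 4) ^ weight w * transferSum w U) := by
        simp only [mul_assoc]
    _ = _ := by rw [h4]

lemma kind_ne_query_of_mem_preGates {g : Gate n (regWidth n k)} (hg : g ∈ preGates n k) :
    g.kind ≠ .query := by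
  simp only [preGates, List.mem_append, List.mem_flatMap, List.mem_finRange, true_and,
    tossGates, markGates, preSwapGates, swapGates, List.mem_cons, List.mem_map,
    List.not_mem_nil, or_false] at hg
  rcases hg with ((⟨i, (rfl | rfl | rfl) | ⟨j, rfl⟩⟩ |
    ⟨i, ((rfl | rfl | rfl) | ⟨j, rfl⟩) | (rfl | rfl)⟩) | rfl) |
    ⟨i, rfl | (rfl | rfl | rfl) | rfl⟩ <;> exact fun h => GateKind.noConfusion h

lemma kind_ne_query_of_mem_postGates {g : Gate n (regWidth n k)} (hg : g ∈ postGates n k) :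
    g.kind ≠ .query := by
  simp only [postGates, List.mem_append, List.mem_flatMap, List.mem_finRange, true_and,
    postSwapGates, swapGates, List.mem_cons, List.not_mem_nil, or_false] at hg
  rcases hg with ⟨i, (rfl | rfl | rfl) | rfl⟩ | rfl <;> exact fun h => GateKind.noConfusion h

lemma kind_eq_query_of_mem_queryGates {g : Gate n (regWidth n k)} (hg : g ∈ queryGates n k) :
    g.kind = .query := by
  simp only [queryGates, List.mem_cons, List.not_mem_nil, or_false] at hg
  rcases hg with rfl | rfl <;> rfl

lemma pairwise_queryGates (n k : ℕ) :
    (queryGates n k).Pairwise fun g h => ∀ i j, g.wires i ≠ h.wires j := by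
  rw [queryGates, List.pairwise_pair]
  intro i j h
  have h' : (Wire.x i : Wire n k) = Wire.y j := (Wire.equiv n k).injective h
  cases h'

lemma swapCircuit_parallelQueries (n k : ℕ) : (swapCircuit n k).ParallelQueries 2 :=
  ⟨preGates n k, queryGates n k, postGates n k, rfl, fun _ => kind_ne_query_of_mem_preGates,
    fun _ => kind_ne_query_of_mem_postGates, fun _ => kind_eq_query_of_mem_queryGates, rfl,
    pairwise_queryGates n k⟩

end NoGoPRU

namespace NoGoPRU

variable {n k : ℕ}

/-! ### Running programs -/

/-- The program halts within `T` steps in a state that satisfies `Q`. -/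
def Runs (p : Prog) (s : MState) (T : ℕ) (Q : MState → Prop) : Prop :=
  ∃ s' t, Exec p s s' t ∧ t ≤ T ∧ Q s'

lemma Runs.seq {p p' : Prog} {s : MState} {T T' : ℕ} {Q Q' : MState → Prop}
    (h : Runs p s T Q) (h' : ∀ s', Q s' → Runs p' s' T' Q') : Runs (.seq p p') s (T + T') Q' := by
  obtain ⟨s₁, t, he, ht, hQ⟩ := h
  obtain ⟨s₂, t', he', ht', hQ'⟩ := h' s₁ hQ
  exact ⟨s₂, t + t', .seq he he', by omega, hQ'⟩

lemma Runs.mono {p : Prog} {s : MState} {T T' : ℕ} {Q Q' : MState → Prop}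
    (h : Runs p s T Q) (hT : T ≤ T') (hQ : ∀ s', Q s' → Q' s') : Runs p s T' Q' := by
  obtain ⟨s₁, t, he, ht, hq⟩ := h
  exact ⟨s₁, t, he, ht.trans hT, hQ _ hq⟩

lemma Runs.loop {r : ℕ} {p : Prog} {N B : ℕ} {I : ℕ → MState → Prop}
    (hbody : ∀ j s, j < N → I j s → s.mem r ≠ 0 ∧ Runs p s B (I (j + 1)))
    (hend : ∀ s, I N s → s.mem r = 0) {s : MState} (hs : I 0 s) :
    Runs (.loop r p) s (N * (B + 1) + 1) (I N) := by
  have key : ∀ d j s, j + d = N → I j s → Runs (.loop r p) s (d * (B + 1) + 1) (I N) := by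
    intro d
    induction d with
    | zero =>
      intro j s hj hI
      obtain rfl : j = N := by omega
      exact ⟨s, 1, .loopStop (hend s hI), by omega, hI⟩
    | succ d ih =>
      intro j s hj hI
      obtain ⟨hr, s₁, t, he, ht, hI₁⟩ := hbody j s (by omega) hI
      obtain ⟨s₂, t', he', ht', hI₂⟩ := ih (j + 1) s₁ (by omega) hI₁
      refine ⟨s₂, t + t' + 1, .loopStep hr he he', ?_, hI₂⟩
      rw [Nat.succ_mul]
      omega
  exact key N 0 s (by omega) hs

/-- Write the numbers `c + M[r]` on the output tape, for the pairs `(r, c)` of a list. Cell `7` is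
used for the computation. -/
def emitList : List (ℕ × ℕ) → Prog
  | [] => .const 7 0
  | e :: l => .seq (.const 7 e.2) (.seq (.plus 7 e.1) (.seq (.emit 7) (emitList l)))

lemma runs_emitList (l : List (ℕ × ℕ)) (hl : ∀ e ∈ l, e.1 ≠ 7) (s : MState) :
    Runs (emitList l) s (3 * l.length + 1) fun s' =>
      s'.out = s.out ++ l.map (fun e => e.2 + s.mem e.1) ∧ ∀ r, r ≠ 7 → s'.mem r = s.mem r := by
  induction l generalizing s with
  | nil =>
    refine ⟨_, _, .const 7 0 s, by simp, by simp [MState.write], fun r hr => ?_⟩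
    simp [MState.write, hr]
  | cons e l ih =>
    set s₁ : MState := s.write 7 e.2 with hs₁
    set s₂ : MState := s₁.write 7 (s₁.mem 7 + s₁.mem e.1) with hs₂
    set s₃ : MState := ⟨s₂.mem, s₂.out ++ [s₂.mem 7]⟩ with hs₃
    have hmem : ∀ r, r ≠ 7 → s₃.mem r = s.mem r := by
      intro r hr
      simp [hs₃, hs₂, hs₁, MState.write, hr]
    have hout : s₃.out = s.out ++ [e.2 + s.mem e.1] := by
      have := hl e (by simp)
      simp [hs₃, hs₂, hs₁, MState.write, this]
    obtain ⟨s', t, he, ht, ho, hm⟩ := ih (fun e he => hl e (by simp [he])) s₃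
    refine ⟨s', 1 + (1 + (1 + t)), .seq (.const 7 e.2 s) (.seq (.plus 7 e.1 s₁)
      (.seq (.emit 7 s₂) he)), by simp; omega, ?_, fun r hr => (hm r hr).trans (hmem r hr)⟩
    rw [ho, hout, List.map_cons, List.append_assoc, List.singleton_append]
    congr 2
    refine List.map_congr_left fun e' he' => ?_
    rw [hmem _ (hl e' (by simp [he']))]

/-- The cells `0`, `1`, `2`, `8`, `9` hold the constants `n`, `k`, `2 * k + 8`, `0` and `1`. -/
def Ready (n k : ℕ) (s : MState) : Prop :=
  s.mem 0 = n ∧ s.mem 1 = k ∧ s.mem 2 = 2 * k + 8 ∧ s.mem 8 = 0 ∧ s.mem 9 = 1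

/-- The value of a pair `(r, c)` when cells `3` and `6` hold `a` and `b`. -/
def entryVal (a b : ℕ) (e : ℕ × ℕ) : ℕ :=
  e.2 + if e.1 = 3 then a else if e.1 = 6 then b else 0

/-- The pair refers to one of the cells `3`, `6` and `8`. -/
def ValidEntry (e : ℕ × ℕ) : Prop := e.1 = 3 ∨ e.1 = 6 ∨ e.1 = 8

lemma runs_emitList_ready {l : List (ℕ × ℕ)} (hl : ∀ e ∈ l, ValidEntry e) {s : MState}
    (hs : Ready n k s) :
    Runs (emitList l) s (3 * l.length + 1) fun s' => Ready n k s' ∧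
      s'.out = s.out ++ l.map (entryVal (s.mem 3) (s.mem 6)) ∧
      s'.mem 3 = s.mem 3 ∧ s'.mem 4 = s.mem 4 ∧ s'.mem 5 = s.mem 5 ∧ s'.mem 6 = s.mem 6 := by
  refine (runs_emitList l (fun e he => ?_) s).mono le_rfl ?_
  · rcases hl e he with h | h | h <;> rw [h] <;> decide
  · rintro s' ⟨ho, hm⟩
    obtain ⟨h0, h1, h2, h8, h9⟩ := hs
    refine ⟨⟨?_, ?_, ?_, ?_, ?_⟩, ?_, hm _ (by decide), hm _ (by decide), hm _ (by decide),
      hm _ (by decide)⟩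
    · rw [hm _ (by decide), h0]
    · rw [hm _ (by decide), h1]
    · rw [hm _ (by decide), h2]
    · rw [hm _ (by decide), h8]
    · rw [hm _ (by decide), h9]
    · rw [ho]
      congr 1
      refine List.map_congr_left fun e he => ?_
      unfold entryVal
      rcases hl e he with h | h | h <;> simp [h, h8]

/-- Run through the coins of a site and write the entries of `l` for each of them. -/
def coinsProg (l : List (ℕ × ℕ)) : Prog :=
  .seq (.copy 6 3) (.seq (.copy 5 1) (.loop 5 (.seq (emitList l)
    (.seq (.const 7 2) (.seq (.plus 6 7) (.minus 5 9))))))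

lemma runs_coinsProg {l : List (ℕ × ℕ)} (hl : ∀ e ∈ l, ValidEntry e) {s : MState}
    (hs : Ready n k s) :
    Runs (coinsProg l) s (k * (3 * l.length + 5) + 3) fun s' => Ready n k s' ∧
      s'.out = s.out ++ (List.range k).flatMap
        (fun j => l.map (entryVal (s.mem 3) (s.mem 3 + 2 * j))) ∧
      s'.mem 3 = s.mem 3 ∧ s'.mem 4 = s.mem 4 ∧ s'.mem 6 = s.mem 3 + 2 * k := by
  set s₁ : MState := s.write 6 (s.mem 3) with hs₁
  set s₂ : MState := s₁.write 5 (s₁.mem 1) with hs₂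
  have hloop := Runs.loop (r := 5) (p := .seq (emitList l)
    (.seq (.const 7 2) (.seq (.plus 6 7) (.minus 5 9)))) (N := k) (B := 3 * l.length + 1 + 3)
    (I := fun j s' => Ready n k s' ∧
      s'.out = s.out ++ (List.range j).flatMap
        (fun j => l.map (entryVal (s.mem 3) (s.mem 3 + 2 * j))) ∧
      s'.mem 3 = s.mem 3 ∧ s'.mem 4 = s.mem 4 ∧ s'.mem 6 = s.mem 3 + 2 * j ∧ s'.mem 5 = k - j)
    (fun j s' hj ⟨hR, ho, h3, h4, h6, h5⟩ => ⟨by rw [h5]; omega, by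
      refine (runs_emitList_ready hl hR).seq fun s'' ⟨hR', ho', h3', h4', h5', h6'⟩ => ?_
      obtain ⟨g0, g1, g2, g8, g9⟩ := hR'
      refine ⟨_, _, .seq (.const 7 2 _) (.seq (.plus 6 7 _) (.minus 5 9 _)), le_rfl, ?_⟩
      refine ⟨⟨by simpa [MState.write] using g0, by simpa [MState.write] using g1,
        by simpa [MState.write] using g2, by simpa [MState.write] using g8,
        by simpa [MState.write] using g9⟩, ?_, by simp [MState.write, h3', h3],
        by simp [MState.write, h4', h4], by simp [MState.write, h6', h6]; ring,
        by simp [MState.write, h5', h5, g9]; omega⟩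
      simp [MState.write, ho', ho, List.range_succ, h3, h6]⟩)
    (fun s' ⟨_, _, _, _, _, h5⟩ => by rw [h5]; omega) (s := s₂) (by
      obtain ⟨g0, g1, g2, g8, g9⟩ := hs
      refine ⟨⟨?_, ?_, ?_, ?_, ?_⟩, ?_, ?_, ?_, ?_, ?_⟩ <;>
        simp [hs₂, hs₁, MState.write, g0, g1, g2, g8, g9])
  obtain ⟨s', t, he, ht, hR, ho, h3, h4, h6, _⟩ := hloop
  refine ⟨s', 1 + (1 + t), .seq (.copy 6 3 s) (.seq (.copy 5 1 s₁) he), ?_, hR, ho, h3, h4, h6⟩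
  have : k * (3 * l.length + 5) = k * (3 * l.length + 1 + 3 + 1) := by ring
  omega

/-- The output of `sitesProg` for one site. -/
def siteOut (k : ℕ) (l₁ l₂ l₃ : List (ℕ × ℕ)) (a : ℕ) : List ℕ :=
  l₁.map (entryVal a 0) ++ ((List.range k).flatMap (fun j => l₂.map (entryVal a (a + 2 * j))) ++
    l₃.map (entryVal a (a + 2 * k)))

/-- Run through the sites; write the entries of `l₁`, then those of `l₂` for each coin of the site,
then those of `l₃`. -/
def sitesProg (l₁ l₂ l₃ : List (ℕ × ℕ)) : Prog :=
  .seq (.const 3 0) (.seq (.copy 4 0) (.loop 4 (.seq (emitList l₁) (.seq (coinsProg l₂)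
    (.seq (emitList l₃) (.seq (.plus 3 2) (.minus 4 9)))))))

lemma runs_sitesProg {l₁ l₂ l₃ : List (ℕ × ℕ)} (h₁ : ∀ e ∈ l₁, e.1 = 3 ∨ e.1 = 8)
    (h₂ : ∀ e ∈ l₂, ValidEntry e) (h₃ : ∀ e ∈ l₃, ValidEntry e) {s : MState} (hs : Ready n k s) :
    Runs (sitesProg l₁ l₂ l₃) s (n * (3 * l₁.length + (k * (3 * l₂.length + 5) + 3) +
      3 * l₃.length + 5) + 3) fun s' => Ready n k s' ∧
      s'.out = s.out ++ (List.range n).flatMap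
        (fun i => siteOut k l₁ l₂ l₃ (i * (2 * k + 8))) ∧ s'.mem 3 = n * (2 * k + 8) := by
  set s₁ : MState := s.write 3 0 with hs₁
  set s₂ : MState := s₁.write 4 (s₁.mem 0) with hs₂
  have h₁' : ∀ e ∈ l₁, ValidEntry e := fun e he => (h₁ e he).elim Or.inl fun h => Or.inr (Or.inr h)
  have hloop := Runs.loop (r := 4) (p := .seq (emitList l₁) (.seq (coinsProg l₂)
    (.seq (emitList l₃) (.seq (.plus 3 2) (.minus 4 9))))) (N := n)
    (B := (3 * l₁.length + 1) + ((k * (3 * l₂.length + 5) + 3) + ((3 * l₃.length + 1) + 2)))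
    (I := fun i s' => Ready n k s' ∧
      s'.out = s.out ++ (List.range i).flatMap
        (fun i => siteOut k l₁ l₂ l₃ (i * (2 * k + 8))) ∧
      s'.mem 3 = i * (2 * k + 8) ∧ s'.mem 4 = n - i)
    (fun i s' hi ⟨hR, ho, h3, h4⟩ => ⟨by rw [h4]; omega, by
      refine (runs_emitList_ready h₁' hR).seq fun t₁ ⟨hR₁, ho₁, h3₁, h4₁, _, _⟩ => ?_
      refine (runs_coinsProg h₂ hR₁).seq fun t₂ ⟨hR₂, ho₂, h3₂, h4₂, h6₂⟩ => ?_
      refine (runs_emitList_ready h₃ hR₂).seq fun t₃ ⟨hR₃, ho₃, h3₃, h4₃, _, _⟩ => ?_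
      obtain ⟨g0, g1, g2, g8, g9⟩ := hR₃
      refine ⟨_, _, .seq (.plus 3 2 _) (.minus 4 9 _), le_rfl, ?_⟩
      refine ⟨⟨by simpa [MState.write] using g0, by simpa [MState.write] using g1,
        by simpa [MState.write] using g2, by simpa [MState.write] using g8,
        by simpa [MState.write] using g9⟩, ?_, ?_, ?_⟩
      · have hl₁ : l₁.map (entryVal (s'.mem 3) (s'.mem 6)) = l₁.map (entryVal (s'.mem 3) 0) := by
          refine List.map_congr_left fun e he => ?_
          rcases h₁ e he with h | h <;> simp [entryVal, h]
        simp only [MState.write]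
        rw [ho₃, ho₂, ho₁, ho, hl₁, h6₂, h3₂, h3₁, h3, List.range_succ, List.flatMap_append]
        simp [siteOut]
      · simp [MState.write, h3₃, h3₂, h3₁, h3, g2]; ring
      · simp [MState.write, h4₃, h4₂, h4₁, h4, g9]; omega⟩)
    (fun s' ⟨_, _, _, h4⟩ => by rw [h4]; omega) (s := s₂) (by
      obtain ⟨g0, g1, g2, g8, g9⟩ := hs
      refine ⟨⟨?_, ?_, ?_, ?_, ?_⟩, ?_, ?_, ?_⟩ <;>
        simp [hs₂, hs₁, MState.write, g0, g1, g2, g8, g9])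
  obtain ⟨s', t, he, ht, hR, ho, h3, _⟩ := hloop
  refine ⟨s', 1 + (1 + t), .seq (.const 3 0 s) (.seq (.copy 4 0 s₁) he), ?_, hR, ho, h3⟩
  have : n * (3 * l₁.length + (k * (3 * l₂.length + 5) + 3) + 3 * l₃.length + 5) + 3 =
    n * ((3 * l₁.length + 1) + ((k * (3 * l₂.length + 5) + 3) + ((3 * l₃.length + 1) + 2)) + 1)
      + 3 := by ring
  omega

/-- Compute the constants. -/
def setupProg : Prog :=
  .seq (.const 9 1) (.seq (.const 10 1) (.seq (.const 1 1) (.seq (.copy 11 0) (.seq (.minus 11 10)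
    (.seq (.loop 11 (.seq (.plus 10 10) (.seq (.plus 1 9) (.seq (.copy 11 0) (.minus 11 10)))))
      (.seq (.const 2 8) (.seq (.plus 2 1) (.plus 2 1))))))))

lemma runs_setupProg (n : ℕ) :
    Runs setupProg (MState.init n) (Nat.clog 2 n * 5 + 9) fun s =>
      Ready n (coinCount n) s ∧ s.out = [] := by
  set s₁ : MState := (MState.init n).write 9 1 with hs₁
  set s₂ : MState := s₁.write 10 1 with hs₂
  set s₃ : MState := s₂.write 1 1 with hs₃
  set s₄ : MState := s₃.write 11 (s₃.mem 0) with hs₄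
  set s₅ : MState := s₄.write 11 (s₄.mem 11 - s₄.mem 10) with hs₅
  have hloop := Runs.loop (r := 11)
    (p := .seq (.plus 10 10) (.seq (.plus 1 9) (.seq (.copy 11 0) (.minus 11 10))))
    (N := Nat.clog 2 n) (B := 4)
    (I := fun j s => s.mem 0 = n ∧ s.mem 1 = j + 1 ∧ s.mem 8 = 0 ∧ s.mem 9 = 1 ∧
      s.mem 10 = 2 ^ j ∧ s.mem 11 = n - 2 ^ j ∧ s.out = [])
    (fun j s hj ⟨g0, g1, g8, g9, g10, g11, ho⟩ => by
      have : 2 ^ j < n := (Nat.lt_clog_iff_pow_lt (by norm_num)).mp hj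
      refine ⟨by rw [g11]; omega, _, _, .seq (.plus 10 10 _) (.seq (.plus 1 9 _)
        (.seq (.copy 11 0 _) (.minus 11 10 _))), le_rfl, ?_⟩
      refine ⟨?_, ?_, ?_, ?_, ?_, ?_, ?_⟩ <;>
        simp [MState.write, g0, g1, g8, g9, g10, ho, pow_succ, mul_two])
    (fun s ⟨_, _, _, _, _, g11, _⟩ => by
      have : n ≤ 2 ^ Nat.clog 2 n := Nat.le_pow_clog (by norm_num) n
      rw [g11]; omega) (s := s₅) (by
      refine ⟨?_, ?_, ?_, ?_, ?_, ?_, ?_⟩ <;>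
        simp [hs₅, hs₄, hs₃, hs₂, hs₁, MState.write, MState.init])
  obtain ⟨s', t, he, ht, g0, g1, g8, g9, -, -, ho⟩ := hloop
  refine ⟨_, _, .seq (.const 9 1 _) (.seq (.const 10 1 _) (.seq (.const 1 1 _)
    (.seq (.copy 11 0 _) (.seq (.minus 11 10 _) (.seq he (.seq (.const 2 8 _)
      (.seq (.plus 2 1 _) (.plus 2 1 _)))))))), by omega, ⟨?_, ?_, ?_, ?_, ?_⟩, ?_⟩ <;>
    simp [MState.write, g0, g1, g8, g9, ho, coinCount]
  ring

end NoGoPRU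

namespace NoGoPRU

variable {n k : ℕ}

/-! ### The description of the circuit -/

/-- The description of an operation. -/
def encodeGate {m : ℕ} (g : Gate n m) : List ℕ :=
  g.kind.code :: List.ofFn fun i => (g.wires i : ℕ)

lemma encodeGate_gateX (a : Wire n k) : encodeGate (gateX a) = [0, a.index] := rfl

lemma encodeGate_gateH (a : Wire n k) : encodeGate (gateH a) = [1, a.index] := rfl

lemma encodeGate_gateCNOT (a b : Wire n k) (h : a ≠ b) :
    encodeGate (gateCNOT a b h) = [3, a.index, b.index] := rfl

lemma encodeGate_gateToffoli (a b c : Wire n k) (h : a ≠ b ∧ a ≠ c ∧ b ≠ c) :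
    encodeGate (gateToffoli a b c h) = [4, a.index, b.index, c.index] := rfl

lemma encodeGate_gateQuery (f : Fin n ↪ Wire n k) :
    encodeGate (gateQuery f) = 5 :: List.ofFn fun i => (f i).index := rfl

lemma flatMap_finRange {α : Type*} (l : ℕ) (f : ℕ → List α) :
    ((List.finRange l).flatMap fun i : Fin l => f i) = (List.range l).flatMap f := by
  rw [← List.map_coe_finRange_eq_range, List.flatMap_map]

/-- The entries for the coin tosses of a site. -/
def tossEntries : List (ℕ × ℕ) × List (ℕ × ℕ) × List (ℕ × ℕ) :=
  ([(8, 1), (3, 4), (8, 1), (3, 5), (8, 1), (3, 6)], [(8, 1), (6, 9)], [])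

/-- The entries for the marks. -/
def markEntries : List (ℕ × ℕ) × List (ℕ × ℕ) × List (ℕ × ℕ) :=
  ([(8, 3), (3, 4), (3, 2), (8, 3), (3, 5), (3, 3), (8, 0), (3, 8)],
    [(8, 4), (6, 8), (6, 9), (6, 10)],
    [(8, 3), (6, 8), (6, 9), (8, 4), (3, 6), (3, 1), (6, 9)])

/-- The entries for a controlled swap. -/
def swapEntries : List (ℕ × ℕ) :=
  [(8, 3), (3, 3), (3, 2), (8, 4), (3, 7), (3, 2), (3, 3), (8, 3), (3, 3), (3, 2)]

/-- The entries for the swaps before the queries. -/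
def preSwapEntries : List (ℕ × ℕ) :=
  [(8, 4), (8, 0), (6, 9), (3, 7)] ++ swapEntries ++ [(8, 3), (6, 9), (3, 7)]

/-- The entries for the swaps after the queries. -/
def postSwapEntries : List (ℕ × ℕ) := swapEntries ++ [(8, 4), (8, 0), (6, 9), (3, 7)]

lemma encode_tossGates (i : Fin n) :
    (tossGates (k := k) i).flatMap encodeGate =
      siteOut k tossEntries.1 tossEntries.2.1 tossEntries.2.2 (i * (2 * k + 8)) := by
  rw [tossGates, List.flatMap_append, List.flatMap_map, siteOut, ← flatMap_finRange]
  refine congrArg₂ _ ?_ ?_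
  · simp [encodeGate_gateH, tossEntries, entryVal, Wire.index, Nat.add_comm]
  · simp only [tossEntries, List.map_nil, List.append_nil]
    refine congrArg (List.flatMap · _) (funext fun j => ?_)
    simp [encodeGate_gateH, entryVal, Wire.index]
    omega

lemma encode_markGates (i : Fin n) :
    (markGates (k := k) i).flatMap encodeGate =
      siteOut k markEntries.1 markEntries.2.1 markEntries.2.2 (i * (2 * k + 8)) := by
  have hw : ((i : ℕ) + 1) * (2 * k + 8) + 1 = 9 + (i * (2 * k + 8) + 2 * k) := by ring
  rw [markGates, List.flatMap_append, List.flatMap_append, List.flatMap_map, siteOut,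
    ← flatMap_finRange, List.append_assoc]
  refine congrArg₂ _ ?_ (congrArg₂ _ ?_ ?_)
  · simp [encodeGate_gateCNOT, encodeGate_gateX, markEntries, entryVal, Wire.index, Nat.add_comm]
  · refine congrArg (List.flatMap · _) (funext fun j => ?_)
    simp [encodeGate_gateToffoli, andGate, markEntries, entryVal, Wire.index]
    omega
  · simp [encodeGate_gateToffoli, encodeGate_gateCNOT, markEntries, entryVal, Wire.index, hw]
    omega

lemma encode_swapGates (i : Fin n) (b : ℕ) :
    (swapGates (k := k) i).flatMap encodeGate =
      swapEntries.map (entryVal (i * (2 * k + 8)) b) := by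
  simp only [swapGates, List.flatMap_cons, List.flatMap_nil, encodeGate_gateCNOT,
    encodeGate_gateToffoli, swapEntries, List.map_cons, List.map_nil, entryVal, Wire.index]
  simp [Nat.add_comm]

lemma encode_preSwapGates (i : Fin n) :
    (preSwapGates (k := k) i).flatMap encodeGate =
      siteOut k [] [] preSwapEntries (i * (2 * k + 8)) := by
  have hw : ((i : ℕ) + 1) * (2 * k + 8) + 1 = 9 + (i * (2 * k + 8) + 2 * k) := by ring
  rw [preSwapGates, List.flatMap_cons, List.flatMap_append,
    encode_swapGates i (i * (2 * k + 8) + 2 * k), siteOut, preSwapEntries]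
  simp only [List.flatMap_cons, List.flatMap_nil, encodeGate_gateCNOT, encodeGate_gateToffoli,
    List.map_append, List.map_cons, List.map_nil, entryVal, Wire.index, Fin.val_succ, hw]
  simp [Nat.add_comm]

lemma encode_postSwapGates (i : Fin n) :
    (postSwapGates (k := k) i).flatMap encodeGate =
      siteOut k [] [] postSwapEntries (i * (2 * k + 8)) := by
  have hw : ((i : ℕ) + 1) * (2 * k + 8) + 1 = 9 + (i * (2 * k + 8) + 2 * k) := by ring
  rw [postSwapGates, List.flatMap_append,
    encode_swapGates i (i * (2 * k + 8) + 2 * k), siteOut, postSwapEntries]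
  simp only [List.flatMap_cons, List.flatMap_nil, encodeGate_gateToffoli,
    List.map_append, List.map_cons, List.map_nil, entryVal, Wire.index, Fin.val_succ, hw]
  simp [Nat.add_comm]

/-- The output of `sitesProg`. -/
def sitesOut (n k : ℕ) (l₁ l₂ l₃ : List (ℕ × ℕ)) : List ℕ :=
  (List.range n).flatMap fun i => siteOut k l₁ l₂ l₃ (i * (2 * k + 8))

lemma encode_xWires : (List.ofFn fun i => (xWires n k i).index) =
    sitesOut n k [(3, 2)] [] [] := by
  rw [sitesOut, ← flatMap_finRange, List.ofFn_eq_map, List.map_eq_flatMap]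
  refine congrArg (List.flatMap · _) (funext fun i => ?_)
  have h : (xWires n k i).index = i * (2 * k + 8) + 2 := rfl
  simp [siteOut, entryVal, h, Nat.add_comm]

lemma encode_yWires : (List.ofFn fun i => (yWires n k i).index) =
    sitesOut n k [(3, 3)] [] [] := by
  rw [sitesOut, ← flatMap_finRange, List.ofFn_eq_map, List.map_eq_flatMap]
  refine congrArg (List.flatMap · _) (funext fun i => ?_)
  have h : (yWires n k i).index = i * (2 * k + 8) + 3 := rfl
  simp [siteOut, entryVal, h, Nat.add_comm]

lemma encode_sites {f : Fin n → List (Gate n (regWidth n k))} {l₁ l₂ l₃ : List (ℕ × ℕ)}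
    (h : ∀ i, (f i).flatMap encodeGate = siteOut k l₁ l₂ l₃ (i * (2 * k + 8))) :
    ((List.finRange n).flatMap f).flatMap encodeGate = sitesOut n k l₁ l₂ l₃ := by
  rw [List.flatMap_assoc, sitesOut, ← flatMap_finRange]
  simp only [h]

lemma encode_swapCircuit (n k : ℕ) : (swapCircuit n k).encode =
    [n * (2 * k + 8) + 2, 0] ++
      (sitesOut n k tossEntries.1 tossEntries.2.1 tossEntries.2.2 ++
      (sitesOut n k markEntries.1 markEntries.2.1 markEntries.2.2 ++ ([1, 0] ++
      (sitesOut n k [] [] preSwapEntries ++ ([5] ++ (sitesOut n k [(3, 2)] [] [] ++ ([5] ++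
      (sitesOut n k [(3, 3)] [] [] ++ (sitesOut n k [] [] postSwapEntries ++ [1, 0]))))))))) := by
  have h : (swapCircuit n k).encode = (n * (2 * k + 8) + 2) :: 0 ::
      (preGates n k ++ queryGates n k ++ postGates n k).flatMap encodeGate := rfl
  rw [h, preGates, postGates, queryGates]
  simp only [List.flatMap_append, encode_sites encode_tossGates, encode_sites encode_markGates,
    encode_sites encode_preSwapGates, encode_sites encode_postSwapGates, List.flatMap_cons,
    List.flatMap_nil, encodeGate_gateH, encodeGate_gateQuery, encode_xWires, encode_yWires]
  simp only [List.append_assoc, List.cons_append, List.nil_append, List.append_nil, Wire.index]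

/-! ### The program -/

/-- The program that writes down the circuit. -/
def circuitProg : Prog :=
  .seq setupProg (.seq (sitesProg [] [] []) (.seq (emitList [(3, 2), (8, 0)])
    (.seq (sitesProg tossEntries.1 tossEntries.2.1 tossEntries.2.2)
    (.seq (sitesProg markEntries.1 markEntries.2.1 markEntries.2.2)
    (.seq (emitList [(8, 1), (8, 0)]) (.seq (sitesProg [] [] preSwapEntries)
    (.seq (emitList [(8, 5)]) (.seq (sitesProg [(3, 2)] [] [])
    (.seq (emitList [(8, 5)]) (.seq (sitesProg [(3, 3)] [] [])
    (.seq (sitesProg [] [] postSwapEntries) (emitList [(8, 1), (8, 0)]))))))))))))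

lemma runs_sitesProg_le {l₁ l₂ l₃ : List (ℕ × ℕ)} (h₁ : ∀ e ∈ l₁, e.1 = 3 ∨ e.1 = 8)
    (h₂ : ∀ e ∈ l₂, ValidEntry e) (h₃ : ∀ e ∈ l₃, ValidEntry e) (hl : l₁.length ≤ 20 ∧
    l₂.length ≤ 20 ∧ l₃.length ≤ 20) (hk : k ≤ n + 1) {s : MState} (hs : Ready n k s) :
    Runs (sitesProg l₁ l₂ l₃) s (200 * (n + 1) ^ 2) fun s' => Ready n k s' ∧
      s'.out = s.out ++ sitesOut n k l₁ l₂ l₃ ∧ s'.mem 3 = n * (2 * k + 8) := by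
  refine (runs_sitesProg h₁ h₂ h₃ hs).mono ?_ fun s' h => h
  obtain ⟨a, b, c⟩ := hl
  have h1 : k * (3 * l₂.length + 5) ≤ (n + 1) * 65 := Nat.mul_le_mul hk (by omega)
  have h2 : n * (3 * l₁.length + (k * (3 * l₂.length + 5) + 3) + 3 * l₃.length + 5) ≤
      n * ((n + 1) * 65 + 128) := Nat.mul_le_mul le_rfl (by omega)
  nlinarith

lemma runs_emitList_le {l : List (ℕ × ℕ)} (hl : ∀ e ∈ l, e.1 = 3 ∨ e.1 = 8)
    (hlen : l.length ≤ 20) {s : MState} (hs : Ready n k s) :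
    Runs (emitList l) s (200 * (n + 1) ^ 2) fun s' => Ready n k s' ∧
      s'.out = s.out ++ l.map (entryVal (s.mem 3) 0) := by
  have h1 : 1 ≤ (n + 1) ^ 2 := Nat.one_le_pow _ _ (by omega)
  refine (runs_emitList_ready (fun e he => (hl e he).elim Or.inl fun h => Or.inr (Or.inr h))
    hs).mono (by linarith) fun s' ⟨hR, ho, _⟩ => ⟨hR, ?_⟩
  rw [ho]
  congr 1
  refine List.map_congr_left fun e he => ?_
  rcases hl e he with h | h <;> simp [entryVal, h]

lemma runs_circuitProg (n : ℕ) :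
    Runs circuitProg (MState.init n) (3000 * (n + 1) ^ 2) fun s =>
      s.out = (swapCircuit n (coinCount n)).encode := by
  have hclog : Nat.clog 2 n ≤ n := Nat.clog_le_of_le_pow (Nat.lt_two_pow_self).le
  have hk : coinCount n ≤ n + 1 := by rw [coinCount]; omega
  have h1 : n + 1 ≤ (n + 1) ^ 2 := Nat.le_self_pow (by norm_num) _
  refine Runs.mono (T := (Nat.clog 2 n * 5 + 9) + (200 * (n + 1) ^ 2 + (200 * (n + 1) ^ 2 +
    (200 * (n + 1) ^ 2 + (200 * (n + 1) ^ 2 + (200 * (n + 1) ^ 2 + (200 * (n + 1) ^ 2 +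
    (200 * (n + 1) ^ 2 + (200 * (n + 1) ^ 2 + (200 * (n + 1) ^ 2 + (200 * (n + 1) ^ 2 +
    (200 * (n + 1) ^ 2 + 200 * (n + 1) ^ 2)))))))))))) (Q := fun s =>
      s.out = (swapCircuit n (coinCount n)).encode) ?_ (by linarith) fun _ h => h
  unfold circuitProg
  refine (runs_setupProg n).seq fun s₀ ⟨hR₀, ho₀⟩ => ?_
  refine (runs_sitesProg_le (by simp) (by simp) (by simp) (by simp) hk hR₀).seq
    fun s₁ ⟨hR₁, ho₁, h3⟩ => ?_
  refine (runs_emitList_le (by simp) (by simp) hR₁).seq fun s₂ ⟨hR₂, ho₂⟩ => ?_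
  refine (runs_sitesProg_le (by simp [tossEntries]) (by simp [tossEntries, ValidEntry])
    (by simp [tossEntries]) (by simp [tossEntries]) hk hR₂).seq fun s₃ ⟨hR₃, ho₃, _⟩ => ?_
  refine (runs_sitesProg_le (by simp [markEntries]) (by simp [markEntries, ValidEntry])
    (by simp [markEntries, ValidEntry]) (by simp [markEntries]) hk hR₃).seq
    fun s₄ ⟨hR₄, ho₄, _⟩ => ?_
  refine (runs_emitList_le (by simp) (by simp) hR₄).seq fun s₅ ⟨hR₅, ho₅⟩ => ?_
  refine (runs_sitesProg_le (by simp) (by simp)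
    (by simp [preSwapEntries, swapEntries, ValidEntry]) (by simp [preSwapEntries, swapEntries])
    hk hR₅).seq fun s₆ ⟨hR₆, ho₆, _⟩ => ?_
  refine (runs_emitList_le (by simp) (by simp) hR₆).seq fun s₇ ⟨hR₇, ho₇⟩ => ?_
  refine (runs_sitesProg_le (by simp) (by simp) (by simp) (by simp) hk hR₇).seq
    fun s₈ ⟨hR₈, ho₈, _⟩ => ?_
  refine (runs_emitList_le (by simp) (by simp) hR₈).seq fun s₉ ⟨hR₉, ho₉⟩ => ?_
  refine (runs_sitesProg_le (by simp) (by simp) (by simp) (by simp) hk hR₉).seq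
    fun s₁₀ ⟨hR₁₀, ho₁₀, _⟩ => ?_
  refine (runs_sitesProg_le (by simp) (by simp)
    (by simp [postSwapEntries, swapEntries, ValidEntry]) (by simp [postSwapEntries, swapEntries])
    hk hR₁₀).seq fun s₁₁ ⟨hR₁₁, ho₁₁, _⟩ => ?_
  refine (runs_emitList_le (by simp) (by simp) hR₁₁).mono le_rfl fun s₁₂ ⟨_, ho₁₂⟩ => ?_
  have hnil : sitesOut n (coinCount n) [] [] [] = [] := by simp [sitesOut, siteOut]
  rw [encode_swapCircuit, ho₁₂, ho₁₁, ho₁₀, ho₉, ho₈, ho₇, ho₆, ho₅, ho₄, ho₃, ho₂, ho₁, ho₀, h3,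
    hnil]
  simp only [List.map_cons, List.map_nil, entryVal, List.append_assoc, List.nil_append]
  simp [Nat.add_comm]

/-- The distinguishing experiment. -/
def swapExperiment : Experiment := fun n => swapCircuit n (coinCount n)

lemma swapExperiment_polyTime : swapExperiment.PolyTime := by
  refine ⟨circuitProg, Polynomial.C 3000 * (Polynomial.X + 1) ^ 2, fun n => ?_⟩
  have hp : (Polynomial.C 3000 * (Polynomial.X + 1) ^ 2 : Polynomial ℕ).eval n =
      3000 * (n + 1) ^ 2 := by simp
  rw [hp]
  constructor
  · change n * (2 * coinCount n + 8) + 2 ≤ _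
    have hclog : Nat.clog 2 n ≤ n := Nat.clog_le_of_le_pow (Nat.lt_two_pow_self).le
    have h2 : n * (2 * coinCount n + 8) ≤ n * (2 * (n + 1) + 8) :=
      Nat.mul_le_mul le_rfl (by rw [coinCount]; omega)
    nlinarith
  · exact runs_circuitProg n

end NoGoPRU

namespace NoGoPRU

variable {n : ℕ}

/-! ### The signal -/

/-- The nontrivial Pauli strings within `w`. -/
def nontrivialWithin (w : Bits n) : Finset (PauliString n) :=
  (Finset.univ.filter (PauliString.Within w)).erase (PauliString.one n)

/-- The contribution of the nontrivial Pauli strings to the average swap correlator. -/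
def signal (k : ℕ) (U : UGroup n) : ℝ :=
  ∑ w : Bits n, markProb k w * (1 / 4) ^ weight w *
    ∑ P ∈ nontrivialWithin w, ∑ Q ∈ nontrivialWithin w, transfer P Q U ^ 2

lemma transferSum_eq (w : Bits n) (U : UGroup n) : transferSum w U =
    1 + ∑ P ∈ nontrivialWithin w, ∑ Q ∈ nontrivialWithin w, transfer P Q U ^ 2 := by
  have h1 : PauliString.one n ∈ Finset.univ.filter (PauliString.Within w) :=
    Finset.mem_filter.mpr ⟨Finset.mem_univ _, fun _ _ => rfl⟩
  rw [transferSum, ← Finset.add_sum_erase _ _ h1]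
  congr 1
  · rw [Finset.sum_eq_single (PauliString.one n)]
    · simp [transfer_one_left]
    · intro Q _ hQ
      simp [transfer_one_left, hQ]
    · exact fun h => absurd h1 h
  · refine Finset.sum_congr rfl fun P hP => ?_
    rw [← Finset.add_sum_erase _ _ h1, transfer_one_right, if_neg (Finset.ne_of_mem_erase hP)]
    simp [nontrivialWithin]

lemma acceptProb_eq_signal (k : ℕ) (U : UGroup n) : (swapCircuit n k).acceptProb U =
    1 / 2 * (∑ w : Bits n, markProb k w * (1 - (1 / 4) ^ weight w)) - 1 / 2 * signal k U := by
  rw [acceptProb_swapCircuit, signal, ← mul_sub, ← Finset.sum_sub_distrib]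
  congr 1
  refine Finset.sum_congr rfl fun w _ => ?_
  rw [transferSum_eq]
  ring

lemma continuous_signal (k : ℕ) : Continuous (signal (n := n) k) := by
  unfold signal
  exact continuous_finsetSum _ fun w _ => continuous_const.mul
    (continuous_finsetSum _ fun P _ => continuous_finsetSum _ fun Q _ =>
      (continuous_transfer P Q).pow 2)

lemma integral_acceptProb (k : ℕ) (μ : Measure (UGroup n)) [IsProbabilityMeasure μ] :
    ∫ U, (swapCircuit n k).acceptProb U ∂μ =
      1 / 2 * (∑ w : Bits n, markProb k w * (1 - (1 / 4) ^ weight w)) -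
        1 / 2 * ∫ U, signal k U ∂μ := by
  simp only [acceptProb_eq_signal]
  rw [integral_sub (integrable_const _)
    ((integrable_of_continuous μ (continuous_signal k)).const_mul _), integral_const,
    integral_const_mul]
  simp

lemma card_nontrivialWithin_le (w : Bits n) : ((nontrivialWithin w).card : ℝ) ≤ 4 ^ weight w := by
  have h1 : ((Finset.univ.filter (PauliString.Within w)).card : ℝ) = 4 ^ weight w := by
    rw [Finset.card_filter]
    push_cast
    have h2 : ∀ P : PauliString n, (if PauliString.Within w P then (1 : ℝ) else 0) =
        ∏ i, if w i = 0 → P i = .I then 1 else 0 := by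
      intro P
      rw [Finset.prod_ite_zero]
      simp [PauliString.Within]
    simp only [h2]
    rw [sum_prod_bits fun i a => if w i = 0 → a = Pauli.I then (1 : ℝ) else 0, weight,
      ← Finset.prod_pow_eq_pow_sum]
    refine Finset.prod_congr rfl fun i _ => ?_
    rcases fin_two_eq_zero_or_one (w i) with h | h
    · simp [h]
    · simp [h, Pauli.card]
  rw [← h1]
  exact_mod_cast Finset.card_le_card (Finset.erase_subset _ _)

/-- The Haar average of the signal is exponentially small. -/
lemma integral_signal_haar_le {k : ℕ} (hk : 1 ≤ k) :
    ∫ U, signal k U ∂(haar n) ≤ 2 * (5 / 8) ^ n := by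
  have hInt : ∀ P Q : PauliString n, Integrable (fun U => transfer P Q U ^ 2) (haar n) :=
    fun P Q => integrable_of_continuous _ ((continuous_transfer P Q).pow 2)
  have h1 : ∫ U, signal k U ∂(haar n) = ∑ w : Bits n, markProb k w * (1 / 4) ^ weight w *
      ∑ P ∈ nontrivialWithin w, ∑ Q ∈ nontrivialWithin w,
        ∫ U, transfer P Q U ^ 2 ∂(haar n) := by
    unfold signal
    rw [integral_finsetSum _ fun w _ => (integrable_finsetSum _ fun P _ =>
      integrable_finsetSum _ fun Q _ => hInt P Q).const_mul _]
    refine Finset.sum_congr rfl fun w _ => ?_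
    rw [integral_const_mul, integral_finsetSum _ fun P _ => integrable_finsetSum _ fun Q _ =>
      hInt P Q]
    congr 1
    exact Finset.sum_congr rfl fun P _ => integral_finsetSum _ fun Q _ => hInt P Q
  have h2 : ∀ w : Bits n, ∑ P ∈ nontrivialWithin w, ∑ Q ∈ nontrivialWithin w,
      ∫ U, transfer P Q U ^ 2 ∂(haar n) ≤ 4 ^ weight w * (4 ^ weight w * (2 / 4 ^ n)) := by
    intro w
    have hc := card_nontrivialWithin_le w
    calc _ ≤ ∑ P ∈ nontrivialWithin w, ∑ Q ∈ nontrivialWithin w, (2 / 4 ^ n : ℝ) :=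
          Finset.sum_le_sum fun P hP => Finset.sum_le_sum fun Q _ =>
            integral_transfer_sq_le (Finset.ne_of_mem_erase hP) Q
      _ = (nontrivialWithin w).card * ((nontrivialWithin w).card * (2 / 4 ^ n)) := by simp
      _ ≤ _ := by gcongr
  have h3 : (2 : ℝ) / 4 ^ n * (5 / 2) ^ n = 2 * (5 / 8) ^ n := by
    rw [div_mul_eq_mul_div, mul_div_assoc, ← div_pow]
    norm_num
  rw [h1, ← h3]
  refine le_trans ?_ (mul_le_mul_of_nonneg_left (sum_markProb_mul_four_pow_le (n := n) hk)
    (by positivity))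
  rw [Finset.mul_sum]
  refine Finset.sum_le_sum fun w _ => ?_
  calc _ ≤ markProb k w * (1 / 4) ^ weight w * (4 ^ weight w * (4 ^ weight w * (2 / 4 ^ n))) :=
        mul_le_mul_of_nonneg_left (h2 w) (mul_nonneg (markProb_nonneg _ _) (by positivity))
    _ = ((1 / 4) ^ weight w * 4 ^ weight w) * (2 / 4 ^ n * (markProb k w * 4 ^ weight w)) := by
        ring
    _ = _ := by rw [← mul_pow]; norm_num

/-- For a Hamiltonian with terms in `S`, the signal is bounded below if any two elements of `S` fit
into a set of sites of weight at most `a` with at most `b` runs. -/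
lemma le_signal_evolution (hn : 2 ≤ n) {S : Finset (PauliString n)} (hne : S.Nonempty)
    (hS : PauliString.one n ∉ S) {a b : ℕ}
    (hcover : ∀ P ∈ S, ∀ Q ∈ S, ∃ w : Bits n, PauliString.Within w P ∧ PauliString.Within w Q ∧
      weight w ≤ a ∧ runs w ≤ b)
    {H : Hamiltonian n} (hH : IsPauliSum (fun P => P = PauliString.one n ∨ P ∈ S) H) (t : ℝ) :
    1 / 2 * (1 / 16) ^ a * (1 / (4 * (n : ℝ))) ^ b ≤
      signal (coinCount n) (evolution (H, t)) := by
  set δ : ℝ := 1 / 2 * (1 / 16) ^ a * (1 / (4 * (n : ℝ))) ^ b with hδ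
  have hδ0 : 0 ≤ δ := by positivity
  set U := evolution (H, t) with hU
  set m : Bits n → ℝ := fun w => markProb (coinCount n) w * (1 / 4) ^ weight w with hm
  have hm0 : ∀ w, 0 ≤ m w := fun w => mul_nonneg (markProb_nonneg _ _) (by positivity)
  have hsig : signal (coinCount n) U = ∑ P, ∑ Q, ∑ w : Bits n,
      if P ∈ nontrivialWithin w ∧ Q ∈ nontrivialWithin w then m w * transfer P Q U ^ 2 else 0 := by
    have h1 : ∀ w : Bits n, markProb (coinCount n) w * (1 / 4) ^ weight w *
        ∑ P ∈ nontrivialWithin w, ∑ Q ∈ nontrivialWithin w, transfer P Q U ^ 2 =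
        ∑ P, ∑ Q, if P ∈ nontrivialWithin w ∧ Q ∈ nontrivialWithin w
          then m w * transfer P Q U ^ 2 else 0 := by
      intro w
      simp only [ite_and]
      rw [Finset.mul_sum]
      simp only [Finset.sum_ite_irrel, Finset.sum_const_zero]
      rw [Finset.sum_ite_mem, Finset.univ_inter]
      refine Finset.sum_congr rfl fun P _ => ?_
      rw [Finset.sum_ite_mem, Finset.univ_inter, Finset.mul_sum]
    rw [signal, Finset.sum_congr rfl fun w _ => h1 w, Finset.sum_comm]
    exact Finset.sum_congr rfl fun P _ => Finset.sum_comm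
  have hpair : ∀ P ∈ S, ∀ Q ∈ S, δ * transfer P Q U ^ 2 ≤ ∑ w : Bits n,
      if P ∈ nontrivialWithin w ∧ Q ∈ nontrivialWithin w then m w * transfer P Q U ^ 2 else 0 := by
    intro P hP Q hQ
    obtain ⟨w, hPw, hQw, hwa, hwb⟩ := hcover P hP Q hQ
    have h1 : δ ≤ m w := le_markProb_coinCount hn w hwa hwb
    have hP' : P ∈ nontrivialWithin w := Finset.mem_erase.mpr
      ⟨fun h => hS (h ▸ hP), Finset.mem_filter.mpr ⟨Finset.mem_univ _, hPw⟩⟩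
    have hQ' : Q ∈ nontrivialWithin w := Finset.mem_erase.mpr
      ⟨fun h => hS (h ▸ hQ), Finset.mem_filter.mpr ⟨Finset.mem_univ _, hQw⟩⟩
    refine (mul_le_mul_of_nonneg_right h1 (sq_nonneg (transfer P Q U))).trans ?_
    have h2 := Finset.single_le_sum (s := Finset.univ) (a := w) (f := fun w =>
      if P ∈ nontrivialWithin w ∧ Q ∈ nontrivialWithin w then m w * transfer P Q U ^ 2 else 0)
      (fun w _ => by
        split_ifs
        · exact mul_nonneg (hm0 w) (sq_nonneg _)
        · exact le_rfl) (Finset.mem_univ w)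
    simpa only [if_pos (And.intro hP' hQ')] using h2
  have hnn : ∀ P Q, 0 ≤ ∑ w : Bits n,
      if P ∈ nontrivialWithin w ∧ Q ∈ nontrivialWithin w then m w * transfer P Q U ^ 2 else 0 := by
    intro P Q
    refine Finset.sum_nonneg fun w _ => ?_
    split_ifs
    · exact mul_nonneg (hm0 w) (sq_nonneg _)
    · exact le_rfl
  have hone := one_le_sum_transfer_sq S hne hS hH t
  calc δ = δ * 1 := (mul_one _).symm
    _ ≤ δ * ∑ P ∈ S, ∑ Q ∈ S, transfer P Q U ^ 2 := mul_le_mul_of_nonneg_left hone hδ0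
    _ = ∑ P ∈ S, ∑ Q ∈ S, δ * transfer P Q U ^ 2 := by simp only [Finset.mul_sum]
    _ ≤ ∑ P ∈ S, ∑ Q ∈ S, ∑ w : Bits n,
        if P ∈ nontrivialWithin w ∧ Q ∈ nontrivialWithin w then m w * transfer P Q U ^ 2 else 0 :=
      Finset.sum_le_sum fun P hP => Finset.sum_le_sum fun Q hQ => hpair P hP Q hQ
    _ ≤ ∑ P ∈ S, ∑ Q, ∑ w : Bits n,
        if P ∈ nontrivialWithin w ∧ Q ∈ nontrivialWithin w then m w * transfer P Q U ^ 2 else 0 :=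
      Finset.sum_le_sum fun P _ => Finset.sum_le_sum_of_subset_of_nonneg (Finset.subset_univ S)
        fun Q _ _ => hnn P Q
    _ ≤ ∑ P, ∑ Q, ∑ w : Bits n,
        if P ∈ nontrivialWithin w ∧ Q ∈ nontrivialWithin w then m w * transfer P Q U ^ 2 else 0 :=
      Finset.sum_le_sum_of_subset_of_nonneg (Finset.subset_univ S)
        fun P _ _ => Finset.sum_nonneg fun Q _ => hnn P Q
    _ = _ := hsig.symm

instance instIsProbabilityMeasureEvolutionEnsemble (D : Measure (Hamiltonian n × ℝ))
    [IsProbabilityMeasure D] : IsProbabilityMeasure (evolutionEnsemble D) :=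
  Measure.isProbabilityMeasure_map (measurable_evolution n).aemeasurable

lemma le_advantage (D : (n : ℕ) → Measure (Hamiltonian n × ℝ)) [∀ n, IsProbabilityMeasure (D n)]
    (hn : 2 ≤ n) {S : Finset (PauliString n)} (hne : S.Nonempty)
    (hS : PauliString.one n ∉ S) {a b : ℕ}
    (hcover : ∀ P ∈ S, ∀ Q ∈ S, ∃ w : Bits n, PauliString.Within w P ∧ PauliString.Within w Q ∧
      weight w ≤ a ∧ runs w ≤ b)
    (hD : ∀ᵐ p ∂(D n), IsPauliSum (fun P => P = PauliString.one n ∨ P ∈ S) p.1) :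
    1 / 2 * (1 / 2 * (1 / 16) ^ a * (1 / (4 * (n : ℝ))) ^ b - 2 * (5 / 8) ^ n) ≤
      advantage swapExperiment (fun n => evolutionEnsemble (D n)) n := by
  have hE : 1 / 2 * (1 / 16) ^ a * (1 / (4 * (n : ℝ))) ^ b ≤
      ∫ U, signal (coinCount n) U ∂(evolutionEnsemble (D n)) := by
    have hmeas := (measurable_evolution n).aemeasurable (μ := D n)
    have hcont := continuous_signal (n := n) (coinCount n)
    have hInt : Integrable (fun p => signal (coinCount n) (evolution p)) (D n) :=
      (integrable_map_measure hcont.measurable.aestronglyMeasurable hmeas).mp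
        (integrable_of_continuous (evolutionEnsemble (D n)) hcont)
    rw [evolutionEnsemble, integral_map hmeas hcont.measurable.aestronglyMeasurable]
    calc _ = ∫ _, 1 / 2 * (1 / 16) ^ a * (1 / (4 * (n : ℝ))) ^ b ∂(D n) := by simp
      _ ≤ _ := integral_mono_ae (integrable_const _) hInt (hD.mono fun p hp =>
        le_signal_evolution hn hne hS hcover hp p.2)
  have hH := integral_signal_haar_le (n := n) (k := coinCount n) (by rw [coinCount]; omega)
  have h1 : advantage swapExperiment (fun n => evolutionEnsemble (D n)) n =
      |∫ U, (swapCircuit n (coinCount n)).acceptProb U ∂(evolutionEnsemble (D n)) -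
        ∫ U, (swapCircuit n (coinCount n)).acceptProb U ∂(haar n)| := rfl
  rw [h1, integral_acceptProb, integral_acceptProb]
  refine le_trans ?_ (neg_le_abs _)
  linarith

/-! ### Regions -/

/-- The marks of a set of sites. -/
def marksOf (A : Finset (Fin n)) : Bits n := fun i => if i ∈ A then 1 else 0

lemma marksOf_eq_one {A : Finset (Fin n)} {i : Fin n} : marksOf A i = 1 ↔ i ∈ A := by
  unfold marksOf; split_ifs with h <;> simp [h]

lemma marksOf_eq_zero {A : Finset (Fin n)} {i : Fin n} : marksOf A i = 0 ↔ i ∉ A := by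
  unfold marksOf; split_ifs with h <;> simp [h]

lemma weight_marksOf (A : Finset (Fin n)) : weight (marksOf A) = A.card := by
  have : ∀ i, ((marksOf A i : Fin 2) : ℕ) = if i ∈ A then 1 else 0 := by
    intro i; unfold marksOf; split_ifs <;> rfl
  simp [weight, this]

lemma runs_marksOf_le (A : Finset (Fin n)) : runs (marksOf A) ≤ A.card :=
  Finset.card_le_card fun _ hi => marksOf_eq_one.mp (Finset.mem_filter.mp hi).2.1

lemma within_marksOf {A : Finset (Fin n)} {P : PauliString n} (h : ∀ i, P i ≠ .I → i ∈ A) :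
    PauliString.Within (marksOf A) P := by
  intro i hi
  by_contra hc
  exact marksOf_eq_zero.mp hi (h i hc)

/-- A window of `q` consecutive sites of a ring. -/
def window (n q a : ℕ) : Finset (Fin n) :=
  Finset.univ.filter fun i => ∃ j < q, (i : ℕ) = (a + j) % n

lemma card_window_le (n q a : ℕ) : (window n q a).card ≤ q := by
  have h : (window n q a).image Fin.val ⊆ (Finset.range q).image fun j => (a + j) % n := by
    intro x hx
    obtain ⟨i, hi, rfl⟩ := Finset.mem_image.mp hx
    obtain ⟨j, hj, hij⟩ := (Finset.mem_filter.mp hi).2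
    exact Finset.mem_image.mpr ⟨j, Finset.mem_range.mpr hj, hij.symm⟩
  calc (window n q a).card = ((window n q a).image Fin.val).card :=
        (Finset.card_image_of_injective _ Fin.val_injective).symm
    _ ≤ _ := Finset.card_le_card h
    _ ≤ (Finset.range q).card := Finset.card_image_le
    _ = q := Finset.card_range q

lemma prevMark_of_pos (w : Bits n) {i : Fin n} (hi : 0 < (i : ℕ)) :
    prevMark w i = w ⟨i - 1, by omega⟩ := by
  have : i.castSucc = Fin.succ ⟨i - 1, by omega⟩ := by
    ext; simp; omega
  rw [prevMark, this, Fin.cons_succ]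

lemma pred_mem_window {q a : ℕ} {i : Fin n} (hi : i ∈ window n q a) (h0 : 0 < (i : ℕ))
    (ha : (i : ℕ) ≠ a % n) : (⟨i - 1, by omega⟩ : Fin n) ∈ window n q a := by
  obtain ⟨j, hj, hij⟩ := (Finset.mem_filter.mp hi).2
  have hj0 : j ≠ 0 := by rintro rfl; exact ha (by simpa using hij)
  refine Finset.mem_filter.mpr ⟨Finset.mem_univ _, j - 1, by omega, ?_⟩
  have hn : 0 < n := by omega
  have hm : a + j = (a + (j - 1)) + 1 := by omega
  rw [hm] at hij
  generalize a + (j - 1) = m at hij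
  have hlt := Nat.mod_lt m hn
  have h1 : (m + 1) % n = (m % n + 1) % n := by rw [Nat.mod_add_mod]
  rw [h1] at hij
  rcases Nat.lt_or_ge (m % n + 1) n with h | h
  · rw [Nat.mod_eq_of_lt h] at hij
    simp only; omega
  · have : m % n + 1 = n := by omega
    rw [this, Nat.mod_self] at hij
    omega

lemma runs_window_union_le (hn : 0 < n) (q a b : ℕ) :
    runs (marksOf (window n q a ∪ window n q b)) ≤ 3 := by
  have h : (Finset.univ.filter fun i => marksOf (window n q a ∪ window n q b) i = 1 ∧
      prevMark (marksOf (window n q a ∪ window n q b)) i = 0) ⊆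
      {⟨0, hn⟩, ⟨a % n, Nat.mod_lt _ hn⟩, ⟨b % n, Nat.mod_lt _ hn⟩} := by
    intro i hi
    obtain ⟨h1, h2⟩ := (Finset.mem_filter.mp hi).2
    simp only [Finset.mem_insert, Finset.mem_singleton, Fin.ext_iff]
    by_contra! hc
    have hpos : 0 < (i : ℕ) := by omega
    rw [prevMark_of_pos _ hpos, marksOf_eq_zero, Finset.mem_union, not_or] at h2
    rcases Finset.mem_union.mp (marksOf_eq_one.mp h1) with h' | h'
    · exact h2.1 (pred_mem_window h' hpos hc.2.1)
    · exact h2.2 (pred_mem_window h' hpos hc.2.2)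
  exact (Finset.card_le_card h).trans Finset.card_le_three

/-- The string with a single Pauli matrix at the first site. -/
def firstSite (n : ℕ) : PauliString n := fun i => if (i : ℕ) = 0 then .X else .I

lemma firstSite_ne_one (hn : 0 < n) : firstSite n ≠ PauliString.one n := by
  intro h
  have := congrFun h ⟨0, hn⟩
  simp [firstSite, PauliString.one] at this

lemma inWindow_firstSite {q : ℕ} (hq : 1 ≤ q) : PauliString.InWindow q (firstSite n) := by
  refine ⟨0, fun i hi => ⟨0, hq, ?_⟩⟩
  have : (i : ℕ) = 0 := by
    by_contra hc
    exact hi (if_neg hc)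
  simp [this]

lemma weight_firstSite_le {q : ℕ} (hq : 1 ≤ q) : PauliString.weight (firstSite n) ≤ q := by
  refine le_trans (Finset.card_le_one.mpr fun i hi j hj => ?_) hq
  have h : ∀ i : Fin n, i ∈ (Finset.univ.filter fun i => firstSite n i ≠ Pauli.I) →
      (i : ℕ) = 0 := by
    intro i hi
    by_contra hc
    exact (Finset.mem_filter.mp hi).2 (if_neg hc)
  exact Fin.ext ((h i hi).trans (h j hj).symm)

lemma IsPauliSum.mono {S S' : PauliString n → Prop} {H : Hamiltonian n} (h : IsPauliSum S H)
    (hS : ∀ P, S P → S' P) : IsPauliSum S' H := by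
  obtain ⟨c, hc, hH⟩ := h
  exact ⟨c, fun P hP => hS P (hc P hP), hH⟩

open Classical in
lemma le_advantage_of_pred (D : (n : ℕ) → Measure (Hamiltonian n × ℝ))
    [∀ n, IsProbabilityMeasure (D n)] (hn : 2 ≤ n) (S : PauliString n → Prop)
    (hfirst : S (firstSite n)) {a b : ℕ}
    (hcover : ∀ P, S P → ∀ Q, S Q → ∃ w : Bits n, PauliString.Within w P ∧
      PauliString.Within w Q ∧ weight w ≤ a ∧ runs w ≤ b)
    (hD : ∀ᵐ p ∂(D n), IsPauliSum S p.1) :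
    1 / 2 * (1 / 2 * (1 / 16) ^ a * (1 / (4 * (n : ℝ))) ^ b - 2 * (5 / 8) ^ n) ≤
      advantage swapExperiment (fun n => evolutionEnsemble (D n)) n := by
  refine le_advantage D hn (S := Finset.univ.filter fun P => S P ∧ P ≠ PauliString.one n)
    ⟨firstSite n, ?_⟩ (by simp) ?_ (hD.mono fun p hp => hp.mono fun P hP => ?_)
  · exact Finset.mem_filter.mpr ⟨Finset.mem_univ _, hfirst, firstSite_ne_one (by omega)⟩
  · intro P hP Q hQ
    exact hcover P (Finset.mem_filter.mp hP).2.1 Q (Finset.mem_filter.mp hQ).2.1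
  · by_cases h : P = PauliString.one n
    · exact Or.inl h
    · exact Or.inr (Finset.mem_filter.mpr ⟨Finset.mem_univ _, hP, h⟩)

lemma le_advantage_of_isLocal1D (D : (n : ℕ) → Measure (Hamiltonian n × ℝ))
    [∀ n, IsProbabilityMeasure (D n)] (hn : 2 ≤ n) {q : ℕ}
    (hD : ∀ᵐ p ∂(D n), IsLocal1D q p.1) :
    1 / 2 * (1 / 2 * (1 / 16) ^ (2 * (q + 1)) * (1 / (4 * (n : ℝ))) ^ 3 - 2 * (5 / 8) ^ n) ≤
      advantage swapExperiment (fun n => evolutionEnsemble (D n)) n := by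
  refine le_advantage_of_pred D hn (PauliString.InWindow (q + 1))
    (inWindow_firstSite (by omega)) ?_ (hD.mono fun p hp => hp.mono fun P hP => ?_)
  · rintro P ⟨a, ha⟩ Q ⟨b, hb⟩
    refine ⟨marksOf (window n (q + 1) a ∪ window n (q + 1) b), within_marksOf fun i hi => ?_,
      within_marksOf fun i hi => ?_, ?_, runs_window_union_le (by omega) _ _ _⟩
    · exact Finset.mem_union_left _ (Finset.mem_filter.mpr ⟨Finset.mem_univ _, ha i hi⟩)
    · exact Finset.mem_union_right _ (Finset.mem_filter.mpr ⟨Finset.mem_univ _, hb i hi⟩)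
    · rw [weight_marksOf]
      have h1 := card_window_le n (q + 1) a
      have h2 := card_window_le n (q + 1) b
      have h3 := Finset.card_union_le (window n (q + 1) a) (window n (q + 1) b)
      omega
  · obtain ⟨a, ha⟩ := hP
    exact ⟨a, fun i hi => (ha i hi).imp fun j hj => ⟨by omega, hj.2⟩⟩

lemma le_advantage_of_isLocal (D : (n : ℕ) → Measure (Hamiltonian n × ℝ))
    [∀ n, IsProbabilityMeasure (D n)] (hn : 2 ≤ n) {q r : ℕ} (hqr : q + 1 ≤ r)
    (hD : ∀ᵐ p ∂(D n), IsLocal q p.1) :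
    1 / 2 * (1 / 2 * (1 / 16) ^ (2 * r) * (1 / (4 * (n : ℝ))) ^ (2 * r) - 2 * (5 / 8) ^ n) ≤
      advantage swapExperiment (fun n => evolutionEnsemble (D n)) n := by
  refine le_advantage_of_pred D hn (fun P => PauliString.weight P ≤ r)
    (weight_firstSite_le (by omega)) ?_ (hD.mono fun p hp => hp.mono fun P hP => by omega)
  intro P hP Q hQ
  set A := (Finset.univ.filter fun i => P i ≠ Pauli.I) ∪
    (Finset.univ.filter fun i => Q i ≠ Pauli.I) with hA
  have hcard : A.card ≤ 2 * r := by
    have := Finset.card_union_le (Finset.univ.filter fun i => P i ≠ Pauli.I)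
      (Finset.univ.filter fun i => Q i ≠ Pauli.I)
    unfold PauliString.weight at hP hQ
    rw [hA]
    omega
  refine ⟨marksOf A, within_marksOf fun i hi => ?_, within_marksOf fun i hi => ?_, ?_, ?_⟩
  · exact Finset.mem_union_left _ (Finset.mem_filter.mpr ⟨Finset.mem_univ _, hi⟩)
  · exact Finset.mem_union_right _ (Finset.mem_filter.mpr ⟨Finset.mem_univ _, hi⟩)
  · rw [weight_marksOf]; exact hcard
  · exact (runs_marksOf_le A).trans hcard

/-! ### Asymptotics -/

lemma not_negligible_of_le {f : ℕ → ℝ} {c : ℝ} (hc : 0 < c) (K : ℕ)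
    (h : ∀ᶠ n : ℕ in atTop, 1 / 2 * (c / (n : ℝ) ^ K - 2 * (5 / 8) ^ n) ≤ f n) :
    ¬ Negligible f := by
  intro hneg
  have h1 : Tendsto (fun n : ℕ => (n : ℝ) ^ K * f n) atTop (nhds 0) := hneg K
  have h2 : Tendsto (fun n : ℕ => (n : ℝ) ^ K * (5 / 8 : ℝ) ^ n) atTop (nhds 0) :=
    tendsto_pow_const_mul_const_pow_of_abs_lt_one K (by rw [abs_lt]; constructor <;> norm_num)
  have h3 : Tendsto (fun n : ℕ => (n : ℝ) ^ K * f n + (n : ℝ) ^ K * (5 / 8 : ℝ) ^ n) atTop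
      (nhds 0) := by simpa using h1.add h2
  have h4 : ∀ᶠ n : ℕ in atTop, c / 2 ≤ (n : ℝ) ^ K * f n + (n : ℝ) ^ K * (5 / 8 : ℝ) ^ n := by
    filter_upwards [h, eventually_ge_atTop 1] with n hn hn1
    have hpos : (0 : ℝ) < (n : ℝ) ^ K := by
      have : (0 : ℝ) < n := by exact_mod_cast hn1
      positivity
    have := mul_le_mul_of_nonneg_left hn hpos.le
    have e : (n : ℝ) ^ K * (1 / 2 * (c / (n : ℝ) ^ K - 2 * (5 / 8) ^ n)) =
        c / 2 - (n : ℝ) ^ K * (5 / 8) ^ n := by field_simp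
    linarith
  have := ge_of_tendsto h3 h4
  linarith

lemma not_negligible_of_isLocal1D (D : (n : ℕ) → Measure (Hamiltonian n × ℝ))
    [∀ n, IsProbabilityMeasure (D n)] {q : ℕ → ℕ}
    (hD : ∀ n, ∀ᵐ p ∂(D n), IsLocal1D (q n) p.1)
    (hq : (fun n => (q n : ℝ)) =O[atTop] (fun n : ℕ => Real.log n)) :
    ¬ Negligible (advantage swapExperiment fun n => evolutionEnsemble (D n)) := by
  obtain ⟨C, hC⟩ := hq.bound
  obtain ⟨m, hm⟩ := exists_nat_ge (C * Real.log 256)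
  refine not_negligible_of_le (c := 1 / 2 * (1 / 256) * (1 / 4) ^ 3) (by norm_num) (m + 3) ?_
  filter_upwards [hC, eventually_ge_atTop 2] with n hn hn2
  refine le_trans ?_ (le_advantage_of_isLocal1D D hn2 (hD n))
  have hn0 : (0 : ℝ) < n := by exact_mod_cast (show 0 < n by omega)
  have hlog : 0 ≤ Real.log n := Real.log_natCast_nonneg n
  have hq' : (q n : ℝ) ≤ C * Real.log n := by
    simpa [abs_of_nonneg hlog] using hn
  have h256 : (256 : ℝ) ^ q n ≤ (n : ℝ) ^ m := by
    rw [← Real.exp_log (show (0 : ℝ) < 256 ^ q n by positivity),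
      ← Real.exp_log (show (0 : ℝ) < (n : ℝ) ^ m by positivity), Real.exp_le_exp, Real.log_pow,
      Real.log_pow]
    have h0 : 0 ≤ Real.log 256 := Real.log_nonneg (by norm_num)
    nlinarith [mul_le_mul_of_nonneg_right hq' h0, mul_le_mul_of_nonneg_right hm hlog]
  have hpow : (1 : ℝ) / 256 * (1 / (n : ℝ) ^ m) ≤ (1 / 16) ^ (2 * (q n + 1)) := by
    have e : ((1 : ℝ) / 16) ^ (2 * (q n + 1)) = 1 / 256 * (1 / 256 ^ q n) := by
      rw [pow_mul, pow_succ]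
      norm_num [mul_comm]
      rw [one_div, inv_pow]
    rw [e]
    gcongr
  have hfin : 1 / 2 * (1 / 256) * (1 / 4) ^ 3 / (n : ℝ) ^ (m + 3) ≤
      1 / 2 * (1 / 16) ^ (2 * (q n + 1)) * (1 / (4 * (n : ℝ))) ^ 3 := by
    calc 1 / 2 * (1 / 256) * (1 / 4) ^ 3 / (n : ℝ) ^ (m + 3)
        = 1 / 2 * (1 / 256 * (1 / (n : ℝ) ^ m)) * (1 / (4 * (n : ℝ))) ^ 3 := by
          rw [pow_add]; field_simp
      _ ≤ _ := by gcongr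
  linarith

lemma not_negligible_of_isLocal (D : (n : ℕ) → Measure (Hamiltonian n × ℝ))
    [∀ n, IsProbabilityMeasure (D n)] {q : ℕ → ℕ}
    (hD : ∀ n, ∀ᵐ p ∂(D n), IsLocal (q n) p.1)
    (hq : (fun n => (q n : ℝ)) =O[atTop] (fun _ : ℕ => (1 : ℝ))) :
    ¬ Negligible (advantage swapExperiment fun n => evolutionEnsemble (D n)) := by
  obtain ⟨C, hC⟩ := hq.bound
  obtain ⟨m, hm⟩ := exists_nat_ge C
  refine not_negligible_of_le
    (c := 1 / 2 * (1 / 16) ^ (2 * (m + 1)) * (1 / 4) ^ (2 * (m + 1))) (by positivity)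
    (2 * (m + 1)) ?_
  filter_upwards [hC, eventually_ge_atTop 2] with n hn hn2
  have hq' : q n ≤ m := by
    have h1 : (q n : ℝ) ≤ m := by
      refine le_trans ?_ hm
      simpa using hn
    exact_mod_cast h1
  refine le_trans (le_of_eq ?_) (le_advantage_of_isLocal D hn2 (r := m + 1) (by omega) (hD n))
  have hn0 : (0 : ℝ) < n := by exact_mod_cast (show 0 < n by omega)
  have e : (1 / (4 * (n : ℝ))) ^ (2 * (m + 1)) =
      (1 / 4) ^ (2 * (m + 1)) / (n : ℝ) ^ (2 * (m + 1)) := by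
    rw [← div_pow, div_div]
  rw [e]
  ring

end NoGoPRU

end

theorem theorem2
    (D : (n : ℕ) → MeasureTheory.Measure (NoGoPRU.Hamiltonian n × ℝ))
    [∀ n, MeasureTheory.IsProbabilityMeasure (D n)] (q : ℕ → ℕ) :
    -- one-dimensional systems
    ((∀ n, ∀ᵐ p ∂(D n), NoGoPRU.IsLocal1D (q n) p.1) →
      (fun n => (q n : ℝ)) =O[Filter.atTop] (fun n : ℕ => Real.log n) →
      ¬ NoGoPRU.IsPRU (fun n => NoGoPRU.evolutionEnsemble (D n)) ∧
      ∃ A : NoGoPRU.Experiment, A.PolyTime ∧ (∀ n, (A n).ParallelQueries 2) ∧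
        ¬ NoGoPRU.Negligible
          (NoGoPRU.advantage A fun n => NoGoPRU.evolutionEnsemble (D n))) ∧
    -- all-to-all connected systems
    ((∀ n, ∀ᵐ p ∂(D n), NoGoPRU.IsLocal (q n) p.1) →
      (fun n => (q n : ℝ)) =O[Filter.atTop] (fun _ : ℕ => (1 : ℝ)) →
      ¬ NoGoPRU.IsPRU (fun n => NoGoPRU.evolutionEnsemble (D n)) ∧
      ∃ A : NoGoPRU.Experiment, A.PolyTime ∧ (∀ n, (A n).ParallelQueries 2) ∧
        ¬ NoGoPRU.Negligible
          (NoGoPRU.advantage A fun n => NoGoPRU.evolutionEnsemble (D n))) := by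
  have key : ¬ NoGoPRU.Negligible (NoGoPRU.advantage NoGoPRU.swapExperiment
      fun n => NoGoPRU.evolutionEnsemble (D n)) →
      ¬ NoGoPRU.IsPRU (fun n => NoGoPRU.evolutionEnsemble (D n)) ∧
      ∃ A : NoGoPRU.Experiment, A.PolyTime ∧ (∀ n, (A n).ParallelQueries 2) ∧
        ¬ NoGoPRU.Negligible
          (NoGoPRU.advantage A fun n => NoGoPRU.evolutionEnsemble (D n)) := fun h =>
    ⟨fun hPRU => h (hPRU _ NoGoPRU.swapExperiment_polyTime), NoGoPRU.swapExperiment,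
      NoGoPRU.swapExperiment_polyTime, fun n => NoGoPRU.swapCircuit_parallelQueries n _, h⟩
  exact ⟨fun hD hq => key (NoGoPRU.not_negligible_of_isLocal1D D hD hq),
    fun hD hq => key (NoGoPRU.not_negligible_of_isLocal D hD hq)⟩
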